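/- Consider the hinged beam equation $$u_{tt}+u_{xxxx}-\Big(m+\frac1{2\pi}\int_0^\pi u_x^2\,dx\Big)u_{xx}=0,\qquad x\in[0,\pi],$$ with $u=u_{xx}=0$ at $x=0,\pi$ and $u(0)=u_0$, $u_t(0)=v_0$. Let $\phi_j(x)=\sqrt{2/\pi}\,\sin jx$ and $u_j=\int_0^\pi u\phi_j\,dx$ for $j\ge1$, and $\omega_j=\sqrt{j^4+mj^2}$. Put $$|u|_\sigma^2=\sum_{j\ge1}j^{2\sigma}u_j^2,\qquad |v|_{\tilde H^{-1}}^2=\sum_{j\ge1}\frac{j^2}{\omega_j^2}v_j^2,\qquad |u|_{H^\sigma_N}^2=\sum_{j\le N}j^2u_j^2+\sum_{j>N}j^{2\sigma}u_j^2,$$ and let $H^\sigma_*$ be the space of functions $u=\sum_ju_j\phi_j$ with $|u|_\sigma<\infty$. Let $$\mu=\min\{2\sqrt{1+m},\tfrac32\sqrt{4+m}\},\quad \varepsilon_0=0.08\sqrt\mu,\quad \mathfrak c=1\text{ if }m\ge0,\quad \mathfrak c=(1+m)^{-1/2}\text{ if }m<0,$$ $$\varepsilon_1=\min\Big\{\varepsilon_0,\Big(\frac{|m|\mu}{3222\,\mathfrak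 c^2}\Big)^{1/4}\Big\},\qquad T_1=T_1(\varepsilon)=\frac{|m|\mu}{6595\,\mathfrak c^3\Big(1+30\frac{\mathfrak c}{|m|\mu}\varepsilon^2+90\frac{\mathfrak c}{\mu}\varepsilon^2\Big)}.$$ Let $s>1/2$, $u_0\in H^{s+2}_*$, $v_0\in H^s_*$. A weak solution on an open interval $I\ni0$ is a function $u$ with $u\in C(I;H^{s+2}_*)\cap C^1(I;H^s_*)$, $u(0)=u_0$, $u_t(0)=v_0$, such that for every $\eta\in C_c^\infty((0,\pi))$ the function $t\mapsto\int_0^\pi u_t\eta\,dx$ is differentiable on $I$ with $$\frac{d}{dt}\int_0^\pi u_t\eta\,dx+\int_0^\pi\Big[u_{xx}\eta_{xx}+\Big(m+\frac1{2\pi}\int_0^\pi u_x^2\Big)u_x\eta_x\Big]dx=0\qquad\text{for all }t\in I .$$ Theorem. Assume $-1/2\le m\le1$ and $m\ne0$. Then a weak solution exists for all $t\in\mathbb R$, and: (a) If $\varepsilon:=\max\{|u_0|_1,\ |v_0|_0/(1+m)\}\le\varepsilon_1$, then every weak solution on an interval $I$ satisfies $\sup_{x\in[0,\pi]}|u(t,x)|\le2.1\,\varepsilon$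 for all $t\in I$ with $|t|\le T_1\varepsilon^{-6}$. (b) If $\varepsilon:=\max\{|u_0|_1,\ |v_0|_{\tilde H^{-1}}\}\le\varepsilon_1$, then there is $N\ge1$, depending on the data only, such that every weak solution on an interval $I$ satisfies, for all $t\in I$ with $|t|\le T_1\varepsilon^{-6}$, $$u(t,\cdot)\in H^{s+2}_*,\qquad |u(t,\cdot)|_{H^{s+2}_N}\le2\varepsilon,\qquad \sup_{x\in[0,\pi]}|u(t,x)|\le2.1\,\varepsilon .$$ If $\varepsilon=0$, the condition $|t|\le T_1\varepsilon^{-6}$ is understood to hold for all $t$. -/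

import Mathlib

open Set Filter Topology
open scoped ContDiff

namespace Beam

noncomputable section

/-- The eigenfunctions `φ_j(x) = √(2/π) sin(jx)`, `j = 1, 2, 3, …`. -/
def phi (j : ℕ+) (x : ℝ) : ℝ := Real.sqrt (2 / Real.pi) * Real.sin ((j : ℝ) * x)

/-- The sine coefficient `u_j = ∫₀^π u φ_j dx`. -/
def coeff (u : ℝ → ℝ) (j : ℕ+) : ℝ := ∫ x in (0 : ℝ)..Real.pi, u x * phi j x

/-- `u ∈ H^s_*` (used for `s > 1/2` only): on `[0, π]` the function `u` is the sum of its series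
`∑ u_j φ_j` and `∑ j^{2s} u_j² < ∞`. For `s > 1/2` the series converges absolutely and uniformly,
so this singles out the continuous representative. Values of `u` outside `[0, π]` are irrelevant. -/
def MemH (s : ℝ) (u : ℝ → ℝ) : Prop :=
  Summable (fun j : ℕ+ => (j : ℝ) ^ (2 * s) * coeff u j ^ 2) ∧
    ∀ x ∈ Icc 0 Real.pi, HasSum (fun j : ℕ+ => coeff u j * phi j x) (u x)

/-- The norm `|u|_s = (∑ j^{2s} u_j²)^{1/2}`. -/
def normH (s : ℝ) (u : ℝ → ℝ) : ℝ :=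
  Real.sqrt (∑' j : ℕ+, (j : ℝ) ^ (2 * s) * coeff u j ^ 2)

/-- The equivalent norm `|u|_{H^s_N}`, with
`|u|²_{H^s_N} = ∑_{j ≤ N} j² u_j² + ∑_{j > N} j^{2s} u_j²`. -/
def normHN (s : ℝ) (N : ℕ) (u : ℝ → ℝ) : ℝ :=
  Real.sqrt (∑' j : ℕ+, (if (j : ℕ) ≤ N then (j : ℝ) ^ 2 else (j : ℝ) ^ (2 * s)) * coeff u j ^ 2)

/-- The linear frequencies `ω_j = √(j⁴ + m j²)`. -/
def omega (m : ℝ) (j : ℕ+) : ℝ := Real.sqrt ((j : ℝ) ^ 4 + m * (j : ℝ) ^ 2)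

/-- The weak norm `|v|_{H̃^{-1}} = (∑ (j² / ω_j²) v_j²)^{1/2}`. -/
def normHTilde (m : ℝ) (v : ℝ → ℝ) : ℝ :=
  Real.sqrt (∑' j : ℕ+, (j : ℝ) ^ 2 / omega m j ^ 2 * coeff v j ^ 2)

/-- Test functions `η ∈ C_c^∞((0, π))`. -/
def IsTest (η : ℝ → ℝ) : Prop :=
  ContDiff ℝ ∞ η ∧ HasCompactSupport η ∧ tsupport η ⊆ Ioo 0 Real.pi

/-- The spatial part of the weak form of the beam equation:
`∫₀^π [u_xx η_xx + (m + (1/2π) ∫₀^π u_x²) u_x η_x] dx`. For `u ∈ H^{s+2}_*`, `s > 1/2`,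
the function `u` is `C²` on `[0, π]`, so the derivatives are classical ones. -/
def weakForm (m : ℝ) (u η : ℝ → ℝ) : ℝ :=
  ∫ x in (0 : ℝ)..Real.pi,
    (deriv (deriv u) x * deriv (deriv η) x +
      (m + 1 / (2 * Real.pi) * ∫ y in (0 : ℝ)..Real.pi, deriv u y ^ 2) * deriv u x * deriv η x)

/-- `u` is a weak solution on the open time interval `I ∋ 0` of
`u_tt + u_xxxx - (m + (1/2π) ∫₀^π u_x² dx) u_xx = 0`, hinged at `x = 0, π`, with
`u(0) = u₀`, `u_t(0) = v₀`: `t ↦ u(t)` is continuous into `H^{s+2}_*` and continuously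
differentiable into `H^s_*`, with derivative `ut`, and for every test function `η` the function
`t ↦ ∫ u_t η dx` is differentiable on `I`, its derivative `∫ u_tt η dx` being such that
`∫ [u_tt η + u_xx η_xx + (m + (1/2π) ∫ u_x²) u_x η_x] dx = 0`. -/
def IsWeakSolution (m s : ℝ) (u₀ v₀ : ℝ → ℝ) (I : Set ℝ) (u : ℝ → ℝ → ℝ) : Prop :=
  IsOpen I ∧ I.OrdConnected ∧ (0 : ℝ) ∈ I ∧
  ∃ ut : ℝ → ℝ → ℝ,
    (∀ t ∈ I, MemH (s + 2) (u t)) ∧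
    (∀ t ∈ I, Tendsto (fun τ => normH (s + 2) (fun x => u τ x - u t x)) (𝓝 t) (𝓝 0)) ∧
    (∀ t ∈ I, MemH s (ut t)) ∧
    (∀ t ∈ I, Tendsto (fun τ => normH s (fun x => ut τ x - ut t x)) (𝓝 t) (𝓝 0)) ∧
    (∀ t ∈ I, Tendsto
      (fun τ => normH s (fun x => (τ - t)⁻¹ * (u τ x - u t x) - ut t x)) (𝓝[≠] t) (𝓝 0)) ∧
    (∀ x ∈ Icc 0 Real.pi, u 0 x = u₀ x) ∧
    (∀ x ∈ Icc 0 Real.pi, ut 0 x = v₀ x) ∧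
    (∀ η : ℝ → ℝ, IsTest η → ∀ t ∈ I,
      HasDerivAt (fun τ => ∫ x in (0 : ℝ)..Real.pi, ut τ x * η x) (-weakForm m (u t) η) t)

/-- `μ = min {2 √(1+m), (3/2) √(4+m)}`. -/
def mu (m : ℝ) : ℝ := min (2 * Real.sqrt (1 + m)) (3 / 2 * Real.sqrt (4 + m))

/-- `ε₀ = 0.08 √μ`. -/
def eps0 (m : ℝ) : ℝ := 0.08 * Real.sqrt (mu m)

/-- `𝔠 = 1` if `m ≥ 0` and `𝔠 = (1+m)^{-1/2}` if `m < 0`. -/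
def cc (m : ℝ) : ℝ := if 0 ≤ m then 1 else (Real.sqrt (1 + m))⁻¹

/-- `ε₁ = min {ε₀, (|m| μ / (3222 𝔠²))^{1/4}}`. -/
def eps1 (m : ℝ) : ℝ := min (eps0 m) ((|m| * mu m / (3222 * cc m ^ 2)) ^ (1 / 4 : ℝ))

/-- `T₁ = |m| μ / (6595 𝔠³ (1 + 30 (𝔠 / (|m| μ)) ε² + 90 (𝔠 / μ) ε²))`. -/
def T1 (m ε : ℝ) : ℝ :=
  |m| * mu m /
    (6595 * cc m ^ 3 * (1 + 30 * (cc m / (|m| * mu m)) * ε ^ 2 + 90 * (cc m / mu m) * ε ^ 2))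

end

end Beam

/-! In the coordinates `p_j = j u_j`, `q_j = j v_j / ω_j` the equation becomes `p_j' = ω_j q_j`,
`q_j' = -(ω_j + a b_j) p_j` with `b_j = j² / ω_j` and the scalar `a = (1/2π) ∑ p_j²`. The modes
interact only through `a`. The quantity to control is the low norm `E = ∑ (p_j² + q_j²)`. The
conserved energy does not do this: its quadratic part is `∑ (j² + m)(p_j² + q_j²)`, which the
hypotheses do not make small.

With `z_j = p_j + i q_j`, the monomials `|z_j|²`, `z_j²`, `z̄_j²` satisfy a linear system with
purely imaginary frequencies `0`, `∓2iω_j` and a coupling multiplied by `a`, and both `a` and `E`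
are linear in these monomials. Hence `E'` is quadratic in them, of order `ε⁴`. Dividing the
coefficients by the frequencies of products of two, then of three monomials (two normal form steps)
adds to `E` corrections of order `ε⁴` and `ε⁶` and leaves a derivative of order `ε⁸`. Over times of
order `ε⁻⁶` the change of `E` is then a small multiple of `ε²`.

Two facts make the division possible. Terms of zero frequency are real products such as
`|z_j|²|z_k|²` or `|z_j|⁴`; the coefficients are real and odd under conjugation, so these terms
cancel in pairs (`sum_resonant_eq_zero`). The remaining frequencies are bounded below: for pairs by
the spectral gap (`paired_or_le`), for triples because `ω_j + ω_k - ω_l` is an integer plus `m/2`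
plus a smaller error (`omega_nonresonant`), which is where `m ≠ 0` enters. The estimate is
`norm_sub_le_of_normalForm`; a continuity argument closes it in `energy_le_of_small`, uniformly in
the finite number of modes.

Cutting the data off to finitely many modes gives exact solutions, global by conservation of energy.
Since `b_j` is bounded, Gronwall's inequality controls every mode by its own initial size with a
factor independent of `j`. This gives stability, uniqueness, convergence as the cut-off is removed
(`exists_mode_solution`), and uniformly small tails of the strong norm, whence `N`.

The mode equations are equivalent to the weak formulation. In one direction they are obtained by
testing with cut-offs of `φ_k` (`hasDerivAt_coeff_velocity`), the boundary layers being harmless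
since `u_xx` vanishes at the end points; in the other the sine series is differentiated termwise
(`hasDerivAt_integral_velocity`). So every weak solution has the modes constructed, and the bound on
`E` gives the sup bound by Cauchy–Schwarz with `∑ j⁻² = π²/6`. -/

namespace Beam

/-! ### Linear systems of monomials and the homological equation -/

open Complex ComplexConjugate

/-- The linear data of a finite family of monomials `x_α` that evolve by
`x_α' = i (λ_α x_α + a ∑_β M_{αβ} x_β)` with a scalar function `a`; `flip` is complex
conjugation of monomials. -/
structure PhaseSystem (A : Type) [Fintype A] where
  freq : A → ℝ
  coupling : A → A → ℝ
  flip : A ≃ A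
  freq_flip : ∀ α, freq (flip α) = -freq α
  coupling_flip : ∀ α β, coupling (flip α) (flip β) = -coupling α β

namespace PhaseSystem

variable {A B : Type} [Fintype A] [Fintype B]

/-- `x` satisfies the equations of the system at time `t`. -/
structure IsOrbitAt (S : PhaseSystem A) (a : ℝ → ℝ) (x : ℝ → A → ℂ) (t : ℝ) : Prop where
  hasDerivAt : ∀ α, HasDerivAt (fun τ => x τ α)
    (I * (S.freq α * x t α + a t * ∑ β, S.coupling α β * x t β)) t
  apply_flip : ∀ α, x t (S.flip α) = conj (x t α)

/-- The weights `r` majorize `|M| r` up to the factor `K`. -/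
structure IsMajorant (S : PhaseSystem A) (K : ℝ) (r : A → ℝ) : Prop where
  nonneg : ∀ α, 0 ≤ r α
  sum_le : ∀ α, ∑ β, |S.coupling α β| * r β ≤ K * r α

/-- The system of products of monomials. -/
def prod [DecidableEq A] [DecidableEq B] (S : PhaseSystem A) (S' : PhaseSystem B) :
    PhaseSystem (A × B) where
  freq α := S.freq α.1 + S'.freq α.2
  coupling α β := (if α.2 = β.2 then S.coupling α.1 β.1 else 0) +
    (if α.1 = β.1 then S'.coupling α.2 β.2 else 0)
  flip := Equiv.prodCongr S.flip S'.flip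
  freq_flip α := by simp [S.freq_flip, S'.freq_flip]; ring
  coupling_flip α β := by
    simp only [Equiv.prodCongr_apply, Prod.map, EmbeddingLike.apply_eq_iff_eq, S.coupling_flip,
      S'.coupling_flip]
    split_ifs <;> ring

section prod

variable [DecidableEq A] [DecidableEq B] (S : PhaseSystem A) (S' : PhaseSystem B)

theorem sum_prod_coupling {R : Type} [CommRing R] (f : ℝ → R) (hf : f 0 = 0)
    (hadd : ∀ u v, f (u + v) = f u + f v) (α : A × B) (x : A → R) (y : B → R) :
    ∑ β, f ((S.prod S').coupling α β) * (x β.1 * y β.2) =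
      (∑ β, f (S.coupling α.1 β) * x β) * y α.2 + x α.1 * ∑ β, f (S'.coupling α.2 β) * y β := by
  simp only [prod, hadd, add_mul, Finset.sum_add_distrib, Fintype.sum_prod_type]
  congr 1
  · rw [Finset.sum_mul]
    refine Finset.sum_congr rfl fun β _ => ?_
    rw [Finset.sum_eq_single α.2]
    · simp [mul_assoc]
    · intro b _ hb; simp [hb.symm, hf]
    · simp
  · rw [Finset.sum_eq_single α.1]
    · rw [Finset.mul_sum]
      refine Finset.sum_congr rfl fun β _ => ?_
      simp; ring
    · intro b _ hb; simp [hb.symm, hf]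
    · simp

variable {S S'}

theorem IsOrbitAt.prod {a : ℝ → ℝ} {x : ℝ → A → ℂ} {y : ℝ → B → ℂ} {t : ℝ}
    (hx : S.IsOrbitAt a x t) (hy : S'.IsOrbitAt a y t) :
    (S.prod S').IsOrbitAt a (fun τ α => x τ α.1 * y τ α.2) t where
  hasDerivAt α := by
    refine ((hx.hasDerivAt α.1).mul (hy.hasDerivAt α.2)).congr_deriv ?_
    rw [sum_prod_coupling S S' (fun u : ℝ => (u : ℂ)) (by simp) (by simp) α (x t) (y t)]
    simp only [PhaseSystem.prod]
    push_cast
    ring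
  apply_flip α := by
    simp [PhaseSystem.prod, hx.apply_flip, hy.apply_flip]

/-- The coupling of a product acts as a derivation, so the two factors add. This is the origin of
the constants `2 * K` and `3 * K` in the normal form estimate. -/
theorem IsMajorant.prod {K K' : ℝ} {r : A → ℝ} {r' : B → ℝ} (h : S.IsMajorant K r)
    (h' : S'.IsMajorant K' r') :
    (S.prod S').IsMajorant (K + K') (fun α => r α.1 * r' α.2) where
  nonneg α := mul_nonneg (h.nonneg _) (h'.nonneg _)
  sum_le α := by
    have hle : ∑ β, |(S.prod S').coupling α β| * (r β.1 * r' β.2) ≤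
        ∑ β : A × B, ((if α.2 = β.2 then |S.coupling α.1 β.1| else 0) +
          (if α.1 = β.1 then |S'.coupling α.2 β.2| else 0)) * (r β.1 * r' β.2) := by
      refine Finset.sum_le_sum fun β _ => mul_le_mul_of_nonneg_right ?_
        (mul_nonneg (h.nonneg _) (h'.nonneg _))
      refine (abs_add_le _ _).trans (le_of_eq ?_)
      congr 1 <;> split_ifs <;> simp
    refine hle.trans ?_
    have e : ∑ β : A × B, ((if α.2 = β.2 then |S.coupling α.1 β.1| else 0) +
          (if α.1 = β.1 then |S'.coupling α.2 β.2| else 0)) * (r β.1 * r' β.2) =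
        (∑ β, |S.coupling α.1 β| * r β) * r' α.2 + r α.1 * ∑ β, |S'.coupling α.2 β| * r' β := by
      simp only [add_mul, Finset.sum_add_distrib, Fintype.sum_prod_type]
      congr 1
      · rw [Finset.sum_mul]
        refine Finset.sum_congr rfl fun β _ => ?_
        rw [Finset.sum_eq_single α.2]
        · simp [mul_assoc]
        · intro b _ hb; simp [hb.symm]
        · simp
      · rw [Finset.sum_eq_single α.1]
        · rw [Finset.mul_sum]
          refine Finset.sum_congr rfl fun β _ => ?_
          simp; ring
        · intro b _ hb; simp [hb.symm]
        · simp
    rw [e]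
    nlinarith [mul_le_mul_of_nonneg_right (h.sum_le α.1) (h'.nonneg α.2),
      mul_le_mul_of_nonneg_left (h'.sum_le α.2) (h.nonneg α.1)]

end prod

variable (S : PhaseSystem A)

/-- The coefficients of `∑ g_α (M x)_α`. -/
def push (g : A → ℝ) (β : A) : ℝ := ∑ α, g α * S.coupling α β

/-- The solution of the homological equation; resonant coefficients are set to zero. -/
noncomputable def solve (f : A → ℝ) (α : A) : ℝ := f α / S.freq α

variable {S}

/-- Parity bookkeeping: `push` turns even coefficients into odd ones because the coupling is odd,
and `solve` turns odd ones back into even ones because the frequencies are odd. The cancellation of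
resonant terms is therefore available at every step. -/
theorem push_flip {g : A → ℝ} (hg : ∀ α, g (S.flip α) = g α) (β : A) :
    S.push g (S.flip β) = -S.push g β := by
  unfold push
  rw [← Equiv.sum_comp S.flip, ← Finset.sum_neg_distrib]
  exact Finset.sum_congr rfl fun α _ => by rw [hg, S.coupling_flip]; ring

theorem solve_flip {f : A → ℝ} (hf : ∀ α, f (S.flip α) = -f α) (α : A) :
    S.solve f (S.flip α) = S.solve f α := by
  simp [solve, hf, S.freq_flip]

/-- Duality: `push` is the transpose of the coupling, so a weighted row bound on the coupling is an
operator bound on coefficients in the `ℓ¹` norm with weight `r`. -/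
theorem IsMajorant.sum_push_le {K : ℝ} {r : A → ℝ} (h : S.IsMajorant K r) (g : A → ℝ) :
    ∑ β, |S.push g β| * r β ≤ K * ∑ α, |g α| * r α := by
  calc ∑ β, |S.push g β| * r β ≤ ∑ β, ∑ α, |g α| * (|S.coupling α β| * r β) := by
        refine Finset.sum_le_sum fun β _ => ?_
        rw [push]
        refine (mul_le_mul_of_nonneg_right (Finset.abs_sum_le_sum_abs _ _) (h.nonneg β)).trans ?_
        rw [Finset.sum_mul]
        exact Finset.sum_le_sum fun α _ => by rw [abs_mul, mul_assoc]
    _ = ∑ α, |g α| * ∑ β, |S.coupling α β| * r β := by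
        rw [Finset.sum_comm]; simp_rw [Finset.mul_sum]
    _ ≤ ∑ α, |g α| * (K * r α) :=
        Finset.sum_le_sum fun α _ => mul_le_mul_of_nonneg_left (h.sum_le α) (abs_nonneg _)
    _ = K * ∑ α, |g α| * r α := by
        rw [Finset.mul_sum]; exact Finset.sum_congr rfl fun α _ => by ring

theorem sum_solve_le {δ : ℝ} (hδ : 0 < δ) (hS : ∀ α, S.freq α = 0 ∨ δ ≤ |S.freq α|)
    {r : A → ℝ} (hr : ∀ α, 0 ≤ r α) (f : A → ℝ) :
    ∑ α, |S.solve f α| * r α ≤ δ⁻¹ * ∑ α, |f α| * r α := by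
  rw [Finset.mul_sum]
  refine Finset.sum_le_sum fun α _ => ?_
  rw [← mul_assoc]
  refine mul_le_mul_of_nonneg_right ?_ (hr α)
  rw [solve, abs_div]
  rcases hS α with h | h
  · simp [h]; positivity
  · rw [div_eq_mul_inv, mul_comm]
    exact mul_le_mul_of_nonneg_right (inv_anti₀ hδ h) (abs_nonneg _)

/-- Flipping preserves the set of zero frequencies, fixes the real value `x α` and changes the sign
of `f α`; the sum equals its own negative. -/
theorem sum_resonant_eq_zero {f : A → ℝ} (hf : ∀ α, f (S.flip α) = -f α) {x : A → ℂ}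
    (hx : ∀ α, x (S.flip α) = conj (x α)) (hres : ∀ α, S.freq α = 0 → (x α).im = 0) :
    ∑ α, (if S.freq α = 0 then (f α : ℂ) * x α else 0) = 0 := by
  have h : ∑ α, (if S.freq α = 0 then (f α : ℂ) * x α else 0) =
      -∑ α, (if S.freq α = 0 then (f α : ℂ) * x α else 0) := by
    conv_lhs => rw [← Equiv.sum_comp S.flip]
    rw [← Finset.sum_neg_distrib]
    refine Finset.sum_congr rfl fun α _ => ?_
    simp only [S.freq_flip, neg_eq_zero, hf, hx]
    split_ifs with h
    · rw [Complex.conj_eq_iff_im.2 (hres α h)]; push_cast; ring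
    · simp
  exact self_eq_neg.1 h

theorem sum_sum_coupling (g : A → ℝ) (x : A → ℂ) :
    ∑ α, (g α : ℂ) * ∑ β, (S.coupling α β : ℂ) * x β = ∑ β, (S.push g β : ℂ) * x β := by
  simp only [push, Finset.mul_sum, Complex.ofReal_sum, Finset.sum_mul, Complex.ofReal_mul]
  rw [Finset.sum_comm]
  exact Finset.sum_congr rfl fun β _ => Finset.sum_congr rfl fun α _ => by ring

theorem IsOrbitAt.hasDerivAt_sum {a : ℝ → ℝ} {x : ℝ → A → ℂ} {t : ℝ} (hx : S.IsOrbitAt a x t)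
    (g : A → ℝ) :
    HasDerivAt (fun τ => ∑ α, (g α : ℂ) * x τ α)
      (I * (∑ α, ((g α * S.freq α : ℝ) : ℂ) * x t α + a t * ∑ β, (S.push g β : ℂ) * x t β)) t := by
  refine (HasDerivAt.fun_sum fun α _ => (hx.hasDerivAt α).const_mul (g α : ℂ)).congr_deriv ?_
  rw [← sum_sum_coupling, Finset.mul_sum, ← Finset.sum_add_distrib, Finset.mul_sum]
  refine Finset.sum_congr rfl fun α _ => ?_
  push_cast
  ring

/-- The homological equation: `∑ f_α x_α / λ_α` is a primitive of `i ∑ f_α x_α` up to higher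
order, the resonant terms of an odd `f` adding up to zero. -/
theorem IsOrbitAt.hasDerivAt_solve {a : ℝ → ℝ} {x : ℝ → A → ℂ} {t : ℝ} (hx : S.IsOrbitAt a x t)
    {f : A → ℝ} (hf : ∀ α, f (S.flip α) = -f α) (hres : ∀ α, S.freq α = 0 → (x t α).im = 0) :
    HasDerivAt (fun τ => ∑ α, (S.solve f α : ℂ) * x τ α)
      (I * (∑ α, (f α : ℂ) * x t α + a t * ∑ β, (S.push (S.solve f) β : ℂ) * x t β)) t := by
  refine (hx.hasDerivAt_sum _).congr_deriv ?_
  congr 2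
  have h := sum_resonant_eq_zero hf hx.apply_flip hres
  rw [← add_zero (∑ α, _ * _), ← h, ← Finset.sum_add_distrib]
  refine Finset.sum_congr rfl fun α _ => ?_
  by_cases h0 : S.freq α = 0
  · simp [h0]
  · simp [h0, solve]

theorem norm_sum_le {r : A → ℝ} {x : A → ℂ} (hx : ∀ α, ‖x α‖ ≤ r α) (g : A → ℝ) :
    ‖∑ α, (g α : ℂ) * x α‖ ≤ ∑ α, |g α| * r α := by
  refine (_root_.norm_sum_le _ _).trans (Finset.sum_le_sum fun α _ => ?_)
  rw [norm_mul, Complex.norm_real, Real.norm_eq_abs]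
  exact mul_le_mul_of_nonneg_left (hx α) (abs_nonneg _)

end PhaseSystem

end Beam

/-! ### Two steps of normal form -/

namespace Beam

open Complex ComplexConjugate

namespace PhaseSystem

variable {A : Type} [Fintype A]

/-- Coefficients of the product of the linear forms with coefficients `c` and `h`. -/
def outer {B : Type} (c : A → ℝ) (h : B → ℝ) (α : A × B) : ℝ := c α.1 * h α.2

theorem sum_outer {B : Type} [Fintype B] (c : A → ℝ) (h : B → ℝ) (x : A → ℂ) (y : B → ℂ) :
    ∑ α, (outer c h α : ℂ) * (x α.1 * y α.2) =
      (∑ α, (c α : ℂ) * x α) * ∑ β, (h β : ℂ) * y β := by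
  rw [Finset.sum_mul_sum, Fintype.sum_prod_type]
  refine Finset.sum_congr rfl fun α _ => Finset.sum_congr rfl fun β _ => ?_
  simp only [outer]; push_cast; ring

theorem sum_abs_outer {B : Type} [Fintype B] (c : A → ℝ) (h : B → ℝ) (x : A → ℝ) (y : B → ℝ) :
    ∑ α, |outer c h α| * (x α.1 * y α.2) = (∑ α, |c α| * x α) * ∑ β, |h β| * y β := by
  rw [Finset.sum_mul_sum, Fintype.sum_prod_type]
  refine Finset.sum_congr rfl fun α _ => Finset.sum_congr rfl fun β _ => ?_
  simp only [outer, abs_mul]; ring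

theorem outer_flip [DecidableEq A] {B : Type} [Fintype B] [DecidableEq B]
    {S : PhaseSystem A} {S' : PhaseSystem B}
    {c : A → ℝ} {h : B → ℝ} (hc : ∀ α, c (S.flip α) = c α) (hh : ∀ β, h (S'.flip β) = -h β)
    (α : A × B) : outer c h ((S.prod S').flip α) = -outer c h α := by
  simp [outer, prod, hc, hh]

/-- Two steps of normal form. The quantity `∑ e_α x_α` of resonant monomials changes, up to
boundary terms, only at the rate of the terms left over after solving the homological equation
for products of two and of three monomials. -/
theorem norm_sub_le_of_normalForm [DecidableEq A] (S : PhaseSystem A) {K P Q μ δ : ℝ}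
    (hK : 0 ≤ K) (hP : 0 ≤ P)
    (hμ : 0 < μ) (hδ : 0 < δ) {a : ℝ → ℝ} {x : ℝ → A → ℂ} {r : ℝ → A → ℝ}
    {c e : A → ℝ} (hc : ∀ α, c (S.flip α) = c α) (he : ∀ α, e (S.flip α) = e α)
    (heS : ∀ α, e α * S.freq α = 0)
    (h2 : ∀ α, (S.prod S).freq α = 0 ∨ μ ≤ |(S.prod S).freq α|)
    (h3 : ∀ α, (S.prod (S.prod S)).freq α = 0 ∨ δ ≤ |(S.prod (S.prod S)).freq α|)
    {t₀ t₁ : ℝ} (hx : ∀ t ∈ uIcc t₀ t₁, S.IsOrbitAt a x t)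
    (ha : ∀ t ∈ uIcc t₀ t₁, (a t : ℂ) = ∑ α, (c α : ℂ) * x t α)
    (hr : ∀ t ∈ uIcc t₀ t₁, S.IsMajorant K (r t))
    (hxr : ∀ t ∈ uIcc t₀ t₁, ∀ α, ‖x t α‖ ≤ r t α)
    (hcr : ∀ t ∈ uIcc t₀ t₁, ∑ α, |c α| * r t α ≤ P)
    (her : ∀ t ∈ uIcc t₀ t₁, ∑ α, |e α| * r t α ≤ Q)
    (hres2 : ∀ t ∈ uIcc t₀ t₁, ∀ α, (S.prod S).freq α = 0 → (x t α.1 * x t α.2).im = 0)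
    (hres3 : ∀ t ∈ uIcc t₀ t₁, ∀ α, (S.prod (S.prod S)).freq α = 0 →
      (x t α.1 * (x t α.2.1 * x t α.2.2)).im = 0) :
    ‖∑ α, (e α : ℂ) * x t₁ α - ∑ α, (e α : ℂ) * x t₀ α‖ ≤
      2 * (μ⁻¹ * (P * (K * Q)) + δ⁻¹ * (P * (2 * K * (μ⁻¹ * (P * (K * Q)))))) +
        P * (3 * K * (δ⁻¹ * (P * (2 * K * (μ⁻¹ * (P * (K * Q))))))) * |t₁ - t₀| := by
  set f₂ := outer c (S.push e) with hf₂
  set g₂ := (S.prod S).solve f₂ with hg₂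
  set f₃ := outer c ((S.prod S).push g₂) with hf₃
  set g₃ := (S.prod (S.prod S)).solve f₃ with hg₃
  -- The coefficients `c` of `a` are even, so multiplication by `a` preserves parity and both
  -- right-hand sides are odd.
  have f₂odd : ∀ α, f₂ ((S.prod S).flip α) = -f₂ α := outer_flip hc (push_flip he)
  have f₃odd : ∀ α, f₃ ((S.prod (S.prod S)).flip α) = -f₃ α :=
    outer_flip hc (push_flip (solve_flip f₂odd))
  set x₂ : ℝ → A × A → ℂ := fun τ α => x τ α.1 * x τ α.2 with hx₂
  set x₃ : ℝ → A × (A × A) → ℂ := fun τ α => x τ α.1 * x₂ τ α.2 with hx₃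
  -- Cost of each operation in the weighted `ℓ¹` norm: a factor `P` for multiplication by `a`, a
  -- factor `K` per monomial for `push`, and `μ⁻¹` or `δ⁻¹` for division by the frequencies.
  have e₂ : ∀ t ∈ uIcc t₀ t₁, ∑ α, |g₂ α| * (r t α.1 * r t α.2) ≤ μ⁻¹ * (P * (K * Q)) := by
    intro t ht
    refine (sum_solve_le hμ h2 ((hr t ht).prod (hr t ht)).nonneg f₂).trans ?_
    refine mul_le_mul_of_nonneg_left ?_ (by positivity)
    rw [hf₂, sum_abs_outer]
    refine mul_le_mul (hcr t ht) (((hr t ht).sum_push_le e).trans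
      (mul_le_mul_of_nonneg_left (her t ht) hK)) ?_ hP
    exact Finset.sum_nonneg fun α _ => mul_nonneg (abs_nonneg _) ((hr t ht).nonneg α)
  have e₂' : ∀ t ∈ uIcc t₀ t₁, ∑ α, |(S.prod S).push g₂ α| * (r t α.1 * r t α.2) ≤
      2 * K * (μ⁻¹ * (P * (K * Q))) := by
    intro t ht
    refine (((hr t ht).prod (hr t ht)).sum_push_le g₂).trans ?_
    rw [two_mul K]
    exact mul_le_mul_of_nonneg_left (e₂ t ht) (by positivity)
  have e₃ : ∀ t ∈ uIcc t₀ t₁, ∑ α, |g₃ α| * (r t α.1 * (r t α.2.1 * r t α.2.2)) ≤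
      δ⁻¹ * (P * (2 * K * (μ⁻¹ * (P * (K * Q))))) := by
    intro t ht
    refine (sum_solve_le hδ h3 ((hr t ht).prod ((hr t ht).prod (hr t ht))).nonneg f₃).trans ?_
    refine mul_le_mul_of_nonneg_left ?_ (by positivity)
    rw [hf₃, sum_abs_outer c ((S.prod S).push g₂) (r t) (fun α => r t α.1 * r t α.2)]
    refine mul_le_mul (hcr t ht) (e₂' t ht) ?_ hP
    exact Finset.sum_nonneg fun α _ => mul_nonneg (abs_nonneg _)
      (((hr t ht).prod (hr t ht)).nonneg α)
  have e₃' : ∀ t ∈ uIcc t₀ t₁, ∑ α, |(S.prod (S.prod S)).push g₃ α| *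
      (r t α.1 * (r t α.2.1 * r t α.2.2)) ≤
      3 * K * (δ⁻¹ * (P * (2 * K * (μ⁻¹ * (P * (K * Q)))))) := by
    intro t ht
    refine (((hr t ht).prod ((hr t ht).prod (hr t ht))).sum_push_le g₃).trans ?_
    rw [show 3 * K = K + (K + K) by ring]
    exact mul_le_mul_of_nonneg_left (e₃ t ht) (by positivity)
  have hxr₂ : ∀ t ∈ uIcc t₀ t₁, ∀ α, ‖x₂ t α‖ ≤ r t α.1 * r t α.2 := by
    intro t ht α
    rw [hx₂, norm_mul]
    exact mul_le_mul (hxr t ht _) (hxr t ht _) (norm_nonneg _) ((hr t ht).nonneg _)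
  have hxr₃ : ∀ t ∈ uIcc t₀ t₁, ∀ α, ‖x₃ t α‖ ≤ r t α.1 * (r t α.2.1 * r t α.2.2) := by
    intro t ht α
    rw [hx₃, norm_mul]
    exact mul_le_mul (hxr t ht _) (hxr₂ t ht _) (norm_nonneg _) ((hr t ht).nonneg _)
  have ha' : ∀ t ∈ uIcc t₀ t₁, |a t| ≤ P := by
    intro t ht
    have := norm_sum_le (hxr t ht) c
    rw [← ha t ht, Complex.norm_real] at this
    exact this.trans (hcr t ht)
  -- The corrected quantity. The derivative of `∑ e x` has no linear part by `heS`; the `g₂` term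
  -- removes its quadratic part and creates a cubic one, which the `g₃` term removes. Only the last
  -- `push` survives.
  let F : ℝ → ℂ := fun t => ∑ α, (e α : ℂ) * x t α - ∑ α, (g₂ α : ℂ) * x₂ t α +
    ∑ α, (g₃ α : ℂ) * x₃ t α
  have hF : ∀ t ∈ uIcc t₀ t₁, HasDerivAt F
      (I * (a t * ∑ β, ((S.prod (S.prod S)).push g₃ β : ℂ) * x₃ t β)) t := by
    intro t ht
    have d₁ := (hx t ht).hasDerivAt_sum e
    have d₂ := ((hx t ht).prod (hx t ht)).hasDerivAt_solve f₂odd (hres2 t ht)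
    have d₃ := ((hx t ht).prod ((hx t ht).prod (hx t ht))).hasDerivAt_solve f₃odd (hres3 t ht)
    refine ((d₁.sub d₂).add d₃).congr_deriv ?_
    have s₂ : ∑ α, (f₂ α : ℂ) * (x t α.1 * x t α.2) = a t * ∑ β, (S.push e β : ℂ) * x t β := by
      rw [ha t ht, hf₂, sum_outer]
    have s₃ : ∑ α, (f₃ α : ℂ) * (x t α.1 * (x t α.2.1 * x t α.2.2)) =
        a t * ∑ β, ((S.prod S).push g₂ β : ℂ) * (x t β.1 * x t β.2) := by
      rw [ha t ht, hf₃, sum_outer c ((S.prod S).push g₂) (x t) (fun β => x t β.1 * x t β.2)]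
    rw [s₂, s₃]
    simp only [heS, Complex.ofReal_zero, zero_mul, Finset.sum_const_zero, hx₃, hx₂, hg₃, hg₂]
    ring
  have hlip : ‖F t₁ - F t₀‖ ≤
      P * (3 * K * (δ⁻¹ * (P * (2 * K * (μ⁻¹ * (P * (K * Q))))))) * ‖t₁ - t₀‖ := by
    refine (convex_uIcc t₀ t₁).norm_image_sub_le_of_norm_hasDerivWithin_le
      (fun t ht => (hF t ht).hasDerivWithinAt) (fun t ht => ?_) left_mem_uIcc right_mem_uIcc
    rw [norm_mul, norm_I, one_mul, norm_mul, Complex.norm_real]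
    exact mul_le_mul (ha' t ht) ((norm_sum_le (hxr₃ t ht) _).trans (e₃' t ht)) (norm_nonneg _) hP
  have b₂ : ∀ t ∈ uIcc t₀ t₁, ‖∑ α, (g₂ α : ℂ) * x₂ t α‖ ≤ _ := fun t ht =>
    (norm_sum_le (hxr₂ t ht) _).trans (e₂ t ht)
  have b₃ : ∀ t ∈ uIcc t₀ t₁, ‖∑ α, (g₃ α : ℂ) * x₃ t α‖ ≤ _ := fun t ht =>
    (norm_sum_le (hxr₃ t ht) _).trans (e₃ t ht)
  have key : ∑ α, (e α : ℂ) * x t₁ α - ∑ α, (e α : ℂ) * x t₀ α =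
      (F t₁ - F t₀) + ((∑ α, (g₂ α : ℂ) * x₂ t₁ α - ∑ α, (g₂ α : ℂ) * x₂ t₀ α) -
        (∑ α, (g₃ α : ℂ) * x₃ t₁ α - ∑ α, (g₃ α : ℂ) * x₃ t₀ α)) := by
    simp only [F]; ring
  rw [key]
  have n1 := norm_add_le (F t₁ - F t₀) ((∑ α, (g₂ α : ℂ) * x₂ t₁ α - ∑ α, (g₂ α : ℂ) * x₂ t₀ α) -
        (∑ α, (g₃ α : ℂ) * x₃ t₁ α - ∑ α, (g₃ α : ℂ) * x₃ t₀ α))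
  have n2 := _root_.norm_sub_le (∑ α, (g₂ α : ℂ) * x₂ t₁ α - ∑ α, (g₂ α : ℂ) * x₂ t₀ α)
        (∑ α, (g₃ α : ℂ) * x₃ t₁ α - ∑ α, (g₃ α : ℂ) * x₃ t₀ α)
  have n3 := _root_.norm_sub_le (∑ α, (g₂ α : ℂ) * x₂ t₁ α) (∑ α, (g₂ α : ℂ) * x₂ t₀ α)
  have n4 := _root_.norm_sub_le (∑ α, (g₃ α : ℂ) * x₃ t₁ α) (∑ α, (g₃ α : ℂ) * x₃ t₀ α)
  have := b₂ t₀ left_mem_uIcc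
  have := b₂ t₁ right_mem_uIcc
  have := b₃ t₀ left_mem_uIcc
  have := b₃ t₁ right_mem_uIcc
  rw [Real.norm_eq_abs] at hlip
  linarith

end PhaseSystem

end Beam

/-! ### Linear frequencies and small divisors -/

namespace Beam

section Frequencies

variable {m : ℝ}

theorem one_le_cast (j : ℕ+) : (1 : ℝ) ≤ j := by exact_mod_cast j.pos

theorem sq_add_pos (hm : -1 / 2 ≤ m) (j : ℕ+) : 0 < (j : ℝ) ^ 2 + m := by
  nlinarith [one_le_cast j]

theorem omega_sq (hm : -1 / 2 ≤ m) (j : ℕ+) : omega m j ^ 2 = (j : ℝ) ^ 2 * ((j : ℝ) ^ 2 + m) := by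
  rw [omega, Real.sq_sqrt]
  · ring
  · nlinarith [one_le_cast j, sq_add_pos hm j,
      mul_pos (pow_pos (one_le_cast j |>.trans_lt' one_pos) 2)
      (sq_add_pos hm j)]

theorem omega_pos (hm : -1 / 2 ≤ m) (j : ℕ+) : 0 < omega m j := by
  refine Real.sqrt_pos.2 ?_
  nlinarith [one_le_cast j, mul_pos (pow_pos (one_le_cast j |>.trans_lt' one_pos) 2)
      (sq_add_pos hm j)]

theorem omega_eq (j : ℕ+) : omega m j = j * Real.sqrt ((j : ℝ) ^ 2 + m) := by
  rw [omega, show (j : ℝ) ^ 4 + m * (j : ℝ) ^ 2 = (j : ℝ) ^ 2 * ((j : ℝ) ^ 2 + m) by ring,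
    Real.sqrt_mul (by positivity), Real.sqrt_sq (by positivity)]

theorem omega_one : omega m 1 = Real.sqrt (1 + m) := by simp [omega_eq]

theorem omega_one_le (j : ℕ+) : omega m 1 ≤ omega m j := by
  rw [omega_one, omega_eq]
  have h := one_le_cast j
  have : Real.sqrt (1 + m) ≤ Real.sqrt ((j : ℝ) ^ 2 + m) := Real.sqrt_le_sqrt (by nlinarith)
  nlinarith [Real.sqrt_nonneg (1 + m)]

/-- Since `ω_j = j √(j² + m)`, the difference is at least `(j - k) √(j² + m)`. -/
theorem omega_one_le_sub {j k : ℕ+} (h : k < j) : omega m 1 ≤ omega m j - omega m k := by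
  rw [omega_one, omega_eq, omega_eq]
  have hk := one_le_cast k
  have hj : (k : ℝ) + 1 ≤ j := by exact_mod_cast h
  have h1 : Real.sqrt (1 + m) ≤ Real.sqrt ((j : ℝ) ^ 2 + m) := Real.sqrt_le_sqrt (by nlinarith)
  have h2 : Real.sqrt ((k : ℝ) ^ 2 + m) ≤ Real.sqrt ((j : ℝ) ^ 2 + m) :=
    Real.sqrt_le_sqrt (by nlinarith)
  nlinarith [Real.sqrt_nonneg (1 + m), Real.sqrt_nonneg ((k : ℝ) ^ 2 + m)]

theorem mu_le_two_omega (j : ℕ+) : mu m ≤ 2 * omega m j := by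
  have := omega_one_le (m := m) j
  rw [omega_one] at this
  exact (min_le_left _ _).trans (by linarith)

theorem mu_le_two_abs_sub {j k : ℕ+} (h : j ≠ k) : mu m ≤ 2 * |omega m j - omega m k| := by
  have h1 := mu_le_two_omega (m := m) 1
  rcases lt_or_gt_of_ne h with h | h
  · have := omega_one_le_sub (m := m) h
    rw [abs_sub_comm]
    linarith [le_abs_self (omega m k - omega m j)]
  · have := omega_one_le_sub (m := m) h
    linarith [le_abs_self (omega m j - omega m k)]

theorem mu_pos (hm : -1 / 2 ≤ m) : 0 < mu m :=
  lt_min (by have : 0 < 1 + m := by linarith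
             positivity) (by have : 0 < 4 + m := by linarith
                             positivity)

/-- Compare squares with `ω_j² = j⁴ + m j²`. The upper bound completes the square. The lower bound
reduces to `9m/64 ≤ j²/4` for `m ≥ 0` and to `25|m|/64 ≤ j²/4` for `m ≤ 0`; both hold on the given
range of `m`, already for `j = 1`. -/
theorem omega_expansion (hm : -1 / 2 ≤ m) (hm1 : m ≤ 1) (j : ℕ+) :
    omega m j ≤ (j : ℝ) ^ 2 + m / 2 ∧ (j : ℝ) ^ 2 + m / 2 - |m| / 8 ≤ omega m j := by
  have hj : (1 : ℝ) ≤ (j : ℝ) ^ 2 := by nlinarith [one_le_cast j]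
  have hp := omega_pos hm j
  have hsq := omega_sq hm j
  set w := omega m j
  set y : ℝ := (j : ℝ) ^ 2
  constructor
  · exact (sq_le_sq₀ hp.le (by linarith)).1 (by nlinarith [sq_nonneg m])
  · rcases le_total 0 m with h | h
    · rw [abs_of_nonneg h]
      refine abs_le_of_sq_le_sq' ?_ hp.le |>.2
      nlinarith
    · rw [abs_of_nonpos h]
      refine abs_le_of_sq_le_sq' ?_ hp.le |>.2
      nlinarith

/-- The combination equals `n + m/2 + r` with `n` an integer and `-|m|/4 ≤ r ≤ |m|/8`. For `n = 0`
the term `m/2` dominates `r`; for `n ≠ 0` the integer dominates, as `|m| ≤ 1` for `m > 0` and `|m| ≤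
1/2` for `m < 0`. -/
theorem omega_nonresonant (hm : -1 / 2 ≤ m) (hm1 : m ≤ 1) (j k l : ℕ+) :
    0.15 * |m| ≤ |omega m j + omega m k - omega m l| := by
  obtain ⟨j1, j2⟩ := omega_expansion hm hm1 j
  obtain ⟨k1, k2⟩ := omega_expansion hm hm1 k
  obtain ⟨l1, l2⟩ := omega_expansion hm hm1 l
  have hn : ∃ n : ℤ, (n : ℝ) = (j : ℝ) ^ 2 + (k : ℝ) ^ 2 - (l : ℝ) ^ 2 :=
    ⟨(j : ℤ) ^ 2 + (k : ℤ) ^ 2 - (l : ℤ) ^ 2, by push_cast; ring⟩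
  obtain ⟨n, hn⟩ := hn
  have hab : |m| ≤ 1 := abs_le.2 ⟨by linarith, hm1⟩
  rcases lt_trichotomy n 0 with h | h | h
  · have h' : (n : ℝ) ≤ -1 := by exact_mod_cast Int.le_sub_one_of_lt h
    refine le_trans ?_ (neg_le_abs _)
    rcases abs_cases m with ⟨e, _⟩ | ⟨e, _⟩ <;> rw [e] at j2 k2 l2 ⊢ <;> linarith
  · have h' : (n : ℝ) = 0 := by exact_mod_cast h
    rcases abs_cases m with ⟨e, _⟩ | ⟨e, _⟩ <;> rw [e] at j2 k2 l2 ⊢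
    · refine le_trans ?_ (le_abs_self _); linarith
    · refine le_trans ?_ (neg_le_abs _); linarith
  · have h' : (1 : ℝ) ≤ n := by exact_mod_cast h
    refine le_trans ?_ (le_abs_self _)
    rcases abs_cases m with ⟨e, _⟩ | ⟨e, _⟩ <;> rw [e] at j2 k2 l2 ⊢ <;> linarith

/-- The coefficient `b_j = j² / ω_j` of the nonlinearity in normalized coordinates. -/
noncomputable def bcoef (m : ℝ) (j : ℕ+) : ℝ := (j : ℝ) ^ 2 / omega m j

theorem bcoef_pos (hm : -1 / 2 ≤ m) (j : ℕ+) : 0 < bcoef m j :=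
  div_pos (pow_pos (one_pos.trans_le (one_le_cast j)) 2) (omega_pos hm j)

theorem cc_pos (hm : -1 / 2 ≤ m) : 0 < cc m := by
  have : 0 < 1 + m := by linarith
  unfold cc; split_ifs <;> positivity

theorem cc_sq_le_two (hm : -1 / 2 ≤ m) : cc m ^ 2 ≤ 2 := by
  have : 0 < 1 + m := by linarith
  unfold cc; split_ifs with h
  · norm_num
  · rw [inv_pow, Real.sq_sqrt this.le]
    rw [inv_le_comm₀ this two_pos]; linarith

/-- Here `b_j = j / √(j² + m)`, which is at most `1` for `m ≥ 0` and largest at `j = 1` for `m < 0`.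
Boundedness in `j` is what prevents any loss of derivatives in the estimates for the modes. -/
theorem bcoef_le (hm : -1 / 2 ≤ m) (j : ℕ+) : bcoef m j ≤ cc m := by
  have hj := one_le_cast j
  rw [bcoef, div_le_iff₀ (omega_pos hm j)]
  refine (sq_le_sq₀ (by positivity) (mul_nonneg (cc_pos hm).le (omega_pos hm j).le)).1 ?_
  rw [mul_pow, omega_sq hm]
  have h1m : 0 < 1 + m := by linarith
  unfold cc; split_ifs with h
  · nlinarith [mul_nonneg h (sq_nonneg (j : ℝ))]
  · rw [inv_pow, Real.sq_sqrt h1m.le, inv_mul_eq_div, le_div_iff₀ h1m]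
    have : (1 : ℝ) ≤ (j : ℝ) ^ 2 := by nlinarith
    nlinarith [mul_nonneg (sq_nonneg (j : ℝ)) (sub_nonneg.2 this)]

end Frequencies

end Beam

/-! ### Quadratic monomials of the modes and their resonances -/

namespace Beam

open Complex ComplexConjugate

section ModeSystem

variable {ι : Type} [Fintype ι] [DecidableEq ι]

/-- The coupling of the monomials `|z|²`, `z²`, `z̄²` of a single mode, labelled `0`, `1`, `-1`. -/
noncomputable def signCoupling (σ τ : SignType) : ℝ :=
  if σ = 0 then (τ : ℝ) / 2 else if τ = -σ then 0 else -(σ : ℝ)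

theorem signCoupling_neg (σ τ : SignType) : signCoupling (-σ) (-τ) = -signCoupling σ τ := by
  rcases σ.trichotomy with rfl | rfl | rfl <;> rcases τ.trichotomy with rfl | rfl | rfl <;>
    simp [signCoupling, neg_div]

/-- The quadratic monomials `|z_j|²`, `z_j²`, `z̄_j²`, `z_j = p_j + i q_j`, of the modes. -/
noncomputable def modeSystem (w b : ι → ℝ) : PhaseSystem (ι × SignType) where
  freq α := -2 * (α.2 : ℝ) * w α.1
  coupling α β := if α.1 = β.1 then b α.1 * signCoupling α.2 β.2 else 0
  flip := (Equiv.refl ι).prodCongr (Equiv.neg SignType)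
  freq_flip α := by simp
  coupling_flip := by
    rintro ⟨j, σ⟩ ⟨k, τ⟩
    simp only [Equiv.prodCongr_apply, Prod.map, Equiv.refl_apply, Equiv.neg_apply,
      signCoupling_neg]
    split_ifs <;> ring

/-- The value of the monomial labelled by the sign. -/
noncomputable def monomial (p q : ℝ) : SignType → ℂ
  | 0 => ((p ^ 2 + q ^ 2 : ℝ) : ℂ)
  | 1 => ((p : ℂ) + I * q) ^ 2
  | -1 => ((p : ℂ) - I * q) ^ 2

@[simp] theorem monomial_zero (p q : ℝ) : monomial p q 0 = ((p ^ 2 + q ^ 2 : ℝ) : ℂ) := rfl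
@[simp] theorem monomial_one (p q : ℝ) : monomial p q 1 = ((p : ℂ) + I * q) ^ 2 := rfl
@[simp] theorem monomial_neg_one (p q : ℝ) : monomial p q (-1) = ((p : ℂ) - I * q) ^ 2 := rfl

theorem sum_signType {R : Type} [AddCommMonoid R] (f : SignType → R) :
    ∑ σ, f σ = f 0 + f 1 + f (-1) := by
  rw [SignType.univ_eq]
  rw [Finset.sum_insert (by decide), Finset.sum_insert (by decide), Finset.sum_singleton]
  rw [add_comm (f (-1)), add_assoc]

theorem monomial_neg (p q : ℝ) (σ : SignType) : monomial p q (-σ) = conj (monomial p q σ) := by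
  rcases σ.trichotomy with rfl | rfl | rfl <;> simp [sub_eq_add_neg]

theorem norm_monomial (p q : ℝ) (σ : SignType) : ‖monomial p q σ‖ = p ^ 2 + q ^ 2 := by
  have h1 : ‖(p : ℂ) + I * q‖ ^ 2 = p ^ 2 + q ^ 2 := by
    rw [Complex.sq_norm, normSq_apply]; simp; ring
  have h2 : ‖(p : ℂ) - I * q‖ ^ 2 = p ^ 2 + q ^ 2 := by
    rw [Complex.sq_norm, normSq_apply]; simp; ring
  rcases σ.trichotomy with rfl | rfl | rfl
  · rw [monomial_neg_one, norm_pow, h2]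
  · rw [monomial_zero, Complex.norm_real, Real.norm_eq_abs, abs_of_nonneg (by positivity)]
  · rw [monomial_one, norm_pow, h1]

theorem modeSystem_sum_coupling {R : Type} [CommRing R] (f : ℝ → R) (hf : f 0 = 0) (w b : ι → ℝ)
    (α : ι × SignType) (x : ι × SignType → R) :
    ∑ β, f ((modeSystem w b).coupling α β) * x β =
      ∑ τ, f (b α.1 * signCoupling α.2 τ) * x (α.1, τ) := by
  rw [Fintype.sum_prod_type, Finset.sum_eq_single α.1]
  · simp [modeSystem]
  · intro k _ hk
    simp [modeSystem, hk.symm, hf]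
  · simp

/-- The equations read `z' = -iω z - i a b p` with `p = (z + z̄)/2`. Hence `(z²)' = -2iω z² - i a b
(z² + |z|²)` and `(|z|²)' = i a b (z² - z̄²)/2`, the coupling recorded in `signCoupling`. -/
theorem modeSystem_isOrbitAt {w b : ι → ℝ} {a : ℝ → ℝ} {p q : ι → ℝ → ℝ} {t : ℝ}
    (hp : ∀ j, HasDerivAt (p j) (w j * q j t) t)
    (hq : ∀ j, HasDerivAt (q j) (-(w j + a t * b j) * p j t) t) :
    (modeSystem w b).IsOrbitAt a (fun τ α => monomial (p α.1 τ) (q α.1 τ) α.2) t where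
  hasDerivAt := by
    rintro ⟨j, σ⟩
    rw [modeSystem_sum_coupling (fun u : ℝ => (u : ℂ)) (by simp), sum_signType]
    have hp' := (hp j).ofReal_comp
    have hq' := (hq j).ofReal_comp
    rcases σ.trichotomy with rfl | rfl | rfl
    · simp only [monomial_neg_one]
      refine ((hp'.sub (hq'.const_mul I)).pow 2).congr_deriv ?_
      simp [modeSystem, signCoupling]
      linear_combination (2 * p j t * q j t * w j - I * q j t ^ 2 * (2 * w j + a t * b j)) * I_sq
    · simp only [monomial_zero]
      have := (((hp j).pow 2).add ((hq j).pow 2)).ofReal_comp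
      refine this.congr_deriv ?_
      simp [modeSystem, signCoupling]
      linear_combination (-2 * p j t * q j t * a t * b j) * I_sq
    · simp only [monomial_one]
      refine ((hp'.add (hq'.const_mul I)).pow 2).congr_deriv ?_
      simp [modeSystem, signCoupling]
      linear_combination (2 * p j t * q j t * w j + I * q j t ^ 2 * (2 * w j + a t * b j)) * I_sq
  apply_flip α := by
    simp [modeSystem, ← monomial_neg]

theorem sum_abs_signCoupling_le (σ : SignType) : ∑ τ, |signCoupling σ τ| ≤ 2 := by
  rw [sum_signType]
  rcases σ.trichotomy with rfl | rfl | rfl <;> simp [signCoupling] <;> norm_num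

/-- Weights that depend on the mode alone suffice, because the coupling stays within one mode; the
factor `2` is the largest absolute row sum of `signCoupling`. -/
theorem modeSystem_isMajorant {w b : ι → ℝ} {K : ℝ} (hb : ∀ j, |b j| ≤ K) {r : ι → ℝ}
    (hr : ∀ j, 0 ≤ r j) : (modeSystem w b).IsMajorant (2 * K) (fun α => r α.1) where
  nonneg α := hr _
  sum_le α := by
    rw [modeSystem_sum_coupling (fun u : ℝ => |u|) abs_zero]
    simp only [abs_mul]
    rw [← Finset.sum_mul, ← Finset.mul_sum]
    refine mul_le_mul_of_nonneg_right ?_ (hr _)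
    have := sum_abs_signCoupling_le α.2
    nlinarith [hb α.1, abs_nonneg (b α.1)]

/-- The product of two monomials is of the form `|z_j|² |z_k|²` or `z_j² z̄_j²`. -/
def Paired (α β : ι × SignType) : Prop := (α.2 = 0 ∧ β.2 = 0) ∨ (β.2 = -α.2 ∧ α.1 = β.1)

theorem Paired.im_eq_zero {κ : Type} {α β : κ × SignType} (h : Paired α β) (p q : κ → ℝ) :
    (monomial (p α.1) (q α.1) α.2 * monomial (p β.1) (q β.1) β.2).im = 0 := by
  obtain ⟨h1, h2⟩ | ⟨h1, h2⟩ := h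
  · rw [h1, h2, monomial_zero, monomial_zero, ← Complex.ofReal_mul, Complex.ofReal_im]
  · rw [h1, h2, monomial_neg, Complex.mul_conj, Complex.ofReal_im]

theorem Paired.freq_eq_zero {α β : ι × SignType} (h : Paired α β) (w b : ι → ℝ) :
    (modeSystem w b).freq α + (modeSystem w b).freq β = 0 := by
  obtain ⟨h1, h2⟩ | ⟨h1, h2⟩ := h
  · simp [modeSystem, h1, h2]
  · simp [modeSystem, h1, h2]

/-- The frequency of a pair is `0`, `±2ω_j`, `±2(ω_j + ω_k)` or `±2(ω_j - ω_k)`. It can vanish only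
for two zero signs or for opposite signs at the same mode. -/
theorem paired_or_le {w : ι → ℝ} (b : ι → ℝ) {μ : ℝ} (h1 : ∀ j, μ ≤ 2 * w j)
    (hμ : 0 < μ) (h2 : ∀ j k, j ≠ k → μ ≤ 2 * |w j - w k|) (α β : ι × SignType) :
    Paired α β ∨ μ ≤ |(modeSystem w b).freq α + (modeSystem w b).freq β| := by
  obtain ⟨j, σ⟩ := α
  obtain ⟨k, τ⟩ := β
  have hj := h1 j
  have hk := h1 k
  have hjk : j = k ∨ μ ≤ |2 * (w j - w k)| := by
    rw [abs_mul, abs_two]; exact or_iff_not_imp_left.2 (h2 j k)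
  have hkj : j = k ∨ μ ≤ |2 * (w k - w j)| := by
    rw [abs_mul, abs_two, abs_sub_comm]; exact or_iff_not_imp_left.2 (h2 j k)
  rcases σ.trichotomy with rfl | rfl | rfl <;> rcases τ.trichotomy with rfl | rfl | rfl <;>
    simp [Paired, modeSystem]
  · refine le_trans ?_ (le_abs_self _); linarith
  · linarith [le_abs_self (w j)]
  · exact hjk.imp id fun h => h.trans (le_of_eq (by congr 1; ring))
  · linarith [le_abs_self (w k)]
  · linarith [le_abs_self (w k)]
  · exact hkj.imp id fun h => h.trans (le_of_eq (by congr 1; ring))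
  · linarith [le_abs_self (w j)]
  · refine le_trans ?_ (neg_le_abs _); linarith

end ModeSystem

end Beam

/-! ### Long-time control of the low norm for finitely many modes -/

namespace Beam

open Complex ComplexConjugate

section FiniteModes

variable {ι : Type} [Fintype ι] [DecidableEq ι]

/-- A factor `|z|²` has zero frequency and reduces the question to pairs. With three nonzero signs
there is no resonance at all: equal signs give a sum of positive frequencies, and the other six
patterns are `±2(ω_j + ω_k - ω_l)` up to relabelling. -/
theorem triple_or_le {w : ι → ℝ} (b : ι → ℝ) {μ δ : ℝ} (h1 : ∀ j, μ ≤ 2 * w j)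
    (hμ : 0 < μ) (h2 : ∀ j k, j ≠ k → μ ≤ 2 * |w j - w k|) (hδ : δ ≤ μ)
    (h3 : ∀ j k l, δ ≤ 2 * |w j + w k - w l|) (α β γ : ι × SignType) :
    (α.2 = 0 ∧ Paired β γ) ∨ (β.2 = 0 ∧ Paired α γ) ∨ (γ.2 = 0 ∧ Paired α β) ∨
      δ ≤ |(modeSystem w b).freq α + ((modeSystem w b).freq β + (modeSystem w b).freq γ)| := by
  have hz : ∀ α : ι × SignType, α.2 = 0 → (modeSystem w b).freq α = 0 := fun α h => by
    simp [modeSystem, h]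
  by_cases hα : α.2 = 0
  · rcases paired_or_le b h1 hμ h2 β γ with h | h
    · exact Or.inl ⟨hα, h⟩
    · exact Or.inr (Or.inr (Or.inr (by rw [hz α hα, zero_add]; exact hδ.trans h)))
  by_cases hβ : β.2 = 0
  · rcases paired_or_le b h1 hμ h2 α γ with h | h
    · exact Or.inr (Or.inl ⟨hβ, h⟩)
    · exact Or.inr (Or.inr (Or.inr (by rw [hz β hβ, zero_add]; exact hδ.trans h)))
  by_cases hγ : γ.2 = 0
  · rcases paired_or_le b h1 hμ h2 α β with h | h
    · exact Or.inr (Or.inr (Or.inl ⟨hγ, h⟩))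
    · exact Or.inr (Or.inr (Or.inr (by rw [hz γ hγ, add_zero]; exact hδ.trans h)))
  refine Or.inr (Or.inr (Or.inr ?_))
  obtain ⟨j, σ⟩ := α
  obtain ⟨k, τ⟩ := β
  obtain ⟨l, υ⟩ := γ
  have hj := h1 j
  have hk := h1 k
  have hl := h1 l
  have e : ∀ x y : ℝ, (y = 2 * x ∨ y = -(2 * x)) → 2 * |x| = |y| := by
    rintro x y (rfl | rfl)
    · rw [abs_mul, abs_two]
    · rw [abs_neg, abs_mul, abs_two]
  rcases σ.trichotomy with rfl | rfl | rfl <;> rcases τ.trichotomy with rfl | rfl | rfl <;>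
    rcases υ.trichotomy with rfl | rfl | rfl <;> first | contradiction | skip
  all_goals simp [modeSystem]
  · refine le_trans ?_ (le_abs_self _); linarith
  · exact (h3 j k l).trans (le_of_eq (e _ _ (Or.inl (by ring))))
  · exact (h3 j l k).trans (le_of_eq (e _ _ (Or.inl (by ring))))
  · exact (h3 k l j).trans (le_of_eq (e _ _ (Or.inr (by ring))))
  · exact (h3 k l j).trans (le_of_eq (e _ _ (Or.inl (by ring))))
  · exact (h3 j l k).trans (le_of_eq (e _ _ (Or.inr (by ring))))
  · exact (h3 j k l).trans (le_of_eq (e _ _ (Or.inr (by ring))))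
  · refine le_trans ?_ (neg_le_abs _); linarith

/-- A finite system of modes without small divisors: the low norm `∑ (p_j² + q_j²)` changes little
over times of the order of its inverse cube. -/
theorem abs_energy_sub_le {w b : ι → ℝ} {μ δ K M : ℝ} (h1 : ∀ j, μ ≤ 2 * w j)
    (hμ : 0 < μ) (h2 : ∀ j k, j ≠ k → μ ≤ 2 * |w j - w k|) (hδ0 : 0 < δ) (hδ : δ ≤ μ)
    (h3 : ∀ j k l, δ ≤ 2 * |w j + w k - w l|) (hK : 0 ≤ K) (hb : ∀ j, |b j| ≤ K) (hM : 0 ≤ M)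
    {a : ℝ → ℝ} {p q : ι → ℝ → ℝ} {t₀ t₁ : ℝ}
    (hp : ∀ t ∈ uIcc t₀ t₁, ∀ j, HasDerivAt (p j) (w j * q j t) t)
    (hq : ∀ t ∈ uIcc t₀ t₁, ∀ j, HasDerivAt (q j) (-(w j + a t * b j) * p j t) t)
    (ha : ∀ t ∈ uIcc t₀ t₁, a t = 1 / (2 * Real.pi) * ∑ j, p j t ^ 2)
    (hE : ∀ t ∈ uIcc t₀ t₁, ∑ j, (p j t ^ 2 + q j t ^ 2) ≤ M) :
    |∑ j, (p j t₁ ^ 2 + q j t₁ ^ 2) - ∑ j, (p j t₀ ^ 2 + q j t₀ ^ 2)| ≤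
      2 * (μ⁻¹ * (0.16 * M * (2 * K * M)) +
        δ⁻¹ * (0.16 * M * (2 * (2 * K) * (μ⁻¹ * (0.16 * M * (2 * K * M)))))) +
        0.16 * M * (3 * (2 * K) *
          (δ⁻¹ * (0.16 * M * (2 * (2 * K) * (μ⁻¹ * (0.16 * M * (2 * K * M))))))) * |t₁ - t₀| := by
  set S := modeSystem w b
  let x : ℝ → ι × SignType → ℂ := fun τ α => monomial (p α.1 τ) (q α.1 τ) α.2
  let r : ℝ → ι × SignType → ℝ := fun τ α => p α.1 τ ^ 2 + q α.1 τ ^ 2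
  -- From `p² = (|z|² + (z² + z̄²)/2)/2` and `a = (1/2π) ∑ p²`.
  let c : ι × SignType → ℝ := fun α => 1 / (4 * Real.pi) * if α.2 = 0 then 1 else 1 / 2
  let e : ι × SignType → ℝ := fun α => if α.2 = 0 then 1 else 0
  have hsum : ∀ t, ∑ α, (e α : ℂ) * x t α = ((∑ j, (p j t ^ 2 + q j t ^ 2) : ℝ) : ℂ) := by
    intro t
    rw [Fintype.sum_prod_type, Complex.ofReal_sum]
    refine Finset.sum_congr rfl fun j _ => ?_
    rw [sum_signType]
    simp [e, x]
  have e2 : ∀ α : (ι × SignType) × (ι × SignType), Paired α.1 α.2 ∨ μ ≤ |(S.prod S).freq α| :=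
    fun α => paired_or_le b h1 hμ h2 α.1 α.2
  have e3 := fun α : (ι × SignType) × ((ι × SignType) × (ι × SignType)) =>
    triple_or_le b h1 hμ h2 hδ h3 α.1 α.2.1 α.2.2
  have hz : ∀ α : ι × SignType, α.2 = 0 → S.freq α = 0 := fun α h => by
    simp [S, modeSystem, h]
  have key := S.norm_sub_le_of_normalForm (K := 2 * K) (P := 0.16 * M) (Q := M) (μ := μ) (δ := δ)
    (by positivity) (by positivity) hμ hδ0 (a := a) (x := x) (r := r) (c := c) (e := e)
    (fun α => by simp [c, S, modeSystem]) (fun α => by simp [e, S, modeSystem])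
    (fun α => by
      by_cases h : α.2 = 0
      · rw [hz α h, mul_zero]
      · simp [e, h])
    (fun α => (e2 α).imp (fun h => h.freq_eq_zero w b) id)
    (fun α => by
      rcases e3 α with ⟨h, h'⟩ | ⟨h, h'⟩ | ⟨h, h'⟩ | h
      · left
        have := h'.freq_eq_zero w b
        simp only [PhaseSystem.prod, S] at *
        rw [hz _ h, this, add_zero]
      · left
        have := h'.freq_eq_zero w b
        simp only [PhaseSystem.prod, S] at *
        rw [hz _ h, zero_add, this]
      · left
        have := h'.freq_eq_zero w b
        simp only [PhaseSystem.prod, S] at *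
        rw [hz _ h, add_zero, this]
      · exact Or.inr h)
    (t₀ := t₀) (t₁ := t₁) (fun t ht => modeSystem_isOrbitAt (hp t ht) (hq t ht))
    (fun t ht => by
      rw [ha t ht, Fintype.sum_prod_type, Finset.mul_sum, Complex.ofReal_sum]
      refine Finset.sum_congr rfl fun j _ => ?_
      rw [sum_signType]
      have hpi : (Real.pi : ℂ) ≠ 0 := by exact_mod_cast Real.pi_ne_zero
      simp [c, x]
      field_simp
      linear_combination (-2 * (q j t : ℂ) ^ 2) * I_sq)
    (fun t _ => modeSystem_isMajorant hb (r := fun j => p j t ^ 2 + q j t ^ 2)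
      fun j => by positivity)
    (fun t _ α => (norm_monomial _ _ _).le)
    (fun t ht => by
      -- The three coefficients of a mode add up to `(1 + 1/2 + 1/2)/(4π) = 1/(2π) < 0.16`.
      have : ∑ α, |c α| * r t α = 1 / (2 * Real.pi) * ∑ j, (p j t ^ 2 + q j t ^ 2) := by
        rw [Fintype.sum_prod_type, Finset.mul_sum]
        refine Finset.sum_congr rfl fun j _ => ?_
        rw [sum_signType]
        simp [c, r, abs_of_pos Real.pi_pos]
        field_simp
        ring
      rw [this]
      refine mul_le_mul ?_ (hE t ht) (Finset.sum_nonneg fun j _ => by positivity) (by norm_num)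
      rw [div_le_iff₀ (by positivity)]
      linarith [Real.pi_gt_d2])
    (fun t ht => by
      refine le_trans (le_of_eq ?_) (hE t ht)
      rw [Fintype.sum_prod_type]
      refine Finset.sum_congr rfl fun j _ => ?_
      rw [sum_signType]
      simp [e, r])
    (fun t _ α h => by
      rcases e2 α with h' | h'
      · exact h'.im_eq_zero (fun j => p j t) (fun j => q j t)
      · rw [h, abs_zero] at h'; linarith)
    (fun t _ α h => by
      rcases e3 α with ⟨h', h''⟩ | ⟨h', h''⟩ | ⟨h', h''⟩ | h'
      · have := h''.im_eq_zero (fun j => p j t) (fun j => q j t)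
        simp only [x, h', monomial_zero, im_ofReal_mul, this, mul_zero]
      · have := h''.im_eq_zero (fun j => p j t) (fun j => q j t)
        rw [mul_left_comm]
        simp only [x, h', monomial_zero, im_ofReal_mul, this, mul_zero]
      · have := h''.im_eq_zero (fun j => p j t) (fun j => q j t)
        rw [← mul_assoc, mul_comm]
        simp only [x, h', monomial_zero, im_ofReal_mul, this, mul_zero]
      · change (S.freq α.1 + (S.freq α.2.1 + S.freq α.2.2)) = 0 at h
        rw [h, abs_zero] at h'; linarith)
  rw [hsum, hsum, ← Complex.ofReal_sub, Complex.norm_real, Real.norm_eq_abs] at key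
  exact key

end FiniteModes

section Bootstrap

/-- A continuity argument: a bound that improves itself holds throughout. -/
theorem le_of_bootstrap {f : ℝ → ℝ} {T A B : ℝ} (hf : ContinuousOn f (Icc 0 T)) (hAB : A < B)
    (h0 : f 0 ≤ A) (h : ∀ t ∈ Icc 0 T, (∀ s ∈ Icc 0 t, f s ≤ B) → f t ≤ A) :
    ∀ t ∈ Icc 0 T, f t ≤ A := by
  by_contra! hcon
  obtain ⟨t, ht, hft⟩ := hcon
  -- A level above `A` that is attained by time `t` and does not exceed `B`. At the first time `s`
  -- at which `f` reaches it, `f ≤ B` on `[0, s]`, so the hypothesis gives `f s ≤ A < c`.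
  set c := min (f t) B
  have hAc : A < c := lt_min hft hAB
  have hcl : IsCompact (Icc 0 T ∩ f ⁻¹' Ici c) :=
    isCompact_Icc.of_isClosed_subset (hf.preimage_isClosed_of_isClosed isClosed_Icc isClosed_Ici)
      inter_subset_left
  obtain ⟨s, hs, hmin⟩ := hcl.exists_isLeast ⟨t, ht, mem_Ici.2 (min_le_left (f t) B)⟩
  have hlt : ∀ r ∈ Icc 0 s, r ≠ s → f r < c := by
    intro r hr hrs
    by_contra! hc
    exact hrs (le_antisymm hr.2 (hmin ⟨⟨hr.1, hr.2.trans hs.1.2⟩, hc⟩))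
  have hsc : f s ≤ c := by
    by_contra! hc
    have hsub : Icc 0 s ⊆ Icc 0 T := Icc_subset_Icc le_rfl hs.1.2
    obtain ⟨r, hr, hrc⟩ := intermediate_value_Icc hs.1.1 (hf.mono hsub)
      (show c ∈ Icc (f 0) (f s) from ⟨h0.trans hAc.le, hc.le⟩)
    by_cases hrs : r = s
    · rw [hrs] at hrc; exact hc.ne' hrc
    · exact (hlt r hr hrs).ne hrc
  have := h s hs.1 fun r hr => by
    by_cases hrs : r = s
    · rw [hrs]; exact hsc.trans (min_le_right _ _)
    · exact (hlt r hr hrs).le.trans (min_le_right _ _)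
  exact absurd (hs.2 : c ≤ f s) (not_le.2 (this.trans_lt hAc))

theorem le_of_bootstrap_uIcc {f : ℝ → ℝ} {T A B : ℝ} (hf : ContinuousOn f (uIcc 0 T))
    (hAB : A < B) (h0 : f 0 ≤ A)
    (h : ∀ t ∈ uIcc 0 T, (∀ s ∈ uIcc 0 t, f s ≤ B) → f t ≤ A) : f T ≤ A := by
  rcases le_total 0 T with hT | hT
  · rw [uIcc_of_le hT] at hf h
    refine le_of_bootstrap hf hAB h0 (fun t ht hs => h t ht ?_) T ⟨hT, le_rfl⟩
    rwa [uIcc_of_le ht.1]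
  · rw [uIcc_of_ge hT] at hf h
    have := le_of_bootstrap (f := fun t => f (-t)) (T := -T) (A := A) (B := B)
      (hf.comp continuousOn_neg fun t ht => ⟨by linarith [ht.2], by linarith [ht.1]⟩) hAB
      (by simpa using h0)
      (fun t ht hs => h (-t) ⟨by linarith [ht.2], by linarith [ht.1]⟩ fun s hs' => by
        rw [uIcc_of_ge (by linarith [ht.1])] at hs'
        have := hs (-s) ⟨by linarith [hs'.2], by linarith [hs'.1]⟩
        simpa using this) (-T) ⟨by linarith, le_rfl⟩
    simpa using this

end Bootstrap

end Beam

/-! ### The constants, and closing the continuity argument -/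

namespace Beam

section Smallness

variable {m : ℝ}

theorem eps_sq_le {ε : ℝ} (hm : -1 / 2 ≤ m) (hε : 0 ≤ ε) (h : ε ≤ eps1 m) :
    ε ^ 2 ≤ 0.0064 * mu m := by
  have h1 : ε ≤ 0.08 * Real.sqrt (mu m) := h.trans (min_le_left _ _)
  calc ε ^ 2 ≤ (0.08 * Real.sqrt (mu m)) ^ 2 := pow_le_pow_left₀ hε h1 2
    _ = 0.0064 * mu m := by rw [mul_pow, Real.sq_sqrt (mu_pos hm).le]; norm_num

theorem eps_pow_four_le {ε : ℝ} (hm : -1 / 2 ≤ m) (hε : 0 ≤ ε) (h : ε ≤ eps1 m) :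
    ε ^ 4 * (3222 * cc m ^ 2) ≤ |m| * mu m := by
  have h1 : ε ≤ (|m| * mu m / (3222 * cc m ^ 2)) ^ (1 / 4 : ℝ) := h.trans (min_le_right _ _)
  have hc := cc_pos hm
  have hmu := mu_pos hm
  rw [← le_div_iff₀ (by positivity)]
  calc ε ^ 4 ≤ ((|m| * mu m / (3222 * cc m ^ 2)) ^ (1 / 4 : ℝ)) ^ 4 := pow_le_pow_left₀ hε h1 4
    _ = |m| * mu m / (3222 * cc m ^ 2) := by
      rw [← Real.rpow_natCast, ← Real.rpow_mul (by positivity)]; norm_num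

/-- The `ε`-dependent factor in the denominator of `T1` is at least `1` and is dropped; the crude
bound is enough below. -/
theorem T1_le (hm : -1 / 2 ≤ m) (ε : ℝ) : T1 m ε * (6595 * cc m ^ 3) ≤ |m| * mu m := by
  have hc := cc_pos hm
  have hmu := mu_pos hm
  have h1 : (1 : ℝ) ≤ 1 + 30 * (cc m / (|m| * mu m)) * ε ^ 2 + 90 * (cc m / mu m) * ε ^ 2 := by
    have : 0 ≤ 30 * (cc m / (|m| * mu m)) * ε ^ 2 + 90 * (cc m / mu m) * ε ^ 2 := by positivity
    linarith
  unfold T1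
  rw [div_mul_eq_mul_div, div_le_iff₀ (by positivity)]
  exact mul_le_mul_of_nonneg_left (le_mul_of_one_le_right (by positivity) h1) (by positivity)

/-- The low norm of a system of finitely many modes stays small over times `T₁ ε⁻⁶`. -/
theorem energy_le_of_small (hm : -1 / 2 ≤ m) (hm1 : m ≤ 1) (hm0 : m ≠ 0)
    {ι : Type} [Fintype ι] [DecidableEq ι] {n : ι → ℕ+} (hn : Function.Injective n)
    {a : ℝ → ℝ} {p q : ι → ℝ → ℝ} {T ε : ℝ} (hε : 0 < ε) (hε1 : ε ≤ eps1 m)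
    (hT : |T| * ε ^ 6 ≤ T1 m ε)
    (hp : ∀ t ∈ uIcc 0 T, ∀ j, HasDerivAt (p j) (omega m (n j) * q j t) t)
    (hq : ∀ t ∈ uIcc 0 T, ∀ j,
      HasDerivAt (q j) (-(omega m (n j) + a t * bcoef m (n j)) * p j t) t)
    (ha : ∀ t ∈ uIcc 0 T, a t = 1 / (2 * Real.pi) * ∑ j, p j t ^ 2)
    (h0 : ∑ j, (p j 0 ^ 2 + q j 0 ^ 2) ≤ 3 * ε ^ 2) :
    ∑ j, (p j T ^ 2 + q j T ^ 2) ≤ 3.5 * ε ^ 2 := by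
  have hε2 : 0 < ε ^ 2 := by positivity
  have hmu := mu_pos hm
  have hc := cc_pos hm
  have hm' : 0 < |m| := abs_pos.2 hm0
  have hcont : ContinuousOn (fun t => ∑ j, (p j t ^ 2 + q j t ^ 2)) (uIcc 0 T) :=
    continuousOn_finsetSum _ fun j _ =>
      (ContinuousOn.pow (fun t ht => (hp t ht j).continuousAt.continuousWithinAt) 2).add
        (ContinuousOn.pow (fun t ht => (hq t ht j).continuousAt.continuousWithinAt) 2)
  -- The bound `3.9 ε²`, assumed up to time `t`, will be improved to `3.5 ε²`: the total change from
  -- the initial bound `3 ε²` has to stay below `0.5 ε²`.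
  refine le_of_bootstrap_uIcc (f := fun t => ∑ j, (p j t ^ 2 + q j t ^ 2)) (B := 3.9 * ε ^ 2) hcont
    (by linarith) (by linarith) fun t ht hE => ?_
  have hsub : uIcc 0 t ⊆ uIcc 0 T := uIcc_subset_uIcc left_mem_uIcc ht
  have htT : |t| ≤ |T| := by
    have := abs_sub_left_of_mem_uIcc ht
    simpa using this
  have hδμ : 0.3 * |m| ≤ mu m := by
    have h1 : |m| ≤ 1 := abs_le.2 ⟨by linarith, hm1⟩
    have h2 : (0.7 : ℝ) ≤ Real.sqrt (1 + m) := Real.le_sqrt_of_sq_le (by linarith)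
    have h3 : (1.8 : ℝ) ≤ Real.sqrt (4 + m) := Real.le_sqrt_of_sq_le (by linarith)
    exact le_min (by linarith) (by linarith)
  have key := abs_energy_sub_le (w := fun j => omega m (n j)) (b := fun j => bcoef m (n j))
    (μ := mu m) (δ := 0.3 * |m|) (K := cc m) (M := 3.9 * ε ^ 2)
    (fun j => mu_le_two_omega _) hmu (fun j k hjk => mu_le_two_abs_sub (hn.ne hjk))
    (by positivity) hδμ (fun j k l => by linarith [omega_nonresonant hm hm1 (n j) (n k) (n l)])
    hc.le (fun j => by rw [abs_of_pos (bcoef_pos hm _)]; exact bcoef_le hm _) (by positivity)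
    (a := a) (p := p) (q := q) (t₀ := 0) (t₁ := t) (fun s hs => hp s (hsub hs))
    (fun s hs => hq s (hsub hs)) (fun s hs => ha s (hsub hs)) hE
  -- A decimal bound for `√2`.
  have hcc : cc m ≤ 1.42 := by
    have := cc_sq_le_two hm
    nlinarith
  have x1 : ε ^ 2 * (mu m)⁻¹ ≤ 0.0064 := by
    rw [← div_eq_mul_inv, div_le_iff₀ hmu]; exact eps_sq_le hm hε.le hε1
  have x2 : ε ^ 4 * cc m ^ 2 * (|m|⁻¹ * (mu m)⁻¹) ≤ 1 / 3222 := by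
    rw [← mul_inv, ← div_eq_mul_inv, div_le_iff₀ (by positivity)]
    linarith [eps_pow_four_le hm hε.le hε1]
  have x3 : |t| * ε ^ 6 * cc m ^ 3 * (|m|⁻¹ * (mu m)⁻¹) ≤ 1 / 6595 := by
    rw [← mul_inv, ← div_eq_mul_inv, div_le_iff₀ (by positivity)]
    have h1 := T1_le hm ε
    have h2 : |t| * ε ^ 6 ≤ T1 m ε := (mul_le_mul_of_nonneg_right htT (by positivity)).trans hT
    have h3 := mul_le_mul_of_nonneg_right h2 (show 0 ≤ cc m ^ 3 by positivity)
    linarith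
  have x1' : cc m * (ε ^ 2 * (mu m)⁻¹) ≤ 1.42 * 0.0064 :=
    mul_le_mul hcc x1 (by positivity) (by norm_num)
  rw [sub_zero, mul_inv] at key
  have e : 2 * ((mu m)⁻¹ * (0.16 * (3.9 * ε ^ 2) * (2 * cc m * (3.9 * ε ^ 2))) +
      0.3⁻¹ * |m|⁻¹ * (0.16 * (3.9 * ε ^ 2) * (2 * (2 * cc m) *
        ((mu m)⁻¹ * (0.16 * (3.9 * ε ^ 2) * (2 * cc m * (3.9 * ε ^ 2))))))) +
      0.16 * (3.9 * ε ^ 2) * (3 * (2 * cc m) * (0.3⁻¹ * |m|⁻¹ * (0.16 * (3.9 * ε ^ 2) *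
        (2 * (2 * cc m) * ((mu m)⁻¹ * (0.16 * (3.9 * ε ^ 2) * (2 * cc m * (3.9 * ε ^ 2)))))))) *
          |t| =
      ε ^ 2 * (2 * 0.16 * 2 * 3.9 ^ 2 * (cc m * (ε ^ 2 * (mu m)⁻¹)) +
        2 * 0.3⁻¹ * 0.16 ^ 2 * 8 * 3.9 ^ 3 * (ε ^ 4 * cc m ^ 2 * (|m|⁻¹ * (mu m)⁻¹)) +
        0.16 ^ 3 * 48 * 0.3⁻¹ * 3.9 ^ 4 * (|t| * ε ^ 6 * cc m ^ 3 * (|m|⁻¹ * (mu m)⁻¹))) := by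
    ring
  rw [e] at key
  -- The two boundary terms and the drift contribute approximately `0.09`, `0.03` and `0.02`, so
  -- there is ample room.
  have hfin : 2 * 0.16 * 2 * 3.9 ^ 2 * (cc m * (ε ^ 2 * (mu m)⁻¹)) +
        2 * 0.3⁻¹ * 0.16 ^ 2 * 8 * 3.9 ^ 3 * (ε ^ 4 * cc m ^ 2 * (|m|⁻¹ * (mu m)⁻¹)) +
        0.16 ^ 3 * 48 * 0.3⁻¹ * 3.9 ^ 4 * (|t| * ε ^ 6 * cc m ^ 3 * (|m|⁻¹ * (mu m)⁻¹)) ≤ 0.5 := by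
    norm_num at x1' x2 x3 ⊢
    linarith
  have := mul_le_mul_of_nonneg_left hfin hε2.le
  have := le_abs_self (∑ j, (p j t ^ 2 + q j t ^ 2) - ∑ j, (p j 0 ^ 2 + q j 0 ^ 2))
  linarith

end Smallness

end Beam

/-! ### The mode equations: growth, stability, uniqueness -/

namespace Beam

/-- Gronwall's inequality with an inhomogeneous term. -/
theorem le_exp_mul_of_deriv_le {f f' g : ℝ → ℝ} {K T : ℝ} (hK : 0 ≤ K)
    (hf : ∀ t ∈ Icc 0 T, HasDerivAt f (f' t) t) (hg : ContinuousOn g (Icc 0 T))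
    (hg0 : ∀ t ∈ Icc 0 T, 0 ≤ g t) (h : ∀ t ∈ Icc 0 T, f' t ≤ K * f t + g t) :
    ∀ t ∈ Icc 0 T, f t ≤ Real.exp (K * t) * (f 0 + ∫ s in (0 : ℝ)..t, g s) := by
  intro t ht
  have hT : 0 ≤ T := ht.1.trans ht.2
  have hint : IntervalIntegrable g MeasureTheory.volume 0 T :=
    ContinuousOn.intervalIntegrable (by rwa [uIcc_of_le hT])
  have hexp : ∀ s, HasDerivAt (fun s => Real.exp (-(K * s))) (Real.exp (-(K * s)) * -K) s := by
    intro s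
    have := ((hasDerivAt_id s).const_mul K).neg.exp
    simpa using this
  -- Integrating factor: the derivative is at most `(exp (-K s) - 1) g`, which is nonpositive
  -- because `g ≥ 0`.
  have hanti : AntitoneOn (fun s => Real.exp (-(K * s)) * f s - ∫ r in (0 : ℝ)..s, g r)
      (Icc 0 T) := by
    refine antitoneOn_of_hasDerivWithinAt_nonpos (convex_Icc 0 T) ?_ (f' := fun s =>
      Real.exp (-(K * s)) * -K * f s + Real.exp (-(K * s)) * f' s - g s) ?_ ?_
    · refine ContinuousOn.sub (ContinuousOn.mul (by fun_prop)
        fun s hs => (hf s hs).continuousAt.continuousWithinAt) ?_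
      have := intervalIntegral.continuousOn_primitive_interval (μ := MeasureTheory.volume)
        (f := g) (a := 0) (b := T) (by
          rw [uIcc_of_le hT]; exact hg.integrableOn_Icc)
      rwa [uIcc_of_le hT] at this
    · rw [interior_Icc]
      intro s hs
      have hs' := Ioo_subset_Icc_self hs
      refine (((hexp s).mul (hf s hs')).sub ?_).hasDerivWithinAt
      refine intervalIntegral.integral_hasDerivAt_right ?_ ?_ ?_
      · refine hint.mono_set ?_
        rw [uIcc_of_le hT, uIcc_of_le hs'.1]
        exact Icc_subset_Icc le_rfl hs'.2
      · exact (hg.mono Ioo_subset_Icc_self).stronglyMeasurableAtFilter isOpen_Ioo s hs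
      · exact hg.continuousAt (Icc_mem_nhds hs.1 hs.2)
    · rw [interior_Icc]
      intro s hs
      have hs' := Ioo_subset_Icc_self hs
      have h1 := h s hs'
      have h2 := hg0 s hs'
      have h3 : Real.exp (-(K * s)) ≤ 1 := Real.exp_le_one_iff.2 (by nlinarith [hs'.1])
      have h4 := Real.exp_pos (-(K * s))
      nlinarith
  have h1 := hanti ⟨le_rfl, hT⟩ ht ht.1
  simp only [mul_zero, neg_zero, Real.exp_zero, one_mul, intervalIntegral.integral_same,
    sub_zero] at h1
  have h2 : Real.exp (-(K * t)) * f t ≤ f 0 + ∫ s in (0 : ℝ)..t, g s := by linarith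
  have h3 := mul_le_mul_of_nonneg_left h2 (Real.exp_pos (K * t)).le
  rwa [← mul_assoc, ← Real.exp_add, add_neg_cancel, Real.exp_zero, one_mul] at h3

/-- The equations of the modes `p_j = j u_j`, `q_j = j v_j / ω_j` on a set of times. -/
structure IsModeSolution (m : ℝ) (I : Set ℝ) (a : ℝ → ℝ) (p q : ℕ+ → ℝ → ℝ) : Prop where
  hasDerivAt_p : ∀ t ∈ I, ∀ j, HasDerivAt (p j) (omega m j * q j t) t
  hasDerivAt_q : ∀ t ∈ I, ∀ j, HasDerivAt (q j) (-(omega m j + a t * bcoef m j) * p j t) t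
  continuousOn : ContinuousOn a I
  hasSum : ∀ t ∈ I, HasSum (fun j => p j t ^ 2) (2 * Real.pi * a t)

namespace IsModeSolution

variable {m : ℝ} {I : Set ℝ} {a a' : ℝ → ℝ} {p q p' q' : ℕ+ → ℝ → ℝ}

theorem mono {J : Set ℝ} (h : IsModeSolution m I a p q) (hJ : J ⊆ I) :
    IsModeSolution m J a p q :=
  ⟨fun t ht => h.hasDerivAt_p t (hJ ht), fun t ht => h.hasDerivAt_q t (hJ ht),
    h.continuousOn.mono hJ, fun t ht => h.hasSum t (hJ ht)⟩

/-- Time reversal. -/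
theorem reverse (h : IsModeSolution m I a p q) :
    IsModeSolution m (Neg.neg ⁻¹' I) (fun t => a (-t)) (fun j t => p j (-t))
      (fun j t => -q j (-t)) where
  hasDerivAt_p t ht j := by
    refine ((h.hasDerivAt_p (-t) ht j).scomp t (hasDerivAt_neg t)).congr_deriv ?_
    simp
  hasDerivAt_q t ht j := by
    refine ((h.hasDerivAt_q (-t) ht j).scomp t (hasDerivAt_neg t)).neg.congr_deriv ?_
    simp
  continuousOn := h.continuousOn.comp continuousOn_neg fun t ht => ht
  hasSum t ht := h.hasSum (-t) ht

/-- Growth of the difference of a single mode of two solutions. -/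
theorem mode_sub_le (hm : -1 / 2 ≤ m) {A P T : ℝ} (hA : 0 ≤ A) {j : ℕ+}
    {p q p' q' a a' : ℝ → ℝ} (hp : ∀ t ∈ Icc 0 T, HasDerivAt p (omega m j * q t) t)
    (hq : ∀ t ∈ Icc 0 T, HasDerivAt q (-(omega m j + a t * bcoef m j) * p t) t)
    (hp' : ∀ t ∈ Icc 0 T, HasDerivAt p' (omega m j * q' t) t)
    (hq' : ∀ t ∈ Icc 0 T, HasDerivAt q' (-(omega m j + a' t * bcoef m j) * p' t) t)
    (ha : ContinuousOn a (Icc 0 T)) (ha' : ContinuousOn a' (Icc 0 T))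
    (hP : 0 ≤ P) (hpP : ∀ t ∈ Icc 0 T, p' t ^ 2 ≤ P) (haA : ∀ t ∈ Icc 0 T, |a t| ≤ A) :
    ∀ t ∈ Icc 0 T, (p t - p' t) ^ 2 + (q t - q' t) ^ 2 ≤ Real.exp (cc m * (A + 1) * t) *
      ((p 0 - p' 0) ^ 2 + (q 0 - q' 0) ^ 2 + cc m * P * ∫ s in (0 : ℝ)..t, (a s - a' s) ^ 2) := by
  intro t ht
  have hc := cc_pos hm
  rw [← intervalIntegral.integral_const_mul]
  refine le_exp_mul_of_deriv_le (f := fun t => (p t - p' t) ^ 2 + (q t - q' t) ^ 2)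
    (g := fun s => cc m * P * (a s - a' s) ^ 2) (by positivity)
    (fun s hs => (((hp s hs).sub (hp' s hs)).fun_pow 2).add
      (((hq s hs).sub (hq' s hs)).fun_pow 2))
    (by fun_prop) (fun s hs => by positivity) (fun s hs => ?_) t ht
  have hb := bcoef_le hm j
  have hb0 := bcoef_pos hm j
  have h1 := abs_le.1 (haA s hs)
  have h2 := hpP s hs
  simp only [Nat.cast_ofNat, Nat.add_one_sub_one, pow_one, Pi.sub_apply]
  set x := p s - p' s with hx
  set y := q s - q' s with hy
  set d := a s - a' s with hd
  -- The unbounded frequencies `ω_j` cancel, being a rotation in the `(x, y)` plane; only the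
  -- bounded coefficient `b_j` remains. The growth rate is thus the same for all modes.
  have e : 2 * x * (omega m j * q s - omega m j * q' s) +
      2 * y * (-(omega m j + a s * bcoef m j) * p s - -(omega m j + a' s * bcoef m j) * p' s) =
      bcoef m j * (a s * (-2 * x * y) + -2 * y * (d * p' s)) := by
    rw [show p s = x + p' s by rw [hx]; ring, show q s = y + q' s by rw [hy]; ring,
      show a s = d + a' s by rw [hd]; ring]
    ring
  rw [e]
  have h3 : a s * (-2 * x * y) ≤ A * (x ^ 2 + y ^ 2) := by
    have : |a s * (-2 * x * y)| ≤ A * (x ^ 2 + y ^ 2) := by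
      rw [abs_mul]
      refine mul_le_mul (haA s hs) (abs_le.2 ⟨?_, ?_⟩) (abs_nonneg _) hA
      · nlinarith [sq_nonneg (x - y)]
      · nlinarith [sq_nonneg (x + y)]
    exact (le_abs_self _).trans this
  have h4 : -2 * y * (d * p' s) ≤ (x ^ 2 + y ^ 2) + P * d ^ 2 := by
    nlinarith [sq_nonneg (y + d * p' s), mul_le_mul_of_nonneg_left h2 (sq_nonneg d), sq_nonneg x]
  calc bcoef m j * (a s * (-2 * x * y) + -2 * y * (d * p' s))
      ≤ bcoef m j * (A * (x ^ 2 + y ^ 2) + ((x ^ 2 + y ^ 2) + P * d ^ 2)) :=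
        mul_le_mul_of_nonneg_left (add_le_add h3 h4) hb0.le
    _ ≤ cc m * (A * (x ^ 2 + y ^ 2) + ((x ^ 2 + y ^ 2) + P * d ^ 2)) :=
        mul_le_mul_of_nonneg_right hb (by positivity)
    _ = cc m * (A + 1) * (x ^ 2 + y ^ 2) + cc m * P * d ^ 2 := by ring

/-- Exponential bound for a single mode. -/
theorem mode_le_right (hm : -1 / 2 ≤ m) {A T : ℝ} (hA : 0 ≤ A)
    (h : IsModeSolution m (Icc 0 T) a p q) (haA : ∀ t ∈ Icc 0 T, |a t| ≤ A) (j : ℕ+) :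
    ∀ t ∈ Icc 0 T, p j t ^ 2 + q j t ^ 2 ≤
      Real.exp (cc m * (A + 1) * T) * (p j 0 ^ 2 + q j 0 ^ 2) := by
  intro t ht
  -- Comparison with the zero mode, for which `P = 0` and the inhomogeneous term disappears.
  have := mode_sub_le (P := 0) hm hA (p' := 0) (q' := 0) (a' := a)
    (fun t ht => h.hasDerivAt_p t ht j)
    (fun t ht => h.hasDerivAt_q t ht j) (fun t _ => by simp)
    (fun t _ => by simp) h.continuousOn h.continuousOn le_rfl
    (by simp) haA t ht
  simp only [Pi.zero_apply, sub_zero, mul_zero, zero_mul, add_zero] at this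
  refine this.trans (mul_le_mul_of_nonneg_right (Real.exp_le_exp.2 ?_) (by positivity))
  have := cc_pos hm
  exact mul_le_mul_of_nonneg_left ht.2 (by positivity)

theorem uIcc_neg_preimage {T : ℝ} (hT : T ≤ 0) : Icc 0 (-T) ⊆ Neg.neg ⁻¹' uIcc 0 T := by
  intro t ht
  rw [mem_preimage, uIcc_of_ge hT]
  exact ⟨by linarith [ht.2], by linarith [ht.1]⟩

theorem mode_le (hm : -1 / 2 ≤ m) {A T : ℝ} (hA : 0 ≤ A)
    (h : IsModeSolution m (uIcc 0 T) a p q) (haA : ∀ t ∈ uIcc 0 T, |a t| ≤ A) (j : ℕ+) :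
    p j T ^ 2 + q j T ^ 2 ≤ Real.exp (cc m * (A + 1) * |T|) * (p j 0 ^ 2 + q j 0 ^ 2) := by
  rcases le_total 0 T with hT | hT
  · rw [abs_of_nonneg hT]
    rw [uIcc_of_le hT] at h haA
    exact mode_le_right hm hA h haA j T ⟨hT, le_rfl⟩
  · rw [abs_of_nonpos hT]
    have := mode_le_right hm hA (h.reverse.mono (uIcc_neg_preimage hT))
      (fun t ht => haA (-t) (uIcc_neg_preimage hT ht)) j (-T) ⟨by linarith, le_rfl⟩
    simpa using this

/-- Stability of solutions with respect to the initial data, forward in time. -/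
theorem exists_stability_right (hm : -1 / 2 ≤ m) {A T E : ℝ} (hA : 0 ≤ A) (hE : 0 ≤ E) :
    ∃ C, 0 ≤ C ∧ ∀ (a a' : ℝ → ℝ) (p q p' q' : ℕ+ → ℝ → ℝ) (D : ℝ),
      IsModeSolution m (Icc 0 T) a p q → IsModeSolution m (Icc 0 T) a' p' q' →
      (∀ t ∈ Icc 0 T, |a t| ≤ A) → (∀ t ∈ Icc 0 T, |a' t| ≤ A) →
      Summable (fun j => p' j 0 ^ 2 + q' j 0 ^ 2) → ∑' j, (p' j 0 ^ 2 + q' j 0 ^ 2) ≤ E →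
      HasSum (fun j => (p j 0 - p' j 0) ^ 2 + (q j 0 - q' j 0) ^ 2) D →
      ∀ t ∈ Icc 0 T, (a t - a' t) ^ 2 ≤ C * D ∧ ∀ j, (p j t - p' j t) ^ 2 + (q j t - q' j t) ^ 2 ≤
        C * ((p j 0 - p' j 0) ^ 2 + (q j 0 - q' j 0) ^ 2 + (p' j 0 ^ 2 + q' j 0 ^ 2) * D) := by
  have hc := cc_pos hm
  set G := Real.exp (cc m * (A + 1) * T) with hG
  have hG0 : 0 < G := Real.exp_pos _
  set κ := cc m * G with hκ
  have hκ0 : 0 < κ := by positivity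
  set K := A * (G * (κ * E)) with hKdef
  have hK : 0 ≤ K := by positivity
  set C₁ := Real.exp (K * |T|) * (A * G * |T|) with hC₁
  have hC₁0 : 0 ≤ C₁ := by positivity
  refine ⟨G + G * κ * C₁ + A * (G * (1 + κ * E * C₁)), by positivity, ?_⟩
  intro a a' p q p' q' D h h' haA haA' hs hsE hD
  have hD0 : 0 ≤ D := hD.nonneg fun j => by positivity
  have hint : ContinuousOn (fun s => (a s - a' s) ^ 2) (Icc 0 T) :=
    (h.continuousOn.sub h'.continuousOn).pow 2
  -- The modes are estimated in terms of `y`, and summing them bounds `y' = (a - a')²` by an affine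
  -- function of `y`. A second application of Gronwall's inequality then closes the loop.
  set y : ℝ → ℝ := fun t => ∫ s in (0 : ℝ)..t, (a s - a' s) ^ 2 with hy
  have hy0 : ∀ t ∈ Icc 0 T, 0 ≤ y t := fun t ht =>
    intervalIntegral.integral_nonneg ht.1 fun s _ => sq_nonneg _
  have hmode : ∀ t ∈ Icc 0 T, ∀ j, (p j t - p' j t) ^ 2 + (q j t - q' j t) ^ 2 ≤
      G * ((p j 0 - p' j 0) ^ 2 + (q j 0 - q' j 0) ^ 2 + κ * (p' j 0 ^ 2 + q' j 0 ^ 2) * y t) := by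
    intro t ht j
    have := mode_sub_le (P := G * (p' j 0 ^ 2 + q' j 0 ^ 2)) hm hA
      (fun t ht => h.hasDerivAt_p t ht j) (fun t ht => h.hasDerivAt_q t ht j)
      (fun t ht => h'.hasDerivAt_p t ht j) (fun t ht => h'.hasDerivAt_q t ht j)
      h.continuousOn h'.continuousOn (by positivity)
      (fun t ht => (le_add_of_nonneg_right (sq_nonneg _)).trans (mode_le_right hm hA h' haA' j t ht))
      haA t ht
    refine this.trans ?_
    rw [← mul_assoc]
    have hyt := hy0 t ht
    refine mul_le_mul (Real.exp_le_exp.2 (mul_le_mul_of_nonneg_left ht.2 (by positivity))) le_rfl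
      (by positivity) hG0.le
  have hsum : ∀ t ∈ Icc 0 T, (a t - a' t) ^ 2 ≤ A * (G * (D + κ * E * y t)) := by
    intro t ht
    have hyt := hy0 t ht
    have hbound : HasSum (fun j => G * ((p j 0 - p' j 0) ^ 2 + (q j 0 - q' j 0) ^ 2 +
        κ * (p' j 0 ^ 2 + q' j 0 ^ 2) * y t))
        (G * (D + κ * (∑' j, (p' j 0 ^ 2 + q' j 0 ^ 2)) * y t)) :=
      (hD.add ((hs.hasSum.mul_left κ).mul_right (y t))).mul_left G
    have hle1 : ∀ j, (p j t - p' j t) ^ 2 ≤ G * ((p j 0 - p' j 0) ^ 2 + (q j 0 - q' j 0) ^ 2 +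
        κ * (p' j 0 ^ 2 + q' j 0 ^ 2) * y t) := fun j =>
      (le_add_of_nonneg_right (sq_nonneg _)).trans (hmode t ht j)
    have hs1 : Summable fun j => (p j t - p' j t) ^ 2 :=
      Summable.of_nonneg_of_le (fun j => sq_nonneg _) hle1 hbound.summable
    have hX : ∑' j, (p j t - p' j t) ^ 2 ≤ G * (D + κ * E * y t) := by
      refine (hs1.tsum_le_tsum hle1 hbound.summable).trans ?_
      rw [hbound.tsum_eq]
      gcongr
    have hsub : HasSum (fun j => (p j t - p' j t) * (p j t + p' j t))
        (2 * Real.pi * (a t - a' t)) := by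
      have := (h.hasSum t ht).sub (h'.hasSum t ht)
      rw [← mul_sub] at this
      exact this.congr_fun fun j => by ring
    have hs2 : HasSum (fun j => 2 * (p j t ^ 2 + p' j t ^ 2))
        (2 * (2 * Real.pi * a t + 2 * Real.pi * a' t)) :=
      ((h.hasSum t ht).add (h'.hasSum t ht)).mul_left 2
    have hle2 : ∀ j, (p j t + p' j t) ^ 2 ≤ 2 * (p j t ^ 2 + p' j t ^ 2) := fun j => by
      nlinarith [sq_nonneg (p j t - p' j t)]
    have hs2' : Summable fun j => (p j t + p' j t) ^ 2 :=
      Summable.of_nonneg_of_le (fun j => sq_nonneg _) hle2 hs2.summable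
    have hY : ∑' j, (p j t + p' j t) ^ 2 ≤ 8 * Real.pi * A := by
      refine (hs2'.tsum_le_tsum hle2 hs2.summable).trans ?_
      rw [hs2.tsum_eq]
      have := (le_abs_self _).trans (haA t ht)
      have := (le_abs_self _).trans (haA' t ht)
      nlinarith [Real.pi_pos]
    -- Cauchy–Schwarz applied to `2π(a - a') = ∑ (p_j - p'_j)(p_j + p'_j)`, passed from finite sums
    -- to the limit.
    have hcs : (2 * Real.pi * (a t - a' t)) ^ 2 ≤
        (∑' j, (p j t - p' j t) ^ 2) * ∑' j, (p j t + p' j t) ^ 2 := by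
      refine le_of_tendsto (hsub.pow 2) (Eventually.of_forall fun S => ?_)
      refine (Finset.sum_mul_sq_le_sq_mul_sq S _ _).trans ?_
      exact mul_le_mul (hs1.sum_le_tsum S fun _ _ => sq_nonneg _)
        (hs2'.sum_le_tsum S fun _ _ => sq_nonneg _) (Finset.sum_nonneg fun _ _ => sq_nonneg _)
        (tsum_nonneg fun _ => sq_nonneg _)
    have h5 : (2 * Real.pi * (a t - a' t)) ^ 2 ≤ G * (D + κ * E * y t) * (8 * Real.pi * A) :=
      hcs.trans (mul_le_mul hX hY (tsum_nonneg fun _ => sq_nonneg _) (by positivity))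
    have hpi := Real.pi_gt_three
    have h6 : 0 ≤ A * (G * (D + κ * E * y t)) := by positivity
    have h7 : (2 * Real.pi) * (2 * Real.pi * (a t - a' t) ^ 2) ≤
        (2 * Real.pi) * (4 * (A * (G * (D + κ * E * y t)))) := by linarith
    have h8 := le_of_mul_le_mul_left h7 (by positivity)
    nlinarith [sq_nonneg (a t - a' t)]
  have hyb : ∀ t ∈ Icc 0 T, y t ≤ C₁ * D := by
    intro t ht
    have hT : 0 ≤ T := ht.1.trans ht.2
    -- The integrand is only known to be continuous on `[0, T]`. It is continued by its end values,
    -- so that its primitive is differentiable at the end points as well.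
    have hext : ∀ s ∈ Icc 0 T, ((projIcc 0 T hT s : ℝ)) = s := fun s hs => by
      rw [projIcc_of_mem hT hs]
    have hcont : Continuous fun s : ℝ => (a (projIcc 0 T hT s) - a' (projIcc 0 T hT s)) ^ 2 :=
      ContinuousOn.comp_continuous (f := fun s : ℝ => ((projIcc 0 T hT s : Icc 0 T) : ℝ)) hint
        (continuous_subtype_val.comp continuous_projIcc) fun s => (projIcc 0 T hT s).2
    have heq : ∀ s ∈ Icc 0 T,
        ∫ r in (0 : ℝ)..s, (a (projIcc 0 T hT r) - a' (projIcc 0 T hT r)) ^ 2 = y s := by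
      intro s hs
      refine intervalIntegral.integral_congr fun r hr => ?_
      rw [uIcc_of_le hs.1] at hr
      simp only [hext r ⟨hr.1, hr.2.trans hs.2⟩]
    have := le_exp_mul_of_deriv_le (T := T)
      (f := fun s => ∫ r in (0 : ℝ)..s, (a (projIcc 0 T hT r) - a' (projIcc 0 T hT r)) ^ 2)
      (g := fun _ => A * G * D) hK (fun s _ => hcont.integral_hasStrictDerivAt 0 s |>.hasDerivAt)
      continuousOn_const (fun _ _ => by positivity)
      (fun s hs => by
        rw [hext s hs, heq s hs, hKdef]
        refine (hsum s hs).trans (le_of_eq (by ring))) t ht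
    rw [heq t ht, intervalIntegral.integral_same, zero_add, intervalIntegral.integral_const,
      sub_zero, smul_eq_mul] at this
    refine this.trans ?_
    rw [hC₁, mul_assoc (Real.exp (K * |T|))]
    have h1 : t ≤ |T| := ht.2.trans (le_abs_self _)
    refine mul_le_mul (Real.exp_le_exp.2 (mul_le_mul_of_nonneg_left h1 hK)) ?_
      (mul_nonneg ht.1 (by positivity)) (Real.exp_pos _).le
    calc t * (A * G * D) ≤ |T| * (A * G * D) := mul_le_mul_of_nonneg_right h1 (by positivity)
      _ = A * G * |T| * D := by ring
  intro t ht
  have hyt := hyb t ht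
  have hyt0 := hy0 t ht
  constructor
  · calc (a t - a' t) ^ 2 ≤ A * (G * (D + κ * E * y t)) := hsum t ht
      _ ≤ A * (G * (D + κ * E * (C₁ * D))) := by gcongr
      _ = A * (G * (1 + κ * E * C₁)) * D := by ring
      _ ≤ _ := mul_le_mul_of_nonneg_right (le_add_of_nonneg_left (by positivity)) hD0
  · intro j
    calc _ ≤ G * ((p j 0 - p' j 0) ^ 2 + (q j 0 - q' j 0) ^ 2 +
          κ * (p' j 0 ^ 2 + q' j 0 ^ 2) * y t) := hmode t ht j
      _ ≤ G * ((p j 0 - p' j 0) ^ 2 + (q j 0 - q' j 0) ^ 2 +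
          κ * (p' j 0 ^ 2 + q' j 0 ^ 2) * (C₁ * D)) := by gcongr
      _ = G * ((p j 0 - p' j 0) ^ 2 + (q j 0 - q' j 0) ^ 2) +
          G * κ * C₁ * ((p' j 0 ^ 2 + q' j 0 ^ 2) * D) := by ring
      _ ≤ (G + G * κ * C₁ + A * (G * (1 + κ * E * C₁))) *
            ((p j 0 - p' j 0) ^ 2 + (q j 0 - q' j 0) ^ 2) +
          (G + G * κ * C₁ + A * (G * (1 + κ * E * C₁))) * ((p' j 0 ^ 2 + q' j 0 ^ 2) * D) := by
        refine add_le_add (mul_le_mul_of_nonneg_right ?_ (by positivity))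
          (mul_le_mul_of_nonneg_right ?_ (by positivity))
        · have : 0 ≤ G * κ * C₁ + A * (G * (1 + κ * E * C₁)) := by positivity
          linarith
        · have : 0 ≤ G + A * (G * (1 + κ * E * C₁)) := by positivity
          linarith
      _ = _ := by ring

end IsModeSolution

end Beam

namespace Beam

namespace IsModeSolution

variable {m : ℝ} {I : Set ℝ} {a a' : ℝ → ℝ} {p q p' q' : ℕ+ → ℝ → ℝ}

/-- Stability of solutions with respect to the initial data. -/
theorem exists_stability (hm : -1 / 2 ≤ m) {A E : ℝ} (T : ℝ) (hA : 0 ≤ A) (hE : 0 ≤ E) :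
    ∃ C, 0 ≤ C ∧ ∀ (a a' : ℝ → ℝ) (p q p' q' : ℕ+ → ℝ → ℝ) (D : ℝ),
      IsModeSolution m (uIcc 0 T) a p q → IsModeSolution m (uIcc 0 T) a' p' q' →
      (∀ t ∈ uIcc 0 T, |a t| ≤ A) → (∀ t ∈ uIcc 0 T, |a' t| ≤ A) →
      Summable (fun j => p' j 0 ^ 2 + q' j 0 ^ 2) → ∑' j, (p' j 0 ^ 2 + q' j 0 ^ 2) ≤ E →
      HasSum (fun j => (p j 0 - p' j 0) ^ 2 + (q j 0 - q' j 0) ^ 2) D →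
      ∀ t ∈ uIcc 0 T, (a t - a' t) ^ 2 ≤ C * D ∧
        ∀ j, (p j t - p' j t) ^ 2 + (q j t - q' j t) ^ 2 ≤
        C * ((p j 0 - p' j 0) ^ 2 + (q j 0 - q' j 0) ^ 2 + (p' j 0 ^ 2 + q' j 0 ^ 2) * D) := by
  rcases le_total 0 T with hT | hT
  · obtain ⟨C, hC, h⟩ := exists_stability_right (T := T) hm hA hE
    rw [uIcc_of_le hT]
    exact ⟨C, hC, h⟩
  · obtain ⟨C, hC, hst⟩ := exists_stability_right (T := -T) hm hA hE
    refine ⟨C, hC, fun a a' p q p' q' D h h' ha ha' hs hsE hD t ht => ?_⟩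
    have hq : ∀ x y : ℝ, (-x + y) ^ 2 = (x - y) ^ 2 := fun x y => by ring
    have ht' : -t ∈ Icc 0 (-T) := by
      rw [uIcc_of_ge hT] at ht
      exact ⟨by linarith [ht.2], by linarith [ht.1]⟩
    have := hst _ _ _ _ _ _ D (h.reverse.mono (uIcc_neg_preimage hT))
      (h'.reverse.mono (uIcc_neg_preimage hT))
      (fun t ht => ha (-t) (uIcc_neg_preimage hT ht))
      (fun t ht => ha' (-t) (uIcc_neg_preimage hT ht))
      (by simpa using hs) (by simpa using hsE) (by simpa [hq] using hD) (-t) ht'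
    simpa [hq] using this

/-- Stability with `D = 0`; the common bound for `a` and `a'` comes from compactness of the time
interval. -/
theorem unique (hm : -1 / 2 ≤ m) {T : ℝ} (h : IsModeSolution m (uIcc 0 T) a p q)
    (h' : IsModeSolution m (uIcc 0 T) a' p' q')
    (hs : Summable (fun j => p' j 0 ^ 2 + q' j 0 ^ 2)) (hp : ∀ j, p j 0 = p' j 0)
    (hq : ∀ j, q j 0 = q' j 0) : a T = a' T ∧ ∀ j, p j T = p' j T ∧ q j T = q' j T := by
  obtain ⟨A₁, hA₁⟩ := isCompact_uIcc.exists_bound_of_continuousOn h.continuousOn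
  obtain ⟨A₂, hA₂⟩ := isCompact_uIcc.exists_bound_of_continuousOn h'.continuousOn
  have n₁ : 0 ≤ A₁ := (norm_nonneg _).trans (hA₁ 0 left_mem_uIcc)
  have n₂ : 0 ≤ A₂ := (norm_nonneg _).trans (hA₂ 0 left_mem_uIcc)
  obtain ⟨C, -, hC⟩ := exists_stability hm T (add_nonneg n₁ n₂)
    (tsum_nonneg fun j => add_nonneg (sq_nonneg (p' j 0)) (sq_nonneg (q' j 0)))
  have := hC a a' p q p' q' 0 h h' (fun t ht => (hA₁ t ht).trans (by linarith))
    (fun t ht => (hA₂ t ht).trans (by linarith)) hs le_rfl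
    (by simp [hp, hq]) T right_mem_uIcc
  obtain ⟨h1, h2⟩ := this
  refine ⟨by nlinarith [sq_nonneg (a T - a' T)], fun j => ?_⟩
  have h3 := h2 j
  simp only [hp, hq, sub_self] at h3
  constructor <;> nlinarith [sq_nonneg (p j T - p' j T), sq_nonneg (q j T - q' j T)]

end IsModeSolution

/-- A smooth vector field has solutions on every bounded time interval if its solutions are
bounded a priori. -/
theorem exists_hasDerivAt_Ioo_of_apriori_bound {E : Type*} [NormedAddCommGroup E]
    [NormedSpace ℝ E] [FiniteDimensional ℝ E] {f : E → E} (hf : ContDiff ℝ 1 f) (x₀ : E) {R : ℝ}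
    (hR : 0 < R) (hx₀ : ‖x₀‖ ≤ R)
    (h : ∀ (x : ℝ → E) (t : ℝ), x 0 = x₀ → (∀ s ∈ uIcc 0 t, HasDerivAt x (f (x s)) s) → ‖x t‖ ≤ R)
    (T : ℝ) (hT : 0 < T) :
    ∃ x : ℝ → E, x 0 = x₀ ∧ ∀ t ∈ Ioo (-T) T, HasDerivAt x (f (x t)) t := by
  have : CompleteSpace E := FiniteDimensional.complete ℝ E
  -- Cutting the field off outside the ball of radius `R + 1` makes it bounded and globally
  -- Lipschitz, and leaves it unchanged wherever the a priori bound applies.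
  let χ : ContDiffBump (0 : E) := ⟨R + 1, R + 2, by linarith, by linarith⟩
  let g : E → E := fun x => χ x • f x
  have hg : ContDiff ℝ 1 g := χ.contDiff.smul hf
  have hgs : HasCompactSupport g := χ.hasCompactSupport.smul_right
  obtain ⟨K, hK⟩ := hg.lipschitzWith_of_hasCompactSupport hgs one_ne_zero
  obtain ⟨L, hL⟩ := hg.continuous.bounded_above_of_compact_support hgs
  have hL0 : 0 ≤ L := (norm_nonneg _).trans (hL 0)
  -- With speed at most `L`, a solution cannot leave the ball of radius `L T` within time `T`; this
  -- choice gives existence on all of `[-T, T]` at once.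
  have hpl : IsPicardLindelof (fun _ => g) (tmin := -T) (tmax := T)
      ⟨0, by constructor <;> linarith⟩ x₀ (L * T).toNNReal 0 L.toNNReal K :=
    { lipschitzOnWith := fun _ _ => hK.lipschitzOnWith
      continuousOn := fun _ _ => continuousOn_const
      norm_le := fun _ _ x _ => (hL x).trans (Real.le_coe_toNNReal L)
      mul_max_le := by
        simp [Real.coe_toNNReal _ hL0, Real.coe_toNNReal _ (mul_nonneg hL0 hT.le)] }
  obtain ⟨x, hx0, hx⟩ := hpl.exists_eq_forall_mem_Icc_hasDerivWithinAt₀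
  have hx' : ∀ t ∈ Ioo (-T) T, HasDerivAt x (g (x t)) t := fun t ht =>
    (hx t (Ioo_subset_Icc_self ht)).hasDerivAt (Icc_mem_nhds ht.1 ht.2)
  have hgf : ∀ y : E, ‖y‖ ≤ R + 1 → g y = f y := fun y hy => by
    have : χ y = 1 := χ.one_of_mem_closedBall (by simpa using hy)
    simp [g, this]
  refine ⟨x, hx0, fun t ht => ?_⟩
  have hsub : ∀ s ∈ Ioo (-T) T, uIcc 0 s ⊆ Ioo (-T) T := fun s hs r hr => by
    rcases le_total 0 s with h0 | h0
    · rw [uIcc_of_le h0] at hr; exact ⟨by linarith [hr.1], hr.2.trans_lt hs.2⟩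
    · rw [uIcc_of_ge h0] at hr; exact ⟨hs.1.trans_le hr.1, by linarith [hr.2]⟩
  -- As long as `‖x‖ ≤ R + 1` the cut-off is invisible, so the a priori bound improves this to `‖x‖
  -- ≤ R`.
  have hb : ‖x t‖ ≤ R := by
    refine le_of_bootstrap_uIcc (f := fun s => ‖x s‖) (B := R + 1) (T := t)
      (fun s hs => (hx' s (hsub t ht hs)).continuousAt.norm.continuousWithinAt) (by linarith)
      (by simpa [hx0] using hx₀) fun s hs hb => ?_
    refine h x s hx0 fun r hr => ?_
    rw [← hgf _ (hb r hr)]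
    exact hx' r (hsub s (hsub t ht hs) hr)
  rw [← hgf _ (hb.trans (by linarith))]
  exact hx' t ht

end Beam

/-! ### Conservation of energy and solutions with finitely many modes -/

namespace Beam

variable {m : ℝ}

theorem omega_mul_bcoef (hm : -1 / 2 ≤ m) (j : ℕ+) : omega m j * bcoef m j = (j : ℝ) ^ 2 := by
  rw [bcoef, mul_div_cancel₀ _ (omega_pos hm j).ne']

theorem sq_add_mul_bcoef (hm : -1 / 2 ≤ m) (j : ℕ+) :
    ((j : ℝ) ^ 2 + m) * bcoef m j = omega m j := by
  rw [bcoef, ← mul_div_assoc, div_eq_iff (omega_pos hm j).ne', ← sq, omega_sq hm]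
  ring

/-- Conservation of energy for finitely many modes. -/
theorem finite_energy_eq (hm : -1 / 2 ≤ m) {ι : Type} [Fintype ι] (n : ι → ℕ+)
    {a : ℝ → ℝ} {p q : ι → ℝ → ℝ} {T : ℝ}
    (hp : ∀ t ∈ uIcc 0 T, ∀ j, HasDerivAt (p j) (omega m (n j) * q j t) t)
    (hq : ∀ t ∈ uIcc 0 T, ∀ j,
      HasDerivAt (q j) (-(omega m (n j) + a t * bcoef m (n j)) * p j t) t)
    (ha : ∀ t, a t = 1 / (2 * Real.pi) * ∑ j, p j t ^ 2) :
    ∑ j, ((n j : ℝ) ^ 2 + m) * (p j T ^ 2 + q j T ^ 2) + Real.pi * a T ^ 2 =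
      ∑ j, ((n j : ℝ) ^ 2 + m) * (p j 0 ^ 2 + q j 0 ^ 2) + Real.pi * a 0 ^ 2 := by
  have hpi := Real.pi_pos
  -- Both parts differentiate to multiples of `a ∑ ω_j p_j q_j`: the quadratic part by `(j² + m) b_j
  -- = ω_j`, the quartic part by `π a' = ∑ ω_j p_j q_j`. They cancel.
  set H : ℝ → ℝ := fun t =>
    ∑ j, ((n j : ℝ) ^ 2 + m) * (p j t ^ 2 + q j t ^ 2) + Real.pi * a t ^ 2 with hH
  have hd : ∀ t ∈ uIcc 0 T, HasDerivAt H 0 t := by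
    intro t ht
    have ha' : HasDerivAt a (1 / (2 * Real.pi) * ∑ j, 2 * p j t * (omega m (n j) * q j t)) t := by
      rw [funext ha]
      refine (HasDerivAt.fun_sum fun j _ => ((hp t ht j).fun_pow 2).congr_deriv ?_).const_mul _
      simp
    have h1 : HasDerivAt (fun t => ∑ j, ((n j : ℝ) ^ 2 + m) * (p j t ^ 2 + q j t ^ 2))
        (∑ j, (-a t) * (2 * p j t * (omega m (n j) * q j t))) t := by
      refine HasDerivAt.fun_sum fun j _ => ?_
      refine ((((hp t ht j).fun_pow 2).add ((hq t ht j).fun_pow 2)).const_mul _).congr_deriv ?_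
      rw [← sq_add_mul_bcoef hm (n j)]
      simp
      ring
    refine (h1.add ((ha'.fun_pow 2).const_mul Real.pi)).congr_deriv ?_
    rw [← Finset.mul_sum]
    field_simp
    ring
  have := (convex_uIcc 0 T).norm_image_sub_le_of_norm_hasDerivWithin_le (C := 0)
    (fun t ht => (hd t ht).hasDerivWithinAt) (fun t _ => by simp) left_mem_uIcc right_mem_uIcc
  rw [zero_mul, norm_le_zero_iff, sub_eq_zero] at this
  exact this

/-- Solutions with finitely many modes. -/
theorem exists_finite_solution (hm : -1 / 2 ≤ m) {ι : Type} [Fintype ι] (n : ι → ℕ+)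
    (x y : ι → ℝ) (T : ℝ) (hT : 0 < T) :
    ∃ (a : ℝ → ℝ) (p q : ι → ℝ → ℝ), (∀ j, p j 0 = x j) ∧ (∀ j, q j 0 = y j) ∧
      (∀ t, a t = 1 / (2 * Real.pi) * ∑ j, p j t ^ 2) ∧
      (∀ t ∈ Ioo (-T) T, ∀ j, HasDerivAt (p j) (omega m (n j) * q j t) t) ∧
      (∀ t ∈ Ioo (-T) T, ∀ j,
        HasDerivAt (q j) (-(omega m (n j) + a t * bcoef m (n j)) * p j t) t) := by
  let α : (ι → ℝ × ℝ) → ℝ := fun z => 1 / (2 * Real.pi) * ∑ j, (z j).1 ^ 2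
  let f : (ι → ℝ × ℝ) → (ι → ℝ × ℝ) := fun z j =>
    (omega m (n j) * (z j).2, -(omega m (n j) + α z * bcoef m (n j)) * (z j).1)
  let x₀ : ι → ℝ × ℝ := fun j => (x j, y j)
  let H₀ : ℝ := ∑ j, ((n j : ℝ) ^ 2 + m) * (x j ^ 2 + y j ^ 2) + Real.pi * α x₀ ^ 2
  have hw : ∀ j, 0 < (n j : ℝ) ^ 2 + m := fun j => sq_add_pos hm _
  have hw2 : ∀ j, 1 / 2 ≤ (n j : ℝ) ^ 2 + m := fun j => by nlinarith [one_le_cast (n j)]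
  have hH₀ : 0 ≤ H₀ := by
    refine add_nonneg (Finset.sum_nonneg fun j _ => ?_) (by positivity)
    exact mul_nonneg (hw j).le (by positivity)
  have hf : ContDiff ℝ 1 f := by
    refine contDiff_pi.2 fun j => ContDiff.prodMk ?_ ?_
    · fun_prop
    · have : ContDiff ℝ 1 α := by fun_prop
      fun_prop
  -- The weights `j² + m` are at least `1/2`, so the energy bounds each squared coordinate by `2 H₀
  -- ≤ (2 H₀ + 1)²`.
  have hbound : ∀ (z : ℝ → ι → ℝ × ℝ) (t : ℝ), z 0 = x₀ →
      (∀ s ∈ uIcc 0 t, HasDerivAt z (f (z s)) s) → ‖z t‖ ≤ 2 * H₀ + 1 := by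
    intro z t hz0 hz
    have hz' : ∀ s ∈ uIcc 0 t, ∀ j, HasDerivAt (fun τ => z τ j) (f (z s) j) s :=
      fun s hs => hasDerivAt_pi.1 (hz s hs)
    have hE := finite_energy_eq hm n (a := fun s => α (z s)) (p := fun j s => (z s j).1)
      (q := fun j s => (z s j).2) (T := t) (fun s hs j => (hz' s hs j).fst)
      (fun s hs j => (hz' s hs j).snd) (fun s => rfl)
    have hE0 : ∑ j, ((n j : ℝ) ^ 2 + m) * ((z 0 j).1 ^ 2 + (z 0 j).2 ^ 2) +
        Real.pi * α (z 0) ^ 2 = H₀ := by rw [hz0]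
    rw [hE0] at hE
    have hj : ∀ j, (z t j).1 ^ 2 + (z t j).2 ^ 2 ≤ 2 * H₀ := by
      intro j
      have h1 : ((n j : ℝ) ^ 2 + m) * ((z t j).1 ^ 2 + (z t j).2 ^ 2) ≤ H₀ := by
        rw [← hE]
        refine le_add_of_le_of_nonneg ?_ (by have := Real.pi_pos; positivity)
        exact Finset.single_le_sum (f := fun j => ((n j : ℝ) ^ 2 + m) *
          ((z t j).1 ^ 2 + (z t j).2 ^ 2)) (fun k _ => mul_nonneg (hw k).le (by positivity))
          (Finset.mem_univ j)
      nlinarith [hw2 j, sq_nonneg (z t j).1, sq_nonneg (z t j).2]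
    refine (pi_norm_le_iff_of_nonneg (by positivity)).2 fun j => ?_
    rw [Prod.norm_def]
    refine max_le ?_ ?_
    · refine abs_le_of_sq_le_sq' (b := 2 * H₀ + 1) ?_ (by positivity) |> abs_le.2
      nlinarith [hj j, sq_nonneg (z t j).2]
    · refine abs_le_of_sq_le_sq' (b := 2 * H₀ + 1) ?_ (by positivity) |> abs_le.2
      nlinarith [hj j, sq_nonneg (z t j).1]
  obtain ⟨z, hz0, hz⟩ := exists_hasDerivAt_Ioo_of_apriori_bound hf x₀
    (R := max (2 * H₀ + 1) ‖x₀‖) (lt_max_of_lt_left (by positivity)) (le_max_right _ _)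
    (fun z t h0 h => (hbound z t h0 h).trans (le_max_left _ _)) T hT
  refine ⟨fun t => α (z t), fun j t => (z t j).1, fun j t => (z t j).2, fun j => ?_,
    fun j => ?_, fun t => rfl, fun t ht j => ?_, fun t ht j => ?_⟩
  · simp only [hz0, x₀]
  · simp only [hz0, x₀]
  · exact (hasDerivAt_pi.1 (hz t ht) j).fst
  · exact (hasDerivAt_pi.1 (hz t ht) j).snd

end Beam

/-! ### Truncated data and tools for the passage to the limit -/

namespace Beam

variable {m : ℝ}

/-- Turns conservation of energy into a bound for `a`: `W` is the quadratic energy of the full data,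
`α` the initial and `X` a later value of `a`. The bound does not depend on the truncation. -/
theorem energy_le_of_tsum_le {W α X : ℝ} (hW : 0 ≤ W) (h0 : α ≤ W) (hα0 : 0 ≤ α)
    (h : Real.pi * X ^ 2 ≤ W + Real.pi * α ^ 2) : |X| ≤ W + 1 := by
  have hpi := Real.pi_gt_three
  refine abs_le_of_sq_le_sq ?_ (by linarith)
  have : α ^ 2 ≤ W ^ 2 := pow_le_pow_left₀ hα0 h0 2
  nlinarith [sq_nonneg X]

/-- Solutions with data cut off to finitely many modes. -/
theorem exists_truncated_solution (hm : -1 / 2 ≤ m) (hm1 : m ≤ 1) (hm0 : m ≠ 0) {x y : ℕ+ → ℝ}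
    (hxy : Summable fun j : ℕ+ => ((j : ℝ) ^ 2 + m) * (x j ^ 2 + y j ^ 2)) (S : Finset ℕ+)
    {T : ℝ} (hT : 0 < T) :
    ∃ (a : ℝ → ℝ) (p q : ℕ+ → ℝ → ℝ), IsModeSolution m (Ioo (-T) T) a p q ∧
      (∀ j, p j 0 = if j ∈ S then x j else 0) ∧ (∀ j, q j 0 = if j ∈ S then y j else 0) ∧
      (∀ t ∈ Ioo (-T) T, |a t| ≤ ∑' j : ℕ+, ((j : ℝ) ^ 2 + m) * (x j ^ 2 + y j ^ 2) + 1) ∧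
      ∀ ε, 0 < ε → ε ≤ eps1 m → ∑ j ∈ S, (x j ^ 2 + y j ^ 2) ≤ 3 * ε ^ 2 → ∀ t ∈ Ioo (-T) T,
        |t| * ε ^ 6 ≤ T1 m ε → ∀ F : Finset ℕ+, ∑ j ∈ F, (p j t ^ 2 + q j t ^ 2) ≤ 3.5 * ε ^ 2 := by
  classical
  obtain ⟨a, p, q, hp0, hq0, ha, hp, hq⟩ := exists_finite_solution hm (ι := S) (fun j => (j : ℕ+))
    (fun j => x j) (fun j => y j) T hT
  have hsub : ∀ s ∈ Ioo (-T) T, uIcc 0 s ⊆ Ioo (-T) T := fun s hs r hr => by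
    rcases le_total 0 s with h0 | h0
    · rw [uIcc_of_le h0] at hr; exact ⟨by linarith [hr.1], hr.2.trans_lt hs.2⟩
    · rw [uIcc_of_ge h0] at hr; exact ⟨hs.1.trans_le hr.1, by linarith [hr.2]⟩
  -- Modes that vanish initially stay zero, since the coupling through `a` is multiplicative.
  -- Extension by zero therefore gives an exact solution of the full system, and no projection error
  -- arises.
  let P : ℕ+ → ℝ → ℝ := fun j t => if h : j ∈ S then p ⟨j, h⟩ t else 0
  let Q : ℕ+ → ℝ → ℝ := fun j t => if h : j ∈ S then q ⟨j, h⟩ t else 0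
  have hPS : ∀ j : S, P j = p j := fun j => by ext t; simp [P]
  have hQS : ∀ j : S, Q j = q j := fun j => by ext t; simp [Q]
  have hP0 : ∀ j, j ∉ S → P j = 0 := fun j hj => by ext t; simp [P, hj]
  have hQ0 : ∀ j, j ∉ S → Q j = 0 := fun j hj => by ext t; simp [Q, hj]
  have hw : ∀ j : ℕ+, 0 < (j : ℝ) ^ 2 + m := fun j => sq_add_pos hm _
  have hw2 : ∀ j : ℕ+, 1 / 2 ≤ (j : ℝ) ^ 2 + m := fun j => by nlinarith [one_le_cast j]
  have hsolP : ∀ t ∈ Ioo (-T) T, ∀ j, HasDerivAt (P j) (omega m j * Q j t) t := by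
    intro t ht j
    by_cases hj : j ∈ S
    · have := hp t ht ⟨j, hj⟩
      rwa [← hPS, ← hQS] at this
    · rw [hP0 j hj, hQ0 j hj]; simp
  have hsolQ : ∀ t ∈ Ioo (-T) T, ∀ j,
      HasDerivAt (Q j) (-(omega m j + a t * bcoef m j) * P j t) t := by
    intro t ht j
    by_cases hj : j ∈ S
    · have := hq t ht ⟨j, hj⟩
      rwa [← hPS, ← hQS] at this
    · rw [hP0 j hj, hQ0 j hj]; simp
  refine ⟨a, P, Q, ⟨hsolP, hsolQ, ?_, ?_⟩, ?_, ?_, ?_, ?_⟩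
  · rw [funext ha]
    exact continuousOn_const.mul (continuousOn_finsetSum _ fun j _ =>
      ContinuousOn.pow (fun t ht => (hp t ht j).continuousAt.continuousWithinAt) 2)
  · intro t _
    have e : 2 * Real.pi * a t = ∑ j ∈ S, P j t ^ 2 := by
      rw [ha, ← Finset.sum_coe_sort S]
      have := Real.pi_pos
      simp only [hPS]
      field_simp
    rw [e]
    exact hasSum_sum_of_ne_finset_zero fun j hj => by rw [hP0 j hj]; simp
  · intro j
    by_cases hj : j ∈ S
    · rw [if_pos hj, show P j = p ⟨j, hj⟩ from hPS ⟨j, hj⟩, hp0]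
    · rw [hP0 j hj, if_neg hj]; rfl
  · intro j
    by_cases hj : j ∈ S
    · rw [if_pos hj, show Q j = q ⟨j, hj⟩ from hQS ⟨j, hj⟩, hq0]
    · rw [hQ0 j hj, if_neg hj]; rfl
  · intro t ht
    have hE := finite_energy_eq hm (fun j : S => (j : ℕ+)) (fun s hs => hp s (hsub t ht hs))
      (fun s hs => hq s (hsub t ht hs)) ha
    simp only [hp0, hq0] at hE
    have h1 : ∑ j : S, (((j : ℕ+) : ℝ) ^ 2 + m) * (x j ^ 2 + y j ^ 2) ≤
        ∑' j : ℕ+, ((j : ℝ) ^ 2 + m) * (x j ^ 2 + y j ^ 2) := by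
      rw [Finset.sum_coe_sort S fun j : ℕ+ => ((j : ℝ) ^ 2 + m) * (x j ^ 2 + y j ^ 2)]
      exact hxy.sum_le_tsum S fun j _ => mul_nonneg (hw j).le (by positivity)
    have h2 : a 0 ≤ ∑' j : ℕ+, ((j : ℝ) ^ 2 + m) * (x j ^ 2 + y j ^ 2) := by
      refine le_trans ?_ h1
      rw [ha, Finset.mul_sum]
      refine Finset.sum_le_sum fun j _ => ?_
      rw [hp0]
      have h3 : 1 / (2 * Real.pi) ≤ 1 / 2 :=
        one_div_le_one_div_of_le two_pos (by linarith [Real.pi_gt_three])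
      calc 1 / (2 * Real.pi) * x j ^ 2 ≤ 1 / 2 * (x j ^ 2 + y j ^ 2) :=
            mul_le_mul h3 (le_add_of_nonneg_right (sq_nonneg _)) (sq_nonneg _) (by norm_num)
        _ ≤ _ := mul_le_mul_of_nonneg_right (hw2 j) (by positivity)
    have ha0 : 0 ≤ a 0 := by
      rw [ha]
      have := Real.pi_pos
      exact mul_nonneg (by positivity) (Finset.sum_nonneg fun _ _ => sq_nonneg _)
    refine energy_le_of_tsum_le (tsum_nonneg fun j => mul_nonneg (hw j).le (by positivity)) h2 ha0 ?_
    have : 0 ≤ ∑ j : S, (((j : ℕ+) : ℝ) ^ 2 + m) * (p j t ^ 2 + q j t ^ 2) :=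
      Finset.sum_nonneg fun j _ => mul_nonneg (hw j).le (by positivity)
    linarith
  · intro ε hε hε1 h0 t ht hT1 F
    have := energy_le_of_small hm hm1 hm0 (n := fun j : S => (j : ℕ+)) Subtype.val_injective
      hε hε1 hT1 (fun s hs => hp s (hsub t ht hs)) (fun s hs => hq s (hsub t ht hs))
      (fun s _ => ha s) (by
        simp only [hp0, hq0]
        rwa [Finset.sum_coe_sort S fun j : ℕ+ => x j ^ 2 + y j ^ 2])
    refine le_trans ?_ this
    calc ∑ j ∈ F, (P j t ^ 2 + Q j t ^ 2) ≤ ∑ j ∈ F ∪ S, (P j t ^ 2 + Q j t ^ 2) :=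
          Finset.sum_le_sum_of_subset_of_nonneg Finset.subset_union_left fun j _ _ => by positivity
      _ = ∑ j ∈ S, (P j t ^ 2 + Q j t ^ 2) := by
          refine (Finset.sum_subset Finset.subset_union_right fun j _ hj => ?_).symm
          rw [hP0 j hj, hQ0 j hj]; simp
      _ = ∑ j : S, (p j t ^ 2 + q j t ^ 2) := by
          rw [← Finset.sum_coe_sort S]; simp only [hPS, hQS]
      _ ≤ _ := le_rfl

section Limits

/-- Convergence along `l ×ˢ 𝓝 x` to a function continuous at `x` encodes uniform convergence near
`x`, which is what exchanging limit and derivative needs. It is used for the truncations and again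
for the cut-off test functions. -/
theorem hasDerivAt_of_tendsto_prod {ι : Type} {l : Filter ι} [NeBot l] {f f' : ι → ℝ → ℝ}
    {g g' : ℝ → ℝ} {x : ℝ}
    (hf' : Tendsto (fun n : ι × ℝ => f' n.1 n.2) (l ×ˢ 𝓝 x) (𝓝 (g' x))) (hg' : ContinuousAt g' x)
    (hf : ∀ᶠ n : ι × ℝ in l ×ˢ 𝓝 x, HasDerivAt (f n.1) (f' n.1 n.2) n.2)
    (hfg : ∀ᶠ y in 𝓝 x, Tendsto (fun n => f n y) l (𝓝 (g y))) : HasDerivAt g (g' x) x := by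
  refine hasDerivAt_of_tendstoUniformlyOnFilter ?_ hf hfg
  rw [Metric.tendstoUniformlyOnFilter_iff]
  intro ε hε
  have h : Tendsto (fun n : ι × ℝ => dist (g' n.2) (f' n.1 n.2)) (l ×ˢ 𝓝 x) (𝓝 0) := by
    have := (hg'.tendsto.comp (tendsto_snd (f := l) (g := 𝓝 x))).dist hf'
    rwa [dist_self] at this
  exact h.eventually (gt_mem_nhds hε)

theorem tendsto_prod_of_tendstoUniformlyOn {ι : Type} {l : Filter ι} {f : ι → ℝ → ℝ} {g : ℝ → ℝ}
    {s : Set ℝ} {x : ℝ} (h : TendstoUniformlyOn f g l s) (hs : s ∈ 𝓝 x) (hg : ContinuousAt g x) :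
    Tendsto (fun n : ι × ℝ => f n.1 n.2) (l ×ˢ 𝓝 x) (𝓝 (g x)) := by
  rw [Metric.tendsto_nhds]
  intro ε hε
  rw [Metric.tendstoUniformlyOn_iff] at h
  have h1 := (h (ε / 2) (half_pos hε)).prod_mk
    (hs : ∀ᶠ y in 𝓝 x, y ∈ s) |>.and ((Metric.tendsto_nhds.1 hg.tendsto (ε / 2)
      (half_pos hε)).prod_inr l)
  filter_upwards [h1] with n hn
  have := dist_triangle_left (f n.1 n.2) (g x) (g n.2)
  have := hn.1.1 n.2 hn.1.2
  linarith [hn.2]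

/-- A sequence of functions that is uniformly Cauchy on compact intervals. -/
theorem exists_tendstoUniformlyOn_Icc {f : ℕ → ℝ → ℝ}
    (h : ∀ k : ℕ, ∃ b : ℕ → ℝ, Tendsto b atTop (𝓝 0) ∧ ∀ N M, k < N → N ≤ M →
      ∀ t ∈ Icc (-k : ℝ) k, |f M t - f N t| ≤ b N) :
    ∃ g : ℝ → ℝ, ∀ k : ℕ, TendstoUniformlyOn f g atTop (Icc (-k : ℝ) k) := by
  have hc : ∀ k : ℕ, UniformCauchySeqOn f atTop (Icc (-k : ℝ) k) := by
    intro k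
    obtain ⟨b, hb, hle⟩ := h k
    rw [Metric.uniformCauchySeqOn_iff]
    intro ε hε
    obtain ⟨N, hN⟩ := eventually_atTop.1 (hb.eventually (gt_mem_nhds hε))
    have hmax : ∀ M n, max N (k + 1) ≤ n → n ≤ M → ∀ t ∈ Icc (-k : ℝ) k,
        dist (f M t) (f n t) < ε := fun M n hn hM t ht =>
      (hle n M (by have := le_max_right N (k + 1); omega) hM t ht).trans_lt
        (hN n ((le_max_left _ _).trans hn))
    refine ⟨max N (k + 1), fun n hn n' hn' t ht => ?_⟩
    rcases le_total n n' with hnn | hnn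
    · rw [dist_comm]; exact hmax n' n hn hnn t ht
    · exact hmax n n' hn' hnn t ht
  have hlim : ∀ t : ℝ, ∃ y, Tendsto (fun n => f n t) atTop (𝓝 y) := by
    intro t
    obtain ⟨k, hk⟩ := exists_nat_ge |t|
    exact cauchySeq_tendsto_of_complete ((hc k).cauchySeq (abs_le.1 hk))
  choose g hg using hlim
  exact ⟨g, fun k => (hc k).tendstoUniformlyOn_of_tendsto fun t _ => hg t⟩

end Limits

end Beam

/-! ### Global solutions of the mode equations -/

namespace Beam

variable {m : ℝ}

theorem uIcc_zero_subset_Ioo {t T : ℝ} (ht : t ∈ Ioo (-T) T) : uIcc 0 t ⊆ Ioo (-T) T :=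
  ordConnected_Ioo.uIcc_subset ⟨by linarith [ht.1, ht.2], by linarith [ht.1, ht.2]⟩ ht

set_option maxHeartbeats 1000000 in
/-- Global solutions of the mode equations, with the long-time bound for small data. -/
theorem exists_mode_solution (hm : -1 / 2 ≤ m) (hm1 : m ≤ 1) (hm0 : m ≠ 0) {x y : ℕ+ → ℝ}
    (hxy : Summable fun j : ℕ+ => ((j : ℝ) ^ 2 + m) * (x j ^ 2 + y j ^ 2)) :
    ∃ (a : ℝ → ℝ) (p q : ℕ+ → ℝ → ℝ), IsModeSolution m univ a p q ∧
      (∀ j, p j 0 = x j) ∧ (∀ j, q j 0 = y j) ∧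
      ∀ ε, 0 < ε → ε ≤ eps1 m → ∑' j, (x j ^ 2 + y j ^ 2) ≤ 3 * ε ^ 2 → ∀ t,
        |t| * ε ^ 6 ≤ T1 m ε → ∀ F : Finset ℕ+, ∑ j ∈ F, (p j t ^ 2 + q j t ^ 2) ≤ 3.5 * ε ^ 2 := by
  classical
  have hw2 : ∀ j : ℕ+, 1 / 2 ≤ (j : ℝ) ^ 2 + m := fun j => by nlinarith [one_le_cast j]
  have hρ0 : ∀ j, 0 ≤ x j ^ 2 + y j ^ 2 := fun j => by positivity
  have hρ : Summable fun j => x j ^ 2 + y j ^ 2 :=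
    Summable.of_nonneg_of_le hρ0 (fun j => by nlinarith [hw2 j, hρ0 j]) (hxy.mul_left 2)
  set W := ∑' j : ℕ+, ((j : ℝ) ^ 2 + m) * (x j ^ 2 + y j ^ 2) with hW
  have hW0 : 0 ≤ W := tsum_nonneg fun j => mul_nonneg (by linarith [hw2 j]) (hρ0 j)
  let S : ℕ → Finset ℕ+ := fun N => Finset.Iic N.succPNat
  have hS : Monotone S := fun N M h => Finset.Iic_subset_Iic.2 (Nat.succPNat_mono h)
  have hSmem : ∀ j : ℕ+, ∀ᶠ N in atTop, j ∈ S N := fun j => by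
    filter_upwards [eventually_ge_atTop (j : ℕ)] with N hN
    exact Finset.mem_Iic.2 (PNat.coe_le_coe _ _ |>.1 (by simp; omega))
  have hStop : Tendsto S atTop atTop := tendsto_atTop_finset_of_monotone hS fun j =>
    (hSmem j).exists
  -- The `N`-th truncation keeps the modes `j ≤ N + 1` and lives on `(-(N+1), N+1)`, so each compact
  -- interval is covered for all large `N`.
  choose a p q hsol hp0 hq0 haW hsmall using fun N : ℕ =>
    exists_truncated_solution hm hm1 hm0 hxy (S N) (T := (N : ℝ) + 1) (by positivity)
  have hIcc : ∀ {k N : ℕ}, k < N + 1 → Icc (-k : ℝ) k ⊆ Ioo (-((N : ℝ) + 1)) ((N : ℝ) + 1) := by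
    intro k N hk t ht
    have : (k : ℝ) < N + 1 := by exact_mod_cast hk
    exact ⟨by linarith [ht.1], by linarith [ht.2]⟩
  set τ : ℕ → ℝ := fun N => ∑' j, (x j ^ 2 + y j ^ 2) - ∑ j ∈ S N, (x j ^ 2 + y j ^ 2) with hτ
  have hτ0 : Tendsto τ atTop (𝓝 0) := by
    have := (tendsto_const_nhds (x := ∑' j, (x j ^ 2 + y j ^ 2))).sub (hρ.hasSum.comp hStop)
    rwa [sub_self] at this
  have hdata : ∀ N j, p N j 0 ^ 2 + q N j 0 ^ 2 ≤ x j ^ 2 + y j ^ 2 := fun N j => by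
    rw [hp0, hq0]; split_ifs
    · exact le_rfl
    · simpa using hρ0 j
  -- Two truncations `N ≤ M` differ initially by a part of the tail `τ N`. Stability turns this into
  -- a Cauchy estimate, with `C` depending on `k` but not on `N` and `M`.
  have hst : ∀ k : ℕ, ∃ C, 0 ≤ C ∧ ∀ N M, k < N → N ≤ M → ∀ t ∈ Icc (-k : ℝ) k,
      (a M t - a N t) ^ 2 ≤ C * τ N ∧
      ∀ j, (p M j t - p N j t) ^ 2 + (q M j t - q N j t) ^ 2 ≤
        C * (1 + (x j ^ 2 + y j ^ 2)) * τ N := by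
    intro k
    obtain ⟨C₁, hC₁, h₁⟩ := IsModeSolution.exists_stability (E := ∑' j, (x j ^ 2 + y j ^ 2))
      hm (k : ℝ) (by positivity : 0 ≤ W + 1) (tsum_nonneg hρ0)
    obtain ⟨C₂, hC₂, h₂⟩ := IsModeSolution.exists_stability (E := ∑' j, (x j ^ 2 + y j ^ 2))
      hm (-k : ℝ) (by positivity : 0 ≤ W + 1) (tsum_nonneg hρ0)
    refine ⟨C₁ + C₂, by positivity, fun N M hkN hNM t ht => ?_⟩
    have hs : Summable fun j => p N j 0 ^ 2 + q N j 0 ^ 2 :=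
      Summable.of_nonneg_of_le (fun j => by positivity) (hdata N) hρ
    have hsE : ∑' j, (p N j 0 ^ 2 + q N j 0 ^ 2) ≤ ∑' j, (x j ^ 2 + y j ^ 2) :=
      hs.tsum_le_tsum (hdata N) hρ
    set D := ∑ j ∈ S M \ S N, (x j ^ 2 + y j ^ 2) with hDdef
    have hdiff : ∀ j, (p M j 0 - p N j 0) ^ 2 + (q M j 0 - q N j 0) ^ 2 =
        if j ∈ S M \ S N then x j ^ 2 + y j ^ 2 else 0 := by
      intro j
      have := @hS N M hNM j
      rw [hp0, hp0, hq0, hq0]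
      simp only [Finset.mem_sdiff]
      by_cases h1 : j ∈ S M <;> by_cases h2 : j ∈ S N
      · rw [if_pos h1, if_pos h1, if_pos h2, if_pos h2, if_neg (fun h => h.2 h2)]; ring
      · rw [if_pos h1, if_pos h1, if_neg h2, if_neg h2, if_pos ⟨h1, h2⟩]; ring
      · exact absurd (this h2) h1
      · rw [if_neg h1, if_neg h1, if_neg h2, if_neg h2, if_neg (fun h => h1 h.1)]; ring
    have hD : HasSum (fun j => (p M j 0 - p N j 0) ^ 2 + (q M j 0 - q N j 0) ^ 2) D := by
      have : D = ∑ j ∈ S M \ S N, if j ∈ S M \ S N then x j ^ 2 + y j ^ 2 else 0 :=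
        Finset.sum_congr rfl fun j hj => by rw [if_pos hj]
      rw [this, funext hdiff]
      exact hasSum_sum_of_ne_finset_zero fun j hj => if_neg hj
    have hDτ : D ≤ τ N := by
      have h1 := Finset.sum_sdiff (f := fun j => x j ^ 2 + y j ^ 2) (hS hNM)
      have h2 := hρ.sum_le_tsum (S M) fun j _ => hρ0 j
      simp only [hτ]
      linarith
    have hD0 : 0 ≤ D := Finset.sum_nonneg fun j _ => hρ0 j
    have hfin : ∀ C, 0 ≤ C → C ≤ C₁ + C₂ → ((a M t - a N t) ^ 2 ≤ C * D ∧
        ∀ j, (p M j t - p N j t) ^ 2 + (q M j t - q N j t) ^ 2 ≤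
        C * ((p M j 0 - p N j 0) ^ 2 + (q M j 0 - q N j 0) ^ 2 +
          (p N j 0 ^ 2 + q N j 0 ^ 2) * D)) →
        (a M t - a N t) ^ 2 ≤ (C₁ + C₂) * τ N ∧
        ∀ j, (p M j t - p N j t) ^ 2 + (q M j t - q N j t) ^ 2 ≤
          (C₁ + C₂) * (1 + (x j ^ 2 + y j ^ 2)) * τ N := by
      rintro C hC hCC ⟨g1, g2⟩
      refine ⟨g1.trans (mul_le_mul hCC hDτ hD0 (by positivity)), fun j => (g2 j).trans ?_⟩
      rw [mul_assoc]
      refine mul_le_mul hCC ?_ (by positivity) (by positivity)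
      have e1 : (p M j 0 - p N j 0) ^ 2 + (q M j 0 - q N j 0) ^ 2 ≤ D := by
        rw [← hD.tsum_eq]
        exact hD.summable.le_tsum j fun _ _ => by positivity
      have e2 : (p N j 0 ^ 2 + q N j 0 ^ 2) * D ≤ (x j ^ 2 + y j ^ 2) * D :=
        mul_le_mul_of_nonneg_right (hdata N j) hD0
      have e3 : (1 + (x j ^ 2 + y j ^ 2)) * D ≤ (1 + (x j ^ 2 + y j ^ 2)) * τ N :=
        mul_le_mul_of_nonneg_left hDτ (by positivity)
      linarith
    have hN : k < N + 1 := by omega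
    have hM : k < M + 1 := by omega
    rcases le_total 0 t with h0 | h0
    · have hsubk : uIcc (0 : ℝ) k ⊆ Icc (-k : ℝ) k := by
        rw [uIcc_of_le (by positivity)]; exact Icc_subset_Icc (by simp) le_rfl
      refine hfin C₁ hC₁ (by linarith) (h₁ _ _ _ _ _ _ D
        ((hsol M).mono (hsubk.trans (hIcc hM))) ((hsol N).mono (hsubk.trans (hIcc hN)))
        (fun s hs => haW M s (hIcc hM (hsubk hs))) (fun s hs => haW N s (hIcc hN (hsubk hs)))
        hs hsE hD t ?_)
      rw [uIcc_of_le (by positivity)]; exact ⟨h0, ht.2⟩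
    · have hsubk : uIcc (0 : ℝ) (-k) ⊆ Icc (-k : ℝ) k := by
        rw [uIcc_of_ge (by simp)]; exact Icc_subset_Icc le_rfl (by simp)
      refine hfin C₂ hC₂ (by linarith) (h₂ _ _ _ _ _ _ D
        ((hsol M).mono (hsubk.trans (hIcc hM))) ((hsol N).mono (hsubk.trans (hIcc hN)))
        (fun s hs => haW M s (hIcc hM (hsubk hs))) (fun s hs => haW N s (hIcc hN (hsubk hs)))
        hs hsE hD t ?_)
      rw [uIcc_of_ge (by simp)]; exact ⟨ht.1, h0⟩
  have hsqrt : ∀ C : ℝ, Tendsto (fun N => Real.sqrt (C * τ N)) atTop (𝓝 0) := fun C => by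
    have := ((hτ0.const_mul C).sqrt)
    simpa using this
  obtain ⟨α, hα⟩ : ∃ g : ℝ → ℝ, ∀ k : ℕ, TendstoUniformlyOn a g atTop (Icc (-k : ℝ) k) := by
    refine exists_tendstoUniformlyOn_Icc fun k => ?_
    obtain ⟨C, -, h⟩ := hst k
    exact ⟨_, hsqrt C, fun N M hkN hNM t ht => Real.abs_le_sqrt (h N M hkN hNM t ht).1⟩
  have hP : ∀ j, ∃ g : ℝ → ℝ, ∀ k : ℕ,
      TendstoUniformlyOn (fun N => p N j) g atTop (Icc (-k : ℝ) k) := by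
    refine fun j => exists_tendstoUniformlyOn_Icc fun k => ?_
    obtain ⟨C, -, h⟩ := hst k
    exact ⟨_, hsqrt (C * (1 + (x j ^ 2 + y j ^ 2))), fun N M hkN hNM t ht =>
      Real.abs_le_sqrt ((le_add_of_nonneg_right (sq_nonneg _)).trans ((h N M hkN hNM t ht).2 j))⟩
  have hQ : ∀ j, ∃ g : ℝ → ℝ, ∀ k : ℕ,
      TendstoUniformlyOn (fun N => q N j) g atTop (Icc (-k : ℝ) k) := by
    refine fun j => exists_tendstoUniformlyOn_Icc fun k => ?_
    obtain ⟨C, -, h⟩ := hst k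
    exact ⟨_, hsqrt (C * (1 + (x j ^ 2 + y j ^ 2))), fun N M hkN hNM t ht =>
      Real.abs_le_sqrt ((le_add_of_nonneg_left (sq_nonneg _)).trans ((h N M hkN hNM t ht).2 j))⟩
  choose P hP using hP
  choose Q hQ using hQ
  have hk : ∀ t : ℝ, ∃ k : ℕ, Icc (-k : ℝ) k ∈ 𝓝 t ∧ t ∈ Icc (-k : ℝ) k := by
    intro t
    obtain ⟨k, hk⟩ := exists_nat_gt |t|
    obtain ⟨h1, h2⟩ := abs_lt.1 hk
    exact ⟨k, Icc_mem_nhds h1 h2, h1.le, h2.le⟩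
  have hlim : ∀ {f : ℕ → ℝ → ℝ} {g : ℝ → ℝ},
      (∀ k : ℕ, TendstoUniformlyOn f g atTop (Icc (-k : ℝ) k)) →
      ∀ t, Tendsto (fun N => f N t) atTop (𝓝 (g t)) := fun h t => by
    obtain ⟨k, -, ht⟩ := hk t
    exact (h k).tendsto_at ht
  have hcont : ∀ {f : ℕ → ℝ → ℝ} {g : ℝ → ℝ},
      (∀ k : ℕ, TendstoUniformlyOn f g atTop (Icc (-k : ℝ) k)) →
      (∀ N, ContinuousOn (f N) (Ioo (-((N : ℝ) + 1)) ((N : ℝ) + 1))) → ∀ t, ContinuousAt g t := by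
    intro f g h hf t
    obtain ⟨k, hk', -⟩ := hk t
    refine ((h k).continuousOn (Eventually.frequently ?_)).continuousAt hk'
    filter_upwards [eventually_ge_atTop k] with N hN
    exact (hf N).mono (hIcc (by omega))
  have hαc := hcont hα fun N => (hsol N).continuousOn
  have hPc := fun j => hcont (hP j) fun N t ht =>
    ((hsol N).hasDerivAt_p t ht j).continuousAt.continuousWithinAt
  have hQc := fun j => hcont (hQ j) fun N t ht =>
    ((hsol N).hasDerivAt_q t ht j).continuousAt.continuousWithinAt
  have hprod : ∀ {f : ℕ → ℝ → ℝ} {g : ℝ → ℝ},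
      (∀ k : ℕ, TendstoUniformlyOn f g atTop (Icc (-k : ℝ) k)) → (∀ t, ContinuousAt g t) →
      ∀ t, Tendsto (fun n : ℕ × ℝ => f n.1 n.2) (atTop ×ˢ 𝓝 t) (𝓝 (g t)) := by
    intro f g h hg t
    obtain ⟨k, hk', -⟩ := hk t
    exact tendsto_prod_of_tendstoUniformlyOn (h k) hk' (hg t)
  have hev : ∀ t : ℝ, ∀ᶠ n : ℕ × ℝ in atTop ×ˢ 𝓝 t,
      n.2 ∈ Ioo (-((n.1 : ℝ) + 1)) ((n.1 : ℝ) + 1) := by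
    intro t
    obtain ⟨k, hk', -⟩ := hk t
    filter_upwards [(eventually_ge_atTop k).prod_mk (show ∀ᶠ s in 𝓝 t, s ∈ Icc (-k : ℝ) k from hk')]
      with n hn
    exact hIcc (by omega) hn.2
  refine ⟨α, P, Q, ⟨fun t _ j => ?_, fun t _ j => ?_, fun t _ => (hαc t).continuousWithinAt,
    fun t _ => ?_⟩, fun j => ?_, fun j => ?_, ?_⟩
  · refine hasDerivAt_of_tendsto_prod (l := atTop) (f := fun N => p N j)
      (f' := fun N s => omega m j * q N j s) (g' := fun s => omega m j * Q j s)
      ((hprod (hQ j) (hQc j) t).const_mul _) (continuousAt_const.mul (hQc j t)) ?_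
      (Eventually.of_forall (hlim (hP j)))
    filter_upwards [hev t] with n hn using (hsol n.1).hasDerivAt_p n.2 hn j
  · refine hasDerivAt_of_tendsto_prod (l := atTop) (f := fun N => q N j)
      (f' := fun N s => -(omega m j + a N s * bcoef m j) * p N j s)
      (g' := fun s => -(omega m j + α s * bcoef m j) * P j s) ?_ ?_ ?_
      (Eventually.of_forall (hlim (hQ j)))
    · exact ((tendsto_const_nhds.add ((hprod hα hαc t).mul_const _)).neg).mul
        (hprod (hP j) (hPc j) t)
    · exact ((continuousAt_const.add ((hαc t).mul continuousAt_const)).neg).mul (hPc j t)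
    · filter_upwards [hev t] with n hn using (hsol n.1).hasDerivAt_q n.2 hn j
  -- The modewise exponential bound dominates `p_j²` by a summable sequence uniformly in `N`, so no
  -- mass escapes to high modes and the relation between `a` and `∑ p_j²` survives the limit.
  · have hT : Tendsto (fun N => ∑' j, p N j t ^ 2) atTop (𝓝 (∑' j, P j t ^ 2)) ∧
        Summable fun j => P j t ^ 2 := by
      set G := Real.exp (cc m * (W + 1 + 1) * |t|)
      obtain ⟨k, -, htk⟩ := hk t
      have hbd : ∀ᶠ N in atTop, ∀ j, p N j t ^ 2 ≤ G * (x j ^ 2 + y j ^ 2) := by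
        filter_upwards [eventually_ge_atTop k] with N hN j
        have htN := hIcc (show k < N + 1 by omega) htk
        have := ((hsol N).mono (uIcc_zero_subset_Ioo htN)).mode_le hm (A := W + 1) (by positivity)
          (fun s hs => haW N s (uIcc_zero_subset_Ioo htN hs)) j
        refine (le_add_of_nonneg_right (sq_nonneg (q N j t))).trans (this.trans ?_)
        exact mul_le_mul_of_nonneg_left (hdata N j) (Real.exp_pos _).le
      constructor
      · refine tendsto_tsum_of_dominated_convergence (hρ.mul_left G)
          (fun j => (hlim (hP j) t).pow 2) ?_
        filter_upwards [hbd] with N hN j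
        rw [Real.norm_eq_abs, abs_of_nonneg (sq_nonneg _)]
        exact hN j
      · refine Summable.of_nonneg_of_le (fun j => sq_nonneg _) (fun j => ?_) (hρ.mul_left G)
        exact le_of_tendsto ((hlim (hP j) t).pow 2) (hbd.mono fun N hN => hN j)
    have hT' : Tendsto (fun N => ∑' j, p N j t ^ 2) atTop (𝓝 (2 * Real.pi * α t)) := by
      obtain ⟨k, -, htk⟩ := hk t
      refine ((hlim hα t).const_mul (2 * Real.pi)).congr' ?_
      filter_upwards [eventually_ge_atTop k] with N hN
      exact ((hsol N).hasSum t (hIcc (show k < N + 1 by omega) htk)).tsum_eq.symm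
    rw [tendsto_nhds_unique hT' hT.1]
    exact hT.2.hasSum
  · refine tendsto_nhds_unique (hlim (hP j) 0) (tendsto_const_nhds.congr' ?_)
    filter_upwards [hSmem j] with N hN
    rw [hp0, if_pos hN]
  · refine tendsto_nhds_unique (hlim (hQ j) 0) (tendsto_const_nhds.congr' ?_)
    filter_upwards [hSmem j] with N hN
    rw [hq0, if_pos hN]
  · intro ε hε hε1 h0 t ht F
    have : Tendsto (fun N => ∑ j ∈ F, (p N j t ^ 2 + q N j t ^ 2)) atTop
        (𝓝 (∑ j ∈ F, (P j t ^ 2 + Q j t ^ 2))) :=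
      tendsto_finsetSum _ fun j _ => ((hlim (hP j) t).pow 2).add ((hlim (hQ j) t).pow 2)
    obtain ⟨k, -, htk⟩ := hk t
    refine le_of_tendsto this ?_
    filter_upwards [eventually_ge_atTop k] with N hN
    exact hsmall N ε hε hε1 ((hρ.sum_le_tsum (S N) fun j _ => hρ0 j).trans h0) t
      (hIcc (show k < N + 1 by omega) htk) ht F

end Beam

/-! ### Sine series -/

namespace Beam

/-- The amplitude of the eigenfunctions. -/
theorem abs_phi_le (j : ℕ+) (x : ℝ) : |phi j x| ≤ 1 := by
  have h1 : Real.sqrt (2 / Real.pi) ≤ 1 := by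
    rw [Real.sqrt_le_one, div_le_one Real.pi_pos]
    linarith [Real.pi_gt_three]
  rw [phi, abs_mul, abs_of_nonneg (Real.sqrt_nonneg _)]
  exact mul_le_one₀ h1 (abs_nonneg _) (Real.abs_sin_le_one _)

@[fun_prop]
theorem continuous_phi (j : ℕ+) : Continuous (phi j) := by
  unfold phi; fun_prop

theorem phi_zero (j : ℕ+) : phi j 0 = 0 := by simp [phi]

theorem phi_pi (j : ℕ+) : phi j Real.pi = 0 := by
  simp [phi, Real.sin_nat_mul_pi]

/-- The derivative of `phi`, up to the factor `j`. -/
noncomputable def psi (j : ℕ+) (x : ℝ) : ℝ := Real.sqrt (2 / Real.pi) * Real.cos ((j : ℝ) * x)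

theorem abs_psi_le (j : ℕ+) (x : ℝ) : |psi j x| ≤ 1 := by
  have h1 : Real.sqrt (2 / Real.pi) ≤ 1 := by
    rw [Real.sqrt_le_one, div_le_one Real.pi_pos]
    linarith [Real.pi_gt_three]
  rw [psi, abs_mul, abs_of_nonneg (Real.sqrt_nonneg _)]
  exact mul_le_one₀ h1 (abs_nonneg _) (Real.abs_cos_le_one _)

theorem hasDerivAt_phi (j : ℕ+) (x : ℝ) : HasDerivAt (phi j) (j * psi j x) x := by
  have := (((hasDerivAt_id x).const_mul (j : ℝ)).sin).const_mul (Real.sqrt (2 / Real.pi))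
  refine this.congr_deriv ?_
  simp [psi]; ring

theorem hasDerivAt_psi (j : ℕ+) (x : ℝ) : HasDerivAt (psi j) (-(j * phi j x)) x := by
  have := (((hasDerivAt_id x).const_mul (j : ℝ)).cos).const_mul (Real.sqrt (2 / Real.pi))
  refine this.congr_deriv ?_
  simp [phi]; ring

theorem integral_phi_mul_phi (j k : ℕ+) :
    ∫ x in (0 : ℝ)..Real.pi, phi j x * phi k x = if j = k then 1 else 0 := by
  have hpi := Real.pi_pos
  have hc : Real.sqrt (2 / Real.pi) * Real.sqrt (2 / Real.pi) = 2 / Real.pi :=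
    Real.mul_self_sqrt (by positivity)
  split_ifs with h
  · subst h
    have e : ∀ x, phi j x * phi j x = 2 / Real.pi * (1 / 2) * (1 - Real.cos (2 * (j : ℝ) * x)) := by
      intro x
      rw [phi, mul_mul_mul_comm, hc, ← sq, Real.sin_sq, Real.cos_sq]
      ring_nf
    simp_rw [e]
    rw [intervalIntegral.integral_const_mul, intervalIntegral.integral_sub (by simp)
      (Continuous.intervalIntegrable (by fun_prop) _ _)]
    have hj : (2 * (j : ℝ)) ≠ 0 := by have := one_le_cast j; positivity
    rw [intervalIntegral.integral_comp_mul_left (fun y => Real.cos y) hj, integral_cos]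
    have : Real.sin (2 * (j : ℝ) * Real.pi) = 0 := by
      have := Real.sin_nat_mul_pi (2 * j)
      push_cast at this
      exact this
    simp [this]
    field_simp
  · set a : ℝ := (j : ℝ) - k
    set b : ℝ := (j : ℝ) + k
    have ha : a ≠ 0 := sub_ne_zero.2 (by exact_mod_cast fun h' => h (PNat.coe_injective h'))
    have hb : b ≠ 0 := by have := one_le_cast j; have := one_le_cast k; positivity
    have e : ∀ x, phi j x * phi k x =
        2 / Real.pi * (1 / 2) * (Real.cos (a * x) - Real.cos (b * x)) := by
      intro x
      rw [phi, phi, mul_mul_mul_comm, hc, show a * x = j * x - k * x by ring,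
        show b * x = j * x + k * x by ring, Real.cos_sub, Real.cos_add]
      ring
    simp_rw [e]
    rw [intervalIntegral.integral_const_mul, intervalIntegral.integral_sub
      (Continuous.intervalIntegrable (by fun_prop) _ _)
      (Continuous.intervalIntegrable (by fun_prop) _ _),
      intervalIntegral.integral_comp_mul_left (fun y => Real.cos y) ha,
      intervalIntegral.integral_comp_mul_left (fun y => Real.cos y) hb, integral_cos, integral_cos]
    have h1 : Real.sin (a * Real.pi) = 0 := by
      have := Real.sin_int_mul_pi ((j : ℤ) - k)
      push_cast at this
      exact this
    have h2 : Real.sin (b * Real.pi) = 0 := by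
      have := Real.sin_int_mul_pi ((j : ℤ) + k)
      push_cast at this
      exact this
    simp [h1, h2]

/-- The sine series with the given coefficients. -/
noncomputable def series (c : ℕ+ → ℝ) (x : ℝ) : ℝ := ∑' j, c j * phi j x

section Series

variable {c : ℕ+ → ℝ}

theorem norm_mul_phi_le (c : ℕ+ → ℝ) (j : ℕ+) (x : ℝ) : ‖c j * phi j x‖ ≤ |c j| := by
  rw [norm_mul, Real.norm_eq_abs, Real.norm_eq_abs]
  exact mul_le_of_le_one_right (abs_nonneg _) (abs_phi_le j x)

theorem hasSum_series (hc : Summable fun j => |c j|) (x : ℝ) :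
    HasSum (fun j => c j * phi j x) (series c x) :=
  (Summable.of_norm_bounded hc fun j => norm_mul_phi_le c j x).hasSum

theorem continuous_series (hc : Summable fun j => |c j|) : Continuous (series c) :=
  continuous_tsum (fun j => by fun_prop) hc fun j x => norm_mul_phi_le c j x

theorem abs_series_le (hc : Summable fun j => |c j|) (x : ℝ) : |series c x| ≤ ∑' j, |c j| :=
  tsum_of_norm_bounded hc.hasSum fun j => norm_mul_phi_le c j x

theorem series_zero (c : ℕ+ → ℝ) : series c 0 = 0 := by simp [series, phi_zero]

theorem series_pi (c : ℕ+ → ℝ) : series c Real.pi = 0 := by simp [series, phi_pi]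

theorem hasSum_integral_series_mul (hc : Summable fun j => |c j|) {g : ℝ → ℝ}
    (hg : ContinuousOn g (Icc 0 Real.pi)) :
    HasSum (fun j => c j * ∫ x in (0 : ℝ)..Real.pi, phi j x * g x)
      (∫ x in (0 : ℝ)..Real.pi, series c x * g x) := by
  have hpi := Real.pi_pos
  obtain ⟨B, hB⟩ := isCompact_Icc.exists_bound_of_continuousOn hg
  simp_rw [← intervalIntegral.integral_const_mul, ← mul_assoc]
  have hcont : ∀ j, ContinuousOn (fun x => c j * phi j x * g x) (uIoc 0 Real.pi) := fun j =>
    (ContinuousOn.mul (by fun_prop) hg).mono (by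
      rw [uIoc_of_le hpi.le]; exact Ioc_subset_Icc_self)
  refine intervalIntegral.hasSum_integral_of_dominated_convergence (fun j _ => |c j| * B)
    (fun j => (hcont j).aestronglyMeasurable measurableSet_uIoc) (fun j => ?_) ?_ ?_ ?_
  · refine Eventually.of_forall fun x hx => ?_
    rw [uIoc_of_le hpi.le] at hx
    rw [norm_mul]
    exact mul_le_mul (norm_mul_phi_le c j x) (hB x (Ioc_subset_Icc_self hx)) (norm_nonneg _)
      (abs_nonneg _)
  · exact Eventually.of_forall fun x _ => hc.mul_right B
  · simp
  · exact Eventually.of_forall fun x _ => (hasSum_series hc x).mul_right _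

theorem coeff_series (hc : Summable fun j => |c j|) (k : ℕ+) : coeff (series c) k = c k := by
  have h := hasSum_integral_series_mul hc (continuous_phi k).continuousOn
  simp_rw [integral_phi_mul_phi] at h
  have h' := hasSum_ite_eq k (c k)
  refine h.unique ?_
  convert h' using 2 with j
  split_ifs with h <;> simp [h]

theorem hasDerivAt_series (hc : Summable fun j : ℕ+ => (j : ℝ) * |c j|) (x : ℝ) :
    HasDerivAt (series c) (∑' j : ℕ+, (j * c j) * psi j x) x := by
  refine hasDerivAt_tsum (g := fun j y => c j * phi j y) (g' := fun j y => (j * c j) * psi j y)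
    (y₀ := 0) hc (fun j y => ((hasDerivAt_phi j y).const_mul (c j)).congr_deriv (by ring))
    (fun j y => ?_)
    (by simp [phi_zero]) x
  rw [norm_mul, norm_mul, Real.norm_eq_abs, Real.norm_eq_abs, Real.norm_eq_abs, Nat.abs_cast]
  exact mul_le_of_le_one_right (by positivity) (abs_psi_le j y)

theorem summable_cos_series (hc : Summable fun j => |c j|) (x : ℝ) :
    Summable fun j => c j * psi j x :=
  Summable.of_norm_bounded hc fun j => by
    rw [norm_mul, Real.norm_eq_abs, Real.norm_eq_abs]
    exact mul_le_of_le_one_right (abs_nonneg _) (abs_psi_le j x)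

theorem summable_cast_mul (hc : Summable fun j : ℕ+ => (j : ℝ) ^ 2 * |c j|) :
    Summable fun j : ℕ+ => (j : ℝ) * |c j| :=
  Summable.of_nonneg_of_le (fun j => by positivity) (fun j =>
    mul_le_mul_of_nonneg_right (by nlinarith [one_le_cast j]) (abs_nonneg _)) hc

theorem summable_of_cast_mul (hc : Summable fun j : ℕ+ => (j : ℝ) * |c j|) :
    Summable fun j : ℕ+ => |c j| :=
  Summable.of_nonneg_of_le (fun j => by positivity) (fun j =>
    le_mul_of_one_le_left (abs_nonneg _) (one_le_cast j)) hc

theorem summable_abs_sq_mul (hc : Summable fun j : ℕ+ => (j : ℝ) ^ 2 * |c j|) :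
    Summable fun j : ℕ+ => |(-(j : ℝ) ^ 2 * c j)| := by
  refine hc.congr fun j => ?_
  rw [abs_mul, abs_neg, abs_pow, Nat.abs_cast]

theorem hasDerivAt_deriv_series (hc : Summable fun j : ℕ+ => (j : ℝ) ^ 2 * |c j|) (x : ℝ) :
    HasDerivAt (deriv (series c)) (series (fun j => -(j : ℝ) ^ 2 * c j) x) x := by
  have hc1 := summable_cast_mul hc
  have h1 : deriv (series c) = fun x => ∑' j : ℕ+, (j * c j) * psi j x :=
    funext fun y => (hasDerivAt_series hc1 y).deriv
  rw [h1]
  refine hasDerivAt_tsum (g := fun (j : ℕ+) y => (j * c j) * psi j y)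
    (g' := fun (j : ℕ+) y => (-(j : ℝ) ^ 2 * c j) * phi j y) (y₀ := 0) hc
    (fun j y => ((hasDerivAt_psi j y).const_mul ((j : ℝ) * c j)).congr_deriv (by ring))
    (fun j y => ?_) (summable_cos_series (c := fun j : ℕ+ => (j : ℝ) * c j)
      (hc1.congr fun j => by rw [abs_mul, Nat.abs_cast]) 0) x
  rw [norm_mul, norm_mul, norm_neg, norm_pow, Real.norm_natCast, Real.norm_eq_abs, Real.norm_eq_abs]
  exact mul_le_of_le_one_right (by positivity) (abs_phi_le j y)

end Series

end Beam

/-! ### Weighted coefficient spaces, Parseval's identity, the weak form -/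

namespace Beam

theorem summable_pnat_rpow {r : ℝ} (hr : r < -1) : Summable fun j : ℕ+ => (j : ℝ) ^ r :=
  (Real.summable_nat_rpow.2 hr).comp_injective PNat.coe_injective

theorem cast_pnat_pos (j : ℕ+) : (0 : ℝ) < j := one_pos.trans_le (one_le_cast j)

/-- Write `j^r |c_j| = j^(r-σ) · j^σ |c_j|` and bound the product by the sum of the squares; the
first square is summable since `2(r - σ) < -1`. -/
theorem summable_rpow_mul_abs {c : ℕ+ → ℝ} {r σ : ℝ}
    (h : Summable fun j : ℕ+ => (j : ℝ) ^ (2 * σ) * c j ^ 2) (hr : r < σ - 1 / 2) :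
    Summable fun j : ℕ+ => (j : ℝ) ^ r * |c j| := by
  have h1 : Summable fun j : ℕ+ => (j : ℝ) ^ (2 * (r - σ)) := summable_pnat_rpow (by linarith)
  refine Summable.of_nonneg_of_le (fun j => by positivity) (fun j => ?_) (h1.add h)
  have hj := cast_pnat_pos j
  have e1 : (j : ℝ) ^ (2 * (r - σ)) = ((j : ℝ) ^ (r - σ)) ^ 2 := by
    rw [← Real.rpow_natCast, ← Real.rpow_mul hj.le]; congr 1; push_cast; ring
  have e2 : (j : ℝ) ^ (2 * σ) = ((j : ℝ) ^ σ) ^ 2 := by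
    rw [← Real.rpow_natCast, ← Real.rpow_mul hj.le]; congr 1; push_cast; ring
  have e3 : (j : ℝ) ^ r = (j : ℝ) ^ (r - σ) * (j : ℝ) ^ σ := by
    rw [← Real.rpow_add hj]; congr 1; ring
  rw [e1, e2, e3, ← sq_abs (c j), ← mul_pow, mul_assoc]
  have h3 : 0 ≤ (j : ℝ) ^ (r - σ) := by positivity
  have h4 : 0 ≤ (j : ℝ) ^ σ * |c j| := by positivity
  nlinarith [sq_nonneg ((j : ℝ) ^ (r - σ) - (j : ℝ) ^ σ * |c j|), mul_nonneg h3 h4]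

theorem summable_rpow_mul_sq_of_le {c : ℕ+ → ℝ} {r σ : ℝ}
    (h : Summable fun j : ℕ+ => (j : ℝ) ^ (2 * σ) * c j ^ 2) (hr : r ≤ σ) :
    Summable fun j : ℕ+ => (j : ℝ) ^ (2 * r) * c j ^ 2 :=
  Summable.of_nonneg_of_le (fun j => by positivity) (fun j => mul_le_mul_of_nonneg_right
    (Real.rpow_le_rpow_of_exponent_le (one_le_cast j) (by linarith)) (sq_nonneg _)) h

theorem summable_abs_of_rpow {c : ℕ+ → ℝ} {σ : ℝ}
    (h : Summable fun j : ℕ+ => (j : ℝ) ^ (2 * σ) * c j ^ 2) (hσ : 1 / 2 < σ) :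
    Summable fun j : ℕ+ => |c j| := by
  simpa using summable_rpow_mul_abs (r := 0) h (by linarith)

theorem summable_sq_mul_abs_of_rpow {c : ℕ+ → ℝ} {s : ℝ}
    (h : Summable fun j : ℕ+ => (j : ℝ) ^ (2 * (s + 2)) * c j ^ 2) (hs : 1 / 2 < s) :
    Summable fun j : ℕ+ => (j : ℝ) ^ 2 * |c j| := by
  have := summable_rpow_mul_abs (r := 2) h (by linarith)
  refine this.congr fun j => ?_
  rw [← Real.rpow_natCast]; simp

theorem coeff_congr {u w : ℝ → ℝ} (h : ∀ x ∈ Icc 0 Real.pi, u x = w x) (j : ℕ+) :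
    coeff u j = coeff w j := by
  refine intervalIntegral.integral_congr fun x hx => ?_
  rw [uIcc_of_le Real.pi_pos.le] at hx
  simp only [h x hx]

theorem intervalIntegrable_mul_phi {u : ℝ → ℝ} (hu : ContinuousOn u (Icc 0 Real.pi)) (j : ℕ+) :
    IntervalIntegrable (fun x => u x * phi j x) MeasureTheory.volume 0 Real.pi :=
  ContinuousOn.intervalIntegrable (by
    rw [uIcc_of_le Real.pi_pos.le]; exact hu.mul (continuous_phi j).continuousOn)

theorem coeff_sub {u w : ℝ → ℝ} (hu : ContinuousOn u (Icc 0 Real.pi))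
    (hw : ContinuousOn w (Icc 0 Real.pi)) (j : ℕ+) :
    coeff (fun x => u x - w x) j = coeff u j - coeff w j := by
  simp only [coeff, sub_mul]
  exact intervalIntegral.integral_sub (intervalIntegrable_mul_phi hu j)
    (intervalIntegrable_mul_phi hw j)

theorem coeff_const_mul (r : ℝ) (u : ℝ → ℝ) (j : ℕ+) :
    coeff (fun x => r * u x) j = r * coeff u j := by
  simp only [coeff, mul_assoc]
  exact intervalIntegral.integral_const_mul _ _

theorem abs_coeff_le {u : ℝ → ℝ} {B : ℝ} (hu : ∀ x ∈ Icc 0 Real.pi, |u x| ≤ B) (j : ℕ+) :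
    |coeff u j| ≤ B * Real.pi := by
  have := intervalIntegral.norm_integral_le_of_norm_le_const (a := 0) (b := Real.pi) (C := B)
    (f := fun x => u x * phi j x) fun x hx => by
      rw [uIoc_of_le Real.pi_pos.le] at hx
      rw [norm_mul]
      have h1 := hu x (Ioc_subset_Icc_self hx)
      exact (mul_le_of_le_one_right (norm_nonneg _) (abs_phi_le j x)).trans h1
  rwa [sub_zero, abs_of_pos Real.pi_pos] at this

theorem MemH.summable_abs {s : ℝ} {u : ℝ → ℝ} (h : MemH s u) (hs : 1 / 2 < s) :
    Summable fun j => |coeff u j| := summable_abs_of_rpow h.1 hs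

theorem MemH.eq_series {s : ℝ} {u : ℝ → ℝ} (h : MemH s u) :
    ∀ x ∈ Icc 0 Real.pi, u x = series (coeff u) x := fun x hx => (h.2 x hx).tsum_eq.symm

theorem MemH.continuousOn {s : ℝ} {u : ℝ → ℝ} (h : MemH s u) (hs : 1 / 2 < s) :
    ContinuousOn u (Icc 0 Real.pi) :=
  (continuous_series (h.summable_abs hs)).continuousOn.congr h.eq_series

theorem memH_series {s : ℝ} {c : ℕ+ → ℝ}
    (h : Summable fun j : ℕ+ => (j : ℝ) ^ (2 * s) * c j ^ 2) (hs : 1 / 2 < s) :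
    MemH s (series c) := by
  have hc := summable_abs_of_rpow h hs
  refine ⟨h.congr fun j => by rw [coeff_series hc], fun x _ => ?_⟩
  have := hasSum_series hc x
  exact this.congr_fun fun j => by rw [coeff_series hc]

theorem summable_sub_sq {σ : ℝ} {c d : ℕ+ → ℝ}
    (hc : Summable fun j : ℕ+ => (j : ℝ) ^ (2 * σ) * c j ^ 2)
    (hd : Summable fun j : ℕ+ => (j : ℝ) ^ (2 * σ) * d j ^ 2) :
    Summable fun j : ℕ+ => (j : ℝ) ^ (2 * σ) * (c j - d j) ^ 2 := by
  refine Summable.of_nonneg_of_le (fun j => by positivity) (fun j => ?_)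
    ((hc.add hd).mul_left 2)
  have : 0 ≤ (j : ℝ) ^ (2 * σ) := by positivity
  nlinarith [mul_nonneg this (sq_nonneg (c j + d j))]

section Derivatives

variable {u : ℝ → ℝ} {c : ℕ+ → ℝ}

theorem deriv_eq_of_eq_series (hu : ∀ x ∈ Icc 0 Real.pi, u x = series c x) {x : ℝ}
    (hx : x ∈ Ioo 0 Real.pi) : deriv u x = deriv (series c) x :=
  Filter.EventuallyEq.deriv_eq (by
    filter_upwards [Ioo_mem_nhds hx.1 hx.2] with y hy using hu y (Ioo_subset_Icc_self hy))

theorem deriv_deriv_eq_of_eq_series (hc : Summable fun j : ℕ+ => (j : ℝ) ^ 2 * |c j|)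
    (hu : ∀ x ∈ Icc 0 Real.pi, u x = series c x) {x : ℝ}
    (hx : x ∈ Ioo 0 Real.pi) : deriv (deriv u) x = series (fun j => -(j : ℝ) ^ 2 * c j) x := by
  rw [← (hasDerivAt_deriv_series hc x).deriv]
  refine Filter.EventuallyEq.deriv_eq ?_
  filter_upwards [Ioo_mem_nhds hx.1 hx.2] with y hy using deriv_eq_of_eq_series hu hy

/-- Only the open interval is usable: at `0` and `π` the value of `deriv u` depends on `u` outside
`[0, π]`, where it is arbitrary. -/
theorem integral_congr_Ioo {f g : ℝ → ℝ} (h : ∀ x ∈ Ioo 0 Real.pi, f x = g x) :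
    ∫ x in (0 : ℝ)..Real.pi, f x = ∫ x in (0 : ℝ)..Real.pi, g x := by
  rw [intervalIntegral.integral_of_le Real.pi_pos.le, intervalIntegral.integral_of_le Real.pi_pos.le,
    MeasureTheory.integral_Ioc_eq_integral_Ioo, MeasureTheory.integral_Ioc_eq_integral_Ioo]
  exact MeasureTheory.setIntegral_congr_fun measurableSet_Ioo h

theorem continuous_deriv_series (hc : Summable fun j : ℕ+ => (j : ℝ) ^ 2 * |c j|) :
    Continuous (deriv (series c)) :=
  continuous_iff_continuousAt.2 fun x => (hasDerivAt_deriv_series hc x).continuousAt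

theorem hasDerivAt_series_deriv (hc : Summable fun j : ℕ+ => (j : ℝ) ^ 2 * |c j|) (x : ℝ) :
    HasDerivAt (series c) (deriv (series c) x) x :=
  (hasDerivAt_series (summable_cast_mul hc) x).differentiableAt.hasDerivAt

/-- Parseval's identity for the derivative. -/
theorem hasSum_integral_deriv_sq (hc : Summable fun j : ℕ+ => (j : ℝ) ^ 2 * |c j|)
    (hu : ∀ x ∈ Icc 0 Real.pi, u x = series c x) :
    HasSum (fun j : ℕ+ => (j : ℝ) ^ 2 * c j ^ 2) (∫ x in (0 : ℝ)..Real.pi, deriv u x ^ 2) := by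
  set d : ℕ+ → ℝ := fun j => -(j : ℝ) ^ 2 * c j with hd
  have hc0 := summable_of_cast_mul (summable_cast_mul hc)
  have hds := summable_abs_sq_mul hc
  have h1 : ∫ x in (0 : ℝ)..Real.pi, deriv u x ^ 2 =
      ∫ x in (0 : ℝ)..Real.pi, deriv (series c) x * deriv (series c) x :=
    integral_congr_Ioo fun x hx => by rw [deriv_eq_of_eq_series hu hx, sq]
  -- One integration by parts moves both derivatives to one factor; the boundary terms vanish
  -- because a sine series vanishes at `0` and `π`. Orthogonality of the `φ_j` then suffices, with
  -- no cosine series.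
  have h2 := intervalIntegral.integral_mul_deriv_eq_deriv_mul (a := 0) (b := Real.pi)
    (u := series c) (v := deriv (series c)) (u' := deriv (series c)) (v' := series d)
    (fun x _ => hasDerivAt_series_deriv hc x) (fun x _ => hasDerivAt_deriv_series hc x)
    ((continuous_deriv_series hc).intervalIntegrable _ _)
    ((continuous_series hds).intervalIntegrable _ _)
  rw [series_zero, series_pi, zero_mul, zero_mul, sub_zero, zero_sub] at h2
  rw [h1, ← neg_neg (∫ x in (0 : ℝ)..Real.pi, deriv (series c) x * deriv (series c) x), ← h2]
  refine (hasSum_integral_series_mul hc0 (continuous_series hds).continuousOn).neg.congr_fun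
    fun j => ?_
  have : ∫ x in (0 : ℝ)..Real.pi, phi j x * series d x = d j := by
    refine Eq.trans ?_ (coeff_series hds j)
    exact intervalIntegral.integral_congr fun x _ => mul_comm _ _
  rw [this]
  simp only [hd]
  ring

end Derivatives

section TestFunctions

variable {η : ℝ → ℝ}

theorem IsTest.eq_zero (h : IsTest η) {x : ℝ} (hx : x ∉ Ioo 0 Real.pi) : η x = 0 :=
  image_eq_zero_of_notMem_tsupport fun hx' => hx (h.2.2 hx')

theorem IsTest.hasDerivAt (h : IsTest η) (x : ℝ) : HasDerivAt η (deriv η x) x :=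
  (h.1.differentiable (by simp) x).hasDerivAt

theorem IsTest.contDiff_deriv (h : IsTest η) : ContDiff ℝ ∞ (deriv η) :=
  (contDiff_infty_iff_deriv.1 h.1).2

theorem IsTest.hasDerivAt_deriv (h : IsTest η) (x : ℝ) :
    HasDerivAt (deriv η) (deriv (deriv η) x) x :=
  (h.contDiff_deriv.differentiable (by simp) x).hasDerivAt

theorem IsTest.continuous_deriv (h : IsTest η) : Continuous (deriv η) := h.contDiff_deriv.continuous

theorem IsTest.continuous_deriv_deriv (h : IsTest η) : Continuous (deriv (deriv η)) :=
  (contDiff_infty_iff_deriv.1 h.contDiff_deriv).2.continuous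

/-- The weak form after one integration by parts. -/
theorem weakForm_eq {m : ℝ} {u : ℝ → ℝ} {c : ℕ+ → ℝ}
    (hc : Summable fun j : ℕ+ => (j : ℝ) ^ 2 * |c j|)
    (hu : ∀ x ∈ Icc 0 Real.pi, u x = series c x) (h : IsTest η) :
    weakForm m u η =
      (∫ x in (0 : ℝ)..Real.pi, series (fun j => -(j : ℝ) ^ 2 * c j) x * deriv (deriv η) x) -
      (m + 1 / (2 * Real.pi) * ∑' j : ℕ+, (j : ℝ) ^ 2 * c j ^ 2) *
        ∫ x in (0 : ℝ)..Real.pi, series (fun j => -(j : ℝ) ^ 2 * c j) x * η x := by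
  set d : ℕ+ → ℝ := fun j => -(j : ℝ) ^ 2 * c j with hd
  have hds := summable_abs_sq_mul hc
  rw [weakForm, ← (hasSum_integral_deriv_sq hc hu).tsum_eq]
  set A := m + 1 / (2 * Real.pi) * ∑' j : ℕ+, (j : ℝ) ^ 2 * c j ^ 2
  have h1 : ∫ x in (0 : ℝ)..Real.pi, (deriv (deriv u) x * deriv (deriv η) x +
      A * deriv u x * deriv η x) = ∫ x in (0 : ℝ)..Real.pi, (series d x * deriv (deriv η) x +
      A * (deriv (series c) x * deriv η x)) :=
    integral_congr_Ioo fun x hx => by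
      rw [deriv_eq_of_eq_series hu hx, deriv_deriv_eq_of_eq_series hc hu hx, mul_assoc]
  have i1 : IntervalIntegrable (fun x => series d x * deriv (deriv η) x)
      MeasureTheory.volume 0 Real.pi :=
    ((continuous_series hds).mul h.continuous_deriv_deriv).intervalIntegrable _ _
  have i2 : IntervalIntegrable (fun x => A * (deriv (series c) x * deriv η x))
      MeasureTheory.volume 0 Real.pi :=
    (continuous_const.mul ((continuous_deriv_series hc).mul
      h.continuous_deriv)).intervalIntegrable _ _
  rw [h1, intervalIntegral.integral_add i1 i2, intervalIntegral.integral_const_mul,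
    intervalIntegral.integral_mul_deriv_eq_deriv_mul (u := deriv (series c)) (v := η)
      (u' := series d) (fun x _ => hasDerivAt_deriv_series hc x) (fun x _ => h.hasDerivAt x)
      ((continuous_series hds).intervalIntegrable _ _) (h.continuous_deriv.intervalIntegrable _ _),
    h.eq_zero (by simp), h.eq_zero (by simp)]
  ring

theorem integral_phi_mul_deriv_deriv (h : IsTest η) (j : ℕ+) :
    ∫ x in (0 : ℝ)..Real.pi, phi j x * deriv (deriv η) x = -(j : ℝ) ^ 2 * coeff η j := by
  have hpsi : Continuous (psi j) := continuous_iff_continuousAt.2 fun x =>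
    (hasDerivAt_psi j x).continuousAt
  rw [intervalIntegral.integral_mul_deriv_eq_deriv_mul (u := phi j) (v := deriv η)
      (u' := fun x => j * psi j x) (fun x _ => hasDerivAt_phi j x) (fun x _ => h.hasDerivAt_deriv x)
      ((continuous_const.mul hpsi).intervalIntegrable _ _)
      (h.continuous_deriv_deriv.intervalIntegrable _ _),
    intervalIntegral.integral_mul_deriv_eq_deriv_mul (u := fun x => j * psi j x) (v := η)
      (u' := fun x => j * -(j * phi j x)) (fun x _ => (hasDerivAt_psi j x).const_mul _)
      (fun x _ => h.hasDerivAt x)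
      ((continuous_const.mul (continuous_const.mul (continuous_phi j)).neg).intervalIntegrable _ _)
      (h.continuous_deriv.intervalIntegrable _ _), phi_zero, phi_pi, h.eq_zero (by simp),
      h.eq_zero (by simp), coeff, ← intervalIntegral.integral_const_mul]
  simp only [zero_mul, mul_zero, sub_zero, zero_sub, neg_neg]
  refine intervalIntegral.integral_congr fun x _ => ?_
  ring

end TestFunctions

end Beam

/-! ### Approximation of the eigenfunctions by test functions -/

namespace Beam

section Cutoff

theorem smoothTransition_deriv_eq_zero {f : ℝ → ℝ} {x : ℝ} (c : ℝ) (h : ∀ᶠ y in 𝓝 x, f y = c) :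
    deriv f x = 0 := by
  have : f =ᶠ[𝓝 x] fun _ => c := h
  rw [this.deriv_eq, deriv_const]

theorem exists_smoothTransition_bound : ∃ B, 0 ≤ B ∧ ∀ x,
    |deriv Real.smoothTransition x| ≤ B ∧ |deriv (deriv Real.smoothTransition) x| ≤ B := by
  have hS : ContDiff ℝ ∞ Real.smoothTransition := Real.smoothTransition.contDiff
  have hS1 : ContDiff ℝ ∞ (deriv Real.smoothTransition) := (contDiff_infty_iff_deriv.1 hS).2
  have hS2 : ContDiff ℝ ∞ (deriv (deriv Real.smoothTransition)) :=
    (contDiff_infty_iff_deriv.1 hS1).2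
  obtain ⟨B1, h1⟩ := (isCompact_Icc (a := (0 : ℝ)) (b := 1)).exists_bound_of_continuousOn
    hS1.continuous.continuousOn
  obtain ⟨B2, h2⟩ := (isCompact_Icc (a := (0 : ℝ)) (b := 1)).exists_bound_of_continuousOn
    hS2.continuous.continuousOn
  refine ⟨max (max B1 B2) 0, le_max_right _ _, fun x => ?_⟩
  by_cases hx : x ∈ Icc (0 : ℝ) 1
  · exact ⟨(h1 x hx).trans ((le_max_left _ _).trans (le_max_left _ _)),
      (h2 x hx).trans ((le_max_right _ _).trans (le_max_left _ _))⟩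
  · have hev : ∃ c, ∀ᶠ y in 𝓝 x, Real.smoothTransition y = c := by
      rcases lt_or_ge x 0 with h | h
      · exact ⟨0, by filter_upwards [Iio_mem_nhds h] with y hy using
          Real.smoothTransition.zero_of_nonpos (le_of_lt hy)⟩
      · have : 1 < x := by by_contra! h'; exact hx ⟨h, h'⟩
        exact ⟨1, by filter_upwards [Ioi_mem_nhds this] with y hy using
          Real.smoothTransition.one_of_one_le (le_of_lt hy)⟩
    obtain ⟨c, hc⟩ := hev
    have e1 : ∀ᶠ y in 𝓝 x, deriv Real.smoothTransition y = 0 := by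
      filter_upwards [hc.eventually_nhds] with y hy using smoothTransition_deriv_eq_zero c hy
    rw [e1.self_of_nhds, smoothTransition_deriv_eq_zero 0 e1, abs_zero]
    exact ⟨le_max_right _ _, le_max_right _ _⟩

/-- A cut-off of `phi k` away from the end points. -/
noncomputable def cutoffPhi (k : ℕ+) (n : ℝ) (x : ℝ) : ℝ :=
  Real.smoothTransition (n * (x * (Real.pi - x)) - 1) * phi k x

variable {k : ℕ+} {n x : ℝ}

theorem contDiff_phi (k : ℕ+) : ContDiff ℝ ∞ (phi k) := by
  unfold phi
  exact contDiff_const.mul (Real.contDiff_sin.comp (contDiff_const.mul contDiff_id))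

theorem isTest_cutoffPhi (k : ℕ+) (hn : 0 < n) : IsTest (cutoffPhi k n) := by
  have hcont : Continuous fun x : ℝ => n * (x * (Real.pi - x)) := by fun_prop
  have hsub : tsupport (cutoffPhi k n) ⊆ {x | 1 ≤ n * (x * (Real.pi - x))} := by
    refine closure_minimal (fun x hx => ?_) (isClosed_le continuous_const hcont)
    by_contra h
    simp only [mem_ofPred_eq, not_le] at h
    exact hx (by simp [cutoffPhi, Real.smoothTransition.zero_of_nonpos (sub_nonpos.2 h.le)])
  have hsub' : tsupport (cutoffPhi k n) ⊆ Ioo 0 Real.pi := by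
    refine hsub.trans fun x hx => ?_
    simp only [mem_ofPred_eq] at hx
    have h1 : 0 < x * (Real.pi - x) := by
      by_contra! h
      nlinarith
    have hpi := Real.pi_pos
    constructor
    · by_contra! h; nlinarith
    · by_contra! h; nlinarith
  refine ⟨?_, ?_, hsub'⟩
  · exact (Real.smoothTransition.contDiff.comp (by fun_prop)).mul (contDiff_phi k)
  · exact isCompact_Icc.of_isClosed_subset (isClosed_tsupport _)
      (hsub'.trans Ioo_subset_Icc_self)

/-- The Lipschitz bound gives `|φ_k| ≤ k` times the distance to the nearer end point, while the
distance to the other one is at least `π/2 > 1`. -/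
theorem abs_phi_le_mul (hx : x ∈ Icc 0 Real.pi) : |phi k x| ≤ k * (x * (Real.pi - x)) := by
  have hlip : ∀ y z : ℝ, |phi k z - phi k y| ≤ k * |z - y| := fun y z => by
    have := Convex.norm_image_sub_le_of_norm_hasDerivWithin_le (s := univ) (f := phi k)
      (C := k) (x := y) (y := z) (fun w _ => (hasDerivAt_phi k w).hasDerivWithinAt) (fun w _ => by
        rw [norm_mul, Real.norm_eq_abs, Real.norm_eq_abs, Nat.abs_cast]
        exact mul_le_of_le_one_right (by positivity) (abs_psi_le k w)) convex_univ trivial trivial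
    simpa using this
  have h1 := hlip 0 x
  have h2 := hlip Real.pi x
  rw [phi_zero, sub_zero, sub_zero, abs_of_nonneg hx.1] at h1
  rw [phi_pi, sub_zero, abs_sub_comm x, abs_of_nonneg (sub_nonneg.2 hx.2)] at h2
  have hpi := Real.pi_gt_three
  have hk := cast_pnat_pos k
  have := hx.1
  have := hx.2
  rcases le_total x (Real.pi / 2) with h | h
  · exact h1.trans (mul_le_mul_of_nonneg_left (by nlinarith) hk.le)
  · exact h2.trans (mul_le_mul_of_nonneg_left (by nlinarith) hk.le)

theorem deriv_deriv_cutoffPhi (k : ℕ+) (n x : ℝ) :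
    deriv (deriv (cutoffPhi k n)) x =
      deriv (deriv Real.smoothTransition) (n * (x * (Real.pi - x)) - 1) *
          (n * (Real.pi - 2 * x)) ^ 2 * phi k x
        - deriv Real.smoothTransition (n * (x * (Real.pi - x)) - 1) * (2 * n) * phi k x
        + 2 * (deriv Real.smoothTransition (n * (x * (Real.pi - x)) - 1) *
          (n * (Real.pi - 2 * x)) * (k * psi k x))
        - Real.smoothTransition (n * (x * (Real.pi - x)) - 1) * (k ^ 2 * phi k x) := by
  have hS : ContDiff ℝ ∞ Real.smoothTransition := Real.smoothTransition.contDiff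
  have hS1 : ContDiff ℝ ∞ (deriv Real.smoothTransition) := (contDiff_infty_iff_deriv.1 hS).2
  have hg : ∀ x : ℝ, HasDerivAt (fun x : ℝ => n * (x * (Real.pi - x)) - 1)
      (n * (Real.pi - 2 * x)) x := fun x => by
    have := (((hasDerivAt_id x).mul ((hasDerivAt_id x).const_sub Real.pi)).const_mul n).sub_const 1
    refine this.congr_deriv ?_
    simp only [id_eq]; ring
  have hg' : ∀ x : ℝ, HasDerivAt (fun x : ℝ => n * (Real.pi - 2 * x)) (-(2 * n)) x := fun x => by
    have := (((hasDerivAt_id x).const_mul 2).const_sub Real.pi).const_mul n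
    refine this.congr_deriv ?_
    ring
  have d0 : ∀ x, HasDerivAt (fun x => Real.smoothTransition (n * (x * (Real.pi - x)) - 1))
      (deriv Real.smoothTransition (n * (x * (Real.pi - x)) - 1) * (n * (Real.pi - 2 * x))) x :=
    fun x => HasDerivAt.comp x (hS.differentiable (by simp) _).hasDerivAt (hg x)
  have d1 : ∀ x, HasDerivAt (fun x => deriv Real.smoothTransition (n * (x * (Real.pi - x)) - 1))
      (deriv (deriv Real.smoothTransition) (n * (x * (Real.pi - x)) - 1) *
        (n * (Real.pi - 2 * x))) x :=
    fun x => HasDerivAt.comp x (hS1.differentiable (by simp) _).hasDerivAt (hg x)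
  have e1 : deriv (cutoffPhi k n) = fun x =>
      deriv Real.smoothTransition (n * (x * (Real.pi - x)) - 1) * (n * (Real.pi - 2 * x)) * phi k x
        + Real.smoothTransition (n * (x * (Real.pi - x)) - 1) * (k * psi k x) :=
    funext fun x => ((d0 x).mul (hasDerivAt_phi k x)).deriv
  rw [e1]
  refine HasDerivAt.deriv ?_
  refine ((((d1 x).mul (hg' x)).mul (hasDerivAt_phi k x)).add
    ((d0 x).mul ((hasDerivAt_psi k x).const_mul (k : ℝ)))).congr_deriv ?_
  simp only [Pi.mul_apply]
  ring

theorem cutoffPhi_eq (h : 2 < n * (x * (Real.pi - x))) : cutoffPhi k n x = phi k x := by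
  rw [cutoffPhi, Real.smoothTransition.one_of_one_le (by linarith), one_mul]

theorem deriv_deriv_cutoffPhi_eq (h : 2 < n * (x * (Real.pi - x))) :
    deriv (deriv (cutoffPhi k n)) x = -(k : ℝ) ^ 2 * phi k x := by
  have hopen : IsOpen {y : ℝ | 2 < n * (y * (Real.pi - y))} :=
    isOpen_lt continuous_const (by fun_prop)
  have h0 : ∀ y ∈ {y : ℝ | 2 < n * (y * (Real.pi - y))}, cutoffPhi k n =ᶠ[𝓝 y] phi k :=
    fun y hy => by filter_upwards [hopen.mem_nhds hy] with z hz using cutoffPhi_eq hz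
  have h1 : deriv (cutoffPhi k n) =ᶠ[𝓝 x] fun y => k * psi k y := by
    filter_upwards [hopen.mem_nhds h] with y hy
    rw [(h0 y hy).deriv_eq, (hasDerivAt_phi k y).deriv]
  rw [h1.deriv_eq, ((hasDerivAt_psi k x).const_mul (k : ℝ)).deriv]
  ring

theorem abs_cutoffPhi_sub_le (k : ℕ+) (n x : ℝ) : |cutoffPhi k n x - phi k x| ≤ 1 := by
  have h0 := Real.smoothTransition.nonneg (n * (x * (Real.pi - x)) - 1)
  have h1 := Real.smoothTransition.le_one (n * (x * (Real.pi - x)) - 1)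
  rw [cutoffPhi, ← sub_one_mul, abs_mul]
  exact mul_le_one₀ (abs_le.2 ⟨by linarith, by linarith⟩) (abs_nonneg _) (abs_phi_le k x)

/-- The second derivative of the cut-off is of order `n²`, but it multiplies `φ_k`, which is of
order `1/n` in the layer; the other terms are at most of order `n`. One power of `n` is thus gained.
-/
theorem exists_abs_deriv_deriv_cutoffPhi_le (k : ℕ+) : ∃ C, 0 ≤ C ∧ ∀ n : ℝ, 1 ≤ n →
    ∀ x ∈ Icc 0 Real.pi, n * (x * (Real.pi - x)) ≤ 2 →
      |deriv (deriv (cutoffPhi k n)) x + (k : ℝ) ^ 2 * phi k x| ≤ C * n := by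
  obtain ⟨B, hB, hS⟩ := exists_smoothTransition_bound
  have hk := cast_pnat_pos k
  have hpi := Real.pi_pos
  refine ⟨2 * B * Real.pi ^ 2 * k + 2 * B + 2 * B * Real.pi * k + k ^ 2, by positivity,
    fun n hn x hx hw => ?_⟩
  rw [deriv_deriv_cutoffPhi]
  set y := n * (x * (Real.pi - x)) - 1
  have hn0 : 0 < n := by linarith
  have hphi : n * |phi k x| ≤ 2 * k := by
    have := mul_le_mul_of_nonneg_left (abs_phi_le_mul (k := k) hx) hn0.le
    nlinarith
  have hg : |Real.pi - 2 * x| ≤ Real.pi := abs_le.2 ⟨by linarith [hx.2], by linarith [hx.1]⟩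
  have b1 : |deriv (deriv Real.smoothTransition) y * (n * (Real.pi - 2 * x)) ^ 2 * phi k x| ≤
      B * Real.pi ^ 2 * n * (2 * k) := by
    have : |deriv (deriv Real.smoothTransition) y * (n * (Real.pi - 2 * x)) ^ 2 * phi k x| =
        |deriv (deriv Real.smoothTransition) y| * |Real.pi - 2 * x| ^ 2 * n * (n * |phi k x|) := by
      rw [abs_mul, abs_mul, abs_pow, abs_mul, abs_of_pos hn0]; ring
    rw [this]
    gcongr
    exact (hS y).2
  have b2 : |deriv Real.smoothTransition y * (2 * n) * phi k x| ≤ B * (2 * n) * 1 := by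
    rw [abs_mul, abs_mul, abs_of_pos (show 0 < 2 * n by linarith)]
    gcongr
    exacts [(hS y).1, abs_phi_le k x]
  have b3 : |deriv Real.smoothTransition y * (n * (Real.pi - 2 * x)) * (k * psi k x)| ≤
      B * (n * Real.pi) * (k * 1) := by
    rw [abs_mul, abs_mul, abs_mul, abs_of_pos hn0, abs_mul, Nat.abs_cast]
    gcongr
    exacts [(hS y).1, abs_psi_le k x]
  have b4 : |(1 - Real.smoothTransition y) * (k ^ 2 * phi k x)| ≤ 1 * ((k : ℝ) ^ 2 * 1) := by
    rw [abs_mul, abs_mul, abs_pow, Nat.abs_cast]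
    have h0 := Real.smoothTransition.nonneg y
    have h1 := Real.smoothTransition.le_one y
    gcongr
    exacts [abs_le.2 ⟨by linarith, by linarith⟩, abs_phi_le k x]
  have b5 : (k : ℝ) ^ 2 ≤ k ^ 2 * n := le_mul_of_one_le_right (by positivity) hn
  rw [abs_le] at b1 b2 b3 b4 ⊢
  constructor <;> nlinarith [b1.1, b1.2, b2.1, b2.2, b3.1, b3.2, b4.1, b4.2]

/-- The integral of a function supported in two boundary layers. -/
theorem abs_integral_le_of_boundary_layer {h : ℝ → ℝ} {K : ℝ} (hh : Continuous h) (hn : 2 ≤ n)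
    (h0 : ∀ x ∈ Icc 0 Real.pi, 2 < n * (x * (Real.pi - x)) → h x = 0)
    (hK : ∀ x ∈ Icc 0 Real.pi, n * (x * (Real.pi - x)) ≤ 2 → |h x| ≤ K) :
    |∫ x in (0 : ℝ)..Real.pi, h x| ≤ 4 * K / n := by
  have hpi := Real.pi_gt_three
  have hn0 : 0 < n := by linarith
  have hK0 : 0 ≤ K := (abs_nonneg _).trans (hK 0 ⟨le_rfl, by linarith⟩ (by simp))
  have hb : ∀ x ∈ Icc 0 Real.pi, |h x| ≤ K := fun x hx => by
    rcases le_or_gt (n * (x * (Real.pi - x))) 2 with h' | h'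
    · exact hK x hx h'
    · rw [h0 x hx h', abs_zero]; exact hK0
  -- For `δ < x < π - δ` one has `x(π - x) > δ(π - δ) ≥ δ`, so `n x(π - x) > 2` and the integrand
  -- vanishes there. Two layers of width `δ` remain.
  set δ := 2 / n with hδ
  have hδ0 : 0 < δ := by positivity
  have hδ1 : δ ≤ 1 := by rw [hδ, div_le_one hn0]; exact hn
  have hnδ : n * δ = 2 := by rw [hδ]; field_simp
  have i := fun a b : ℝ => hh.intervalIntegrable (μ := MeasureTheory.volume) a b
  rw [← intervalIntegral.integral_add_adjacent_intervals (i 0 δ) (i δ Real.pi),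
    ← intervalIntegral.integral_add_adjacent_intervals (i δ (Real.pi - δ)) (i (Real.pi - δ) Real.pi)]
  have e2 : ∫ x in δ..(Real.pi - δ), h x = 0 := by
    rw [intervalIntegral.integral_of_le (by linarith), MeasureTheory.integral_Ioc_eq_integral_Ioo]
    refine MeasureTheory.setIntegral_eq_zero_of_forall_eq_zero fun x hx => ?_
    refine h0 x ⟨by linarith [hx.1], by linarith [hx.2]⟩ ?_
    rw [← hnδ]
    refine mul_lt_mul_of_pos_left ?_ hn0
    nlinarith [mul_pos (sub_pos.2 hx.1) (sub_pos.2 hx.2)]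
  have e1 : |∫ x in (0 : ℝ)..δ, h x| ≤ K * δ := by
    have := intervalIntegral.norm_integral_le_of_norm_le_const (a := 0) (b := δ) (C := K) (f := h)
      fun x hx => by
        rw [uIoc_of_le hδ0.le] at hx
        exact hb x ⟨hx.1.le, by linarith [hx.2]⟩
    rwa [sub_zero, abs_of_pos hδ0] at this
  have e3 : |∫ x in (Real.pi - δ)..Real.pi, h x| ≤ K * δ := by
    have := intervalIntegral.norm_integral_le_of_norm_le_const (a := Real.pi - δ) (b := Real.pi)
      (C := K) (f := h) fun x hx => by
        rw [uIoc_of_le (by linarith)] at hx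
        exact hb x ⟨by linarith [hx.1], hx.2⟩
    rwa [sub_sub_cancel, abs_of_pos hδ0] at this
  rw [e2, zero_add]
  refine (abs_add_le _ _).trans ((add_le_add e1 e3).trans (le_of_eq ?_))
  rw [hδ]; ring

/-- An error of order `n` on layers of width of order `1/n` contributes a bounded multiple of the
size of `G` there, uniformly in `n`. Smallness has to come from `G`. -/
theorem exists_integral_cutoffPhi_sub_le (k : ℕ+) : ∃ C, 0 ≤ C ∧ ∀ (G : ℝ → ℝ) (n M : ℝ),
    Continuous G → 2 ≤ n → (∀ x ∈ Icc 0 Real.pi, n * (x * (Real.pi - x)) ≤ 2 → |G x| ≤ M) →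
    |(∫ x in (0 : ℝ)..Real.pi, G x * cutoffPhi k n x) - coeff G k| ≤ C * M ∧
    |(∫ x in (0 : ℝ)..Real.pi, G x * deriv (deriv (cutoffPhi k n)) x) + k ^ 2 * coeff G k| ≤
      C * M := by
  obtain ⟨C, hC, hC'⟩ := exists_abs_deriv_deriv_cutoffPhi_le k
  refine ⟨max 4 (4 * C), by positivity, fun G n M hG hn hM => ?_⟩
  have hn0 : 0 < n := by linarith
  have ht := isTest_cutoffPhi k hn0
  have hc1 : Continuous (cutoffPhi k n) := ht.1.continuous
  have hc2 := ht.continuous_deriv_deriv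
  have hM0 : 0 ≤ M := (abs_nonneg _).trans (hM 0 ⟨le_rfl, Real.pi_pos.le⟩ (by simp))
  constructor
  · rw [coeff, ← intervalIntegral.integral_sub (Continuous.intervalIntegrable (by fun_prop) _ _)
      (Continuous.intervalIntegrable (by fun_prop) _ _)]
    refine (abs_integral_le_of_boundary_layer (n := n) (K := M) (by fun_prop) hn
      (fun x _ h => by rw [cutoffPhi_eq h, sub_self]) (fun x hx h => ?_)).trans ?_
    · rw [← mul_sub, abs_mul, ← mul_one M]
      exact mul_le_mul (hM x hx h) (abs_cutoffPhi_sub_le k n x) (abs_nonneg _) hM0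
    · refine (div_le_self (by positivity) (by linarith)).trans ?_
      exact mul_le_mul_of_nonneg_right (le_max_left _ _) hM0
  · rw [coeff, ← intervalIntegral.integral_const_mul,
      ← intervalIntegral.integral_add (Continuous.intervalIntegrable (by fun_prop) _ _)
      (Continuous.intervalIntegrable (by fun_prop) _ _)]
    refine (abs_integral_le_of_boundary_layer (n := n) (K := M * (C * n)) (by fun_prop) hn
      (fun x _ h => by rw [deriv_deriv_cutoffPhi_eq h]; ring) (fun x hx h => ?_)).trans ?_
    · have : G x * deriv (deriv (cutoffPhi k n)) x + k ^ 2 * (G x * phi k x) =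
        G x * (deriv (deriv (cutoffPhi k n)) x + k ^ 2 * phi k x) := by ring
      rw [this, abs_mul]
      exact mul_le_mul (hM x hx h) (hC' n (by linarith) x hx h) (abs_nonneg _) hM0
    · have : 4 * (M * (C * n)) / n = 4 * C * M := by field_simp
      rw [this]
      exact mul_le_mul_of_nonneg_right (le_max_right _ _) hM0

/-- A continuous function vanishing at the end points is small in thin boundary layers. -/
theorem exists_forall_boundary_layer_le {G : ℝ → ℝ} (hG : Continuous G) (h0 : G 0 = 0)
    (hpi : G Real.pi = 0) {δ : ℝ} (hδ : 0 < δ) : ∃ n₀ : ℝ, ∀ n ≥ n₀, ∀ x ∈ Icc 0 Real.pi,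
      n * (x * (Real.pi - x)) ≤ 2 → |G x| ≤ δ := by
  obtain ⟨r0, hr0, h0'⟩ := Metric.continuousAt_iff.1 (hG.continuousAt (x := 0)) δ hδ
  obtain ⟨r1, hr1, h1'⟩ := Metric.continuousAt_iff.1 (hG.continuousAt (x := Real.pi)) δ hδ
  set r := min r0 r1
  have hr : 0 < r := lt_min hr0 hr1
  -- If both end points are at distance at least `r`, then `x(π - x) ≥ r`, as the larger distance
  -- exceeds `1`; hence `n x(π - x) ≥ 3 > 2`.
  refine ⟨3 / r, fun n hn x hx hw => ?_⟩
  have hn' : 3 ≤ n * r := by rwa [ge_iff_le, div_le_iff₀ hr] at hn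
  have hn0 : 0 < n := by by_contra! h; nlinarith
  have hp := Real.pi_gt_three
  have hx1 := hx.1
  have hx2 := hx.2
  rcases le_total x (Real.pi / 2) with h | h
  · have hxr : x < r := by
      by_contra! hle
      have : r * 1 ≤ x * (Real.pi - x) := mul_le_mul hle (by linarith) (by norm_num) hx1
      nlinarith
    have := h0' (x := x) (by
      rw [Real.dist_eq, sub_zero, abs_of_nonneg hx1]; exact hxr.trans_le (min_le_left _ _))
    rw [Real.dist_eq, h0, sub_zero] at this
    exact this.le
  · have hxr : Real.pi - x < r := by
      by_contra! hle
      have : 1 * r ≤ x * (Real.pi - x) := mul_le_mul (by linarith) hle hr.le hx1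
      nlinarith
    have := h1' (x := x) (by
      rw [Real.dist_eq, abs_sub_comm, abs_of_nonneg (by linarith)]
      exact hxr.trans_le (min_le_right _ _))
    rw [Real.dist_eq, hpi, sub_zero] at this
    exact this.le

end Cutoff

end Beam

/-! ### From weak solutions to the mode equations -/

namespace Beam

/-- A weighted Cauchy–Schwarz inequality. -/
theorem exists_tsum_rpow_mul_abs_le {r σ : ℝ} (hr : r < σ - 1 / 2) : ∃ K, 0 ≤ K ∧ ∀ c : ℕ+ → ℝ,
    Summable (fun j : ℕ+ => (j : ℝ) ^ (2 * σ) * c j ^ 2) →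
      ∑' j : ℕ+, (j : ℝ) ^ r * |c j| ≤ K * √(∑' j : ℕ+, (j : ℝ) ^ (2 * σ) * c j ^ 2) := by
  have h1 : Summable fun j : ℕ+ => (j : ℝ) ^ (2 * (r - σ)) := summable_pnat_rpow (by linarith)
  refine ⟨√(∑' j : ℕ+, (j : ℝ) ^ (2 * (r - σ))), Real.sqrt_nonneg _, fun c hc => ?_⟩
  rw [← Real.sqrt_mul (tsum_nonneg fun j => by positivity)]
  refine (summable_rpow_mul_abs hc hr).tsum_le_of_sum_le fun F => Real.le_sqrt_of_sq_le ?_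
  have e0 : ∀ j : ℕ+, (j : ℝ) ^ r * |c j| = (j : ℝ) ^ (r - σ) * ((j : ℝ) ^ σ * |c j|) := fun j => by
    rw [← mul_assoc, ← Real.rpow_add (cast_pnat_pos j)]; congr 2; ring
  have e1 : ∀ j : ℕ+, ((j : ℝ) ^ (r - σ)) ^ 2 = (j : ℝ) ^ (2 * (r - σ)) := fun j => by
    rw [← Real.rpow_natCast, ← Real.rpow_mul (cast_pnat_pos j).le]; congr 1; push_cast; ring
  have e2 : ∀ j : ℕ+, ((j : ℝ) ^ σ * |c j|) ^ 2 = (j : ℝ) ^ (2 * σ) * c j ^ 2 := fun j => by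
    rw [mul_pow, sq_abs, ← Real.rpow_natCast, ← Real.rpow_mul (cast_pnat_pos j).le]
    congr 2; push_cast; ring
  simp_rw [e0]
  refine (Finset.sum_mul_sq_le_sq_mul_sq F _ _).trans ?_
  simp_rw [e1, e2]
  exact mul_le_mul (h1.sum_le_tsum F fun j _ => by positivity)
    (hc.sum_le_tsum F fun j _ => by positivity) (Finset.sum_nonneg fun j _ => by positivity)
    (tsum_nonneg fun j => by positivity)

theorem abs_coeff_le_normH {σ : ℝ} {u : ℝ → ℝ} (hσ : 0 ≤ σ)
    (hu : Summable fun j : ℕ+ => (j : ℝ) ^ (2 * σ) * coeff u j ^ 2) (k : ℕ+) :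
    |coeff u k| ≤ normH σ u := by
  refine Real.le_sqrt_of_sq_le ?_
  rw [sq_abs]
  refine le_trans ?_ (hu.le_tsum k fun j _ => by positivity)
  exact le_mul_of_one_le_left (sq_nonneg _) (Real.one_le_rpow (one_le_cast k) (by linarith))

section Weak

variable {m s : ℝ} {I : Set ℝ} {u ut : ℝ → ℝ → ℝ}

theorem summable_coeff_sub {σ : ℝ} {f g : ℝ → ℝ} (hσ : 1 / 2 < σ) (hf : MemH σ f) (hg : MemH σ g) :
    Summable fun j : ℕ+ => (j : ℝ) ^ (2 * σ) * coeff (fun x => f x - g x) j ^ 2 := by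
  simp_rw [coeff_sub (hf.continuousOn hσ) (hg.continuousOn hσ)]
  exact summable_sub_sq hf.1 hg.1

theorem tendsto_coeff {σ : ℝ} (hσ : 1 / 2 < σ) (hI : IsOpen I) (hu : ∀ t ∈ I, MemH σ (u t))
    {t : ℝ} (ht : t ∈ I)
    (hc : Tendsto (fun τ => normH σ (fun x => u τ x - u t x)) (𝓝 t) (𝓝 0)) (k : ℕ+) :
    ContinuousAt (fun τ => coeff (u τ) k) t := by
  rw [ContinuousAt, tendsto_iff_norm_sub_tendsto_zero]
  refine squeeze_zero' (Eventually.of_forall fun τ => norm_nonneg _) ?_ hc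
  filter_upwards [hI.mem_nhds ht] with τ hτ
  rw [← coeff_sub ((hu τ hτ).continuousOn hσ) ((hu t ht).continuousOn hσ)]
  exact abs_coeff_le_normH (by linarith) (summable_coeff_sub hσ (hu τ hτ) (hu t ht)) k

theorem hasDerivAt_coeff (hs : 1 / 2 < s) (hI : IsOpen I) (hu : ∀ t ∈ I, MemH (s + 2) (u t))
    (hut : ∀ t ∈ I, MemH s (ut t)) {t : ℝ} (ht : t ∈ I)
    (hd : Tendsto (fun τ => normH s (fun x => (τ - t)⁻¹ * (u τ x - u t x) - ut t x))
      (𝓝[≠] t) (𝓝 0)) (k : ℕ+) :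
    HasDerivAt (fun τ => coeff (u τ) k) (coeff (ut t) k) t := by
  rw [hasDerivAt_iff_tendsto_slope, tendsto_iff_norm_sub_tendsto_zero]
  refine squeeze_zero' (Eventually.of_forall fun τ => norm_nonneg _) ?_ hd
  filter_upwards [mem_nhdsWithin_of_mem_nhds (hI.mem_nhds ht)] with τ hτ
  have cu := fun r hr => (hu r hr).continuousOn (by linarith)
  have cut := (hut t ht).continuousOn hs
  have e : ∀ j, coeff (fun x => (τ - t)⁻¹ * (u τ x - u t x) - ut t x) j =
      (τ - t)⁻¹ * (coeff (u τ) j - coeff (u t) j) - coeff (ut t) j := fun j => by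
    rw [coeff_sub (u := fun x => (τ - t)⁻¹ * (u τ x - u t x))
      (continuousOn_const.mul ((cu τ hτ).sub (cu t ht))) cut, coeff_const_mul,
      coeff_sub (cu τ hτ) (cu t ht)]
  rw [slope_def_field, div_eq_inv_mul, ← e k]
  refine abs_coeff_le_normH (by linarith) ?_ k
  simp_rw [e]
  refine summable_sub_sq ?_ (hut t ht).1
  simp_rw [mul_pow, mul_left_comm]
  refine Summable.mul_left _ ?_
  exact summable_rpow_mul_sq_of_le (summable_sub_sq (hu τ hτ).1 (hu t ht).1) (by linarith)

theorem tsum_sq_mul_abs_eq (c : ℕ+ → ℝ) :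
    ∑' j : ℕ+, (j : ℝ) ^ 2 * |c j| = ∑' j : ℕ+, (j : ℝ) ^ (2 : ℝ) * |c j| := by
  simp_rw [Real.rpow_two]

/-- `∫ u_x² / 2π` in terms of the coefficients. -/
noncomputable def stretch (u : ℝ → ℝ) : ℝ :=
  1 / (2 * Real.pi) * ∑' j : ℕ+, (j : ℝ) ^ 2 * coeff u j ^ 2

theorem MemH.summable_sq (hs : 1 / 2 < s) {u : ℝ → ℝ} (h : MemH (s + 2) u) :
    Summable fun j : ℕ+ => (j : ℝ) ^ 2 * coeff u j ^ 2 := by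
  have := summable_rpow_mul_sq_of_le (r := 1) h.1 (by linarith)
  simpa using this

/-- Factor the difference of squares: one factor is bounded by the norms, and the other is summed
with weight `j²` through the weighted Cauchy–Schwarz inequality. -/
theorem continuousAt_stretch (hs : 1 / 2 < s) (hI : IsOpen I)
    (hu : ∀ t ∈ I, MemH (s + 2) (u t)) {t : ℝ} (ht : t ∈ I)
    (hc : Tendsto (fun τ => normH (s + 2) (fun x => u τ x - u t x)) (𝓝 t) (𝓝 0)) :
    ContinuousAt (fun τ => stretch (u τ)) t := by
  obtain ⟨K, hK0, hK⟩ := exists_tsum_rpow_mul_abs_le (r := 2) (σ := s + 2) (by linarith)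
  refine ContinuousAt.mul continuousAt_const ?_
  rw [ContinuousAt, tendsto_iff_norm_sub_tendsto_zero]
  set N : ℝ → ℝ := fun τ => normH (s + 2) (fun x => u τ x - u t x) with hN
  set B := normH (s + 2) (u t)
  have hlim : Tendsto (fun τ => (2 * B + N τ) * (K * N τ)) (𝓝 t) (𝓝 0) := by
    have := (hc.const_add (2 * B)).mul (hc.const_mul K)
    simpa using this
  refine squeeze_zero' (Eventually.of_forall fun τ => norm_nonneg _) ?_ hlim
  filter_upwards [hI.mem_nhds ht] with τ hτ
  have hσ : 1 / 2 < s + 2 := by linarith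
  have hsum := summable_coeff_sub hσ (hu τ hτ) (hu t ht)
  have e : ∀ j, coeff (fun x => u τ x - u t x) j = coeff (u τ) j - coeff (u t) j :=
    coeff_sub ((hu τ hτ).continuousOn hσ) ((hu t ht).continuousOn hσ)
  have h1 := hK _ hsum
  rw [← tsum_sq_mul_abs_eq] at h1
  have h2 := summable_sq_mul_abs_of_rpow hsum hs
  rw [← ((hu τ hτ).summable_sq hs).tsum_sub ((hu t ht).summable_sq hs)]
  refine (tsum_of_norm_bounded (h2.hasSum.mul_left (2 * B + N τ)) fun j => ?_).trans ?_
  · have h3 : |coeff (fun x => u τ x - u t x) j| ≤ N τ :=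
      abs_coeff_le_normH (by linarith) hsum j
    have h4 : |coeff (u t) j| ≤ B := abs_coeff_le_normH (by linarith) (hu t ht).1 j
    have h5 : (j : ℝ) ^ 2 * coeff (u τ) j ^ 2 - (j : ℝ) ^ 2 * coeff (u t) j ^ 2 =
      (2 * coeff (u t) j + coeff (fun x => u τ x - u t x) j) *
        ((j : ℝ) ^ 2 * coeff (fun x => u τ x - u t x) j) := by rw [e]; ring
    rw [h5, norm_mul, norm_mul _ (coeff _ j), norm_pow, Real.norm_natCast, Real.norm_eq_abs,
      Real.norm_eq_abs]
    refine mul_le_mul_of_nonneg_right ?_ (by positivity)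
    refine (abs_add_le _ _).trans (add_le_add ?_ h3)
    rw [abs_mul, abs_two]
    linarith
  · exact mul_le_mul_of_nonneg_left h1 (add_nonneg
      (mul_nonneg zero_le_two (Real.sqrt_nonneg _)) (Real.sqrt_nonneg _))

/-- The second derivatives of the solution depend continuously on time in the sup norm. -/
theorem abs_series_sub_le (hs : 1 / 2 < s) : ∃ K, 0 ≤ K ∧ ∀ f g : ℝ → ℝ, MemH (s + 2) f →
    MemH (s + 2) g → ∀ x, |series (fun j => -(j : ℝ) ^ 2 * coeff f j) x -
      series (fun j => -(j : ℝ) ^ 2 * coeff g j) x| ≤ K * normH (s + 2) (fun x => f x - g x) := by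
  obtain ⟨K, hK0, hK⟩ := exists_tsum_rpow_mul_abs_le (r := 2) (σ := s + 2) (by linarith)
  refine ⟨K, hK0, fun f g hf hg x => ?_⟩
  have hσ : 1 / 2 < s + 2 := by linarith
  have hsum := summable_coeff_sub hσ hf hg
  refine le_trans ?_ (hK _ hsum)
  rw [← tsum_sq_mul_abs_eq]
  have h := summable_sq_mul_abs_of_rpow hsum hs
  have e : series (fun j => -(j : ℝ) ^ 2 * coeff f j) x -
      series (fun j => -(j : ℝ) ^ 2 * coeff g j) x =
      series (fun j => -(j : ℝ) ^ 2 * coeff (fun x => f x - g x) j) x := by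
    have hf' := hasSum_series (summable_abs_sq_mul (summable_sq_mul_abs_of_rpow hf.1 hs)) x
    have hg' := hasSum_series (summable_abs_sq_mul (summable_sq_mul_abs_of_rpow hg.1 hs)) x
    have hfg := hasSum_series (summable_abs_sq_mul h) x
    refine (hf'.sub hg').unique (hfg.congr_fun fun j => ?_)
    rw [coeff_sub (hf.continuousOn hσ) (hg.continuousOn hσ)]
    ring
  rw [e]
  refine (abs_series_le (summable_abs_sq_mul h) x).trans (le_of_eq ?_)
  congr 1
  ext j
  rw [abs_mul, abs_neg, abs_pow, Nat.abs_cast]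

/-- The function `φ_k` is not compactly supported, so the weak equation is tested with `cutoffPhi k
n` as `n → ∞`. The boundary layers contribute at most a constant times the supremum of `|u_xx|`
there, which tends to zero since `u_xx` is a sine series and vanishes at the end points. Continuity
of `u` in time makes this uniform for times near `t`, so limit and time derivative may be exchanged.
-/
theorem hasDerivAt_coeff_velocity (hs : 1 / 2 < s) (hI : IsOpen I)
    (hu : ∀ t ∈ I, MemH (s + 2) (u t)) (hut : ∀ t ∈ I, MemH s (ut t)) {t : ℝ} (ht : t ∈ I)
    (hc : Tendsto (fun τ => normH (s + 2) (fun x => u τ x - u t x)) (𝓝 t) (𝓝 0))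
    (hw : ∀ η : ℝ → ℝ, IsTest η → ∀ t ∈ I,
      HasDerivAt (fun τ => ∫ x in (0 : ℝ)..Real.pi, ut τ x * η x) (-weakForm m (u t) η) t)
    (k : ℕ+) :
    HasDerivAt (fun τ => coeff (ut τ) k)
      (-((k : ℝ) ^ 4 + (m + stretch (u t)) * (k : ℝ) ^ 2) * coeff (u t) k) t := by
  obtain ⟨C, hC0, hC⟩ := exists_integral_cutoffPhi_sub_le k
  obtain ⟨K, hK0, hK⟩ := abs_series_sub_le hs
  have hσ : 1 / 2 < s + 2 := by linarith
  set g' : ℝ → ℝ := fun τ =>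
    -((k : ℝ) ^ 4 + (m + stretch (u τ)) * (k : ℝ) ^ 2) * coeff (u τ) k with hg'
  have hac := continuousAt_stretch hs hI hu ht hc
  have hgc : ContinuousAt g' t := by
    have hcc := tendsto_coeff hσ hI hu ht hc k
    exact ((continuousAt_const.add ((continuousAt_const.add hac).mul continuousAt_const)).neg).mul
      hcc
  have hG : ∀ τ ∈ I, Summable fun j : ℕ+ => |(-(j : ℝ) ^ 2 * coeff (u τ) j)| := fun τ hτ =>
    summable_abs_sq_mul (summable_sq_mul_abs_of_rpow (hu τ hτ).1 hs)
  have hboundary : ∀ c : ℕ+ → ℝ, (Summable fun j => |c j|) → ∀ δ > 0, ∀ᶠ n : ℝ in atTop,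
      ∀ x ∈ Icc 0 Real.pi, n * (x * (Real.pi - x)) ≤ 2 → |series c x| ≤ δ := fun c hc δ hδ => by
    obtain ⟨n₀, hn₀⟩ := exists_forall_boundary_layer_le (continuous_series hc) (series_zero c)
      (series_pi c) hδ
    filter_upwards [eventually_ge_atTop n₀] with n hn using hn₀ n hn
  refine hasDerivAt_of_tendsto_prod (l := (atTop : Filter ℝ)) (g' := g')
    (f := fun n τ => ∫ x in (0 : ℝ)..Real.pi, ut τ x * cutoffPhi k n x)
    (f' := fun n τ => -weakForm m (u τ) (cutoffPhi k n)) ?_ hgc ?_ ?_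
  · have hdiff : Tendsto (fun n : ℝ × ℝ => weakForm m (u n.2) (cutoffPhi k n.1) + g' n.2)
        (atTop ×ˢ 𝓝 t) (𝓝 0) := by
      rw [Metric.tendsto_nhds]
      intro ε hε
      -- At `τ = t` the error bound is `L δ`, and `δ = ε / (L + 1)` keeps it below `ε`; continuity
      -- in `τ` extends the strict inequality to a neighbourhood.
      set L := C * (1 + |m + stretch (u t)|)
      have hL : 0 ≤ L := by positivity
      set δ := ε / (L + 1) with hδ
      have hδ0 : 0 < δ := by positivity
      have hlim : ∀ᶠ τ in 𝓝 t, C * (δ + K * normH (s + 2) (fun x => u τ x - u t x)) *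
          (1 + |m + stretch (u τ)|) < ε := by
        have h1 : Tendsto (fun τ => C * (δ + K * normH (s + 2) (fun x => u τ x - u t x)) *
            (1 + |m + stretch (u τ)|)) (𝓝 t)
            (𝓝 (C * (δ + K * 0) * (1 + |m + stretch (u t)|))) :=
          (((hc.const_mul K).const_add δ).const_mul C).mul ((hac.const_add m).abs.const_add 1)
        refine h1.eventually_lt_const ?_
        have : C * (δ + K * 0) * (1 + |m + stretch (u t)|) = L * δ := by ring
        rw [this, hδ, mul_div_assoc', div_lt_iff₀ (by linarith)]
        nlinarith
      have hn := (hboundary _ (hG t ht) δ hδ0).and (eventually_ge_atTop (2 : ℝ))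
      filter_upwards [hn.prod_mk (hlim.and (hI.mem_nhds ht))] with ⟨n, τ⟩ ⟨⟨hn1, hn2⟩, hτ1, hτ⟩
      simp only at hn1 hn2 hτ1 hτ ⊢
      have hcs := hG τ hτ
      set G := series (fun j : ℕ+ => -(j : ℝ) ^ 2 * coeff (u τ) j) with hGdef
      have hGk : coeff G k = -(k : ℝ) ^ 2 * coeff (u τ) k := coeff_series hcs k
      obtain ⟨c1, c2⟩ := hC G n (δ + K * normH (s + 2) (fun x => u τ x - u t x))
        (continuous_series hcs) hn2 (fun x hx hxn => by
          have h1 := hn1 x hx hxn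
          have h2 := hK (u τ) (u t) (hu τ hτ) (hu t ht) x
          have h3 := abs_add_le (series (fun j : ℕ+ => -(j : ℝ) ^ 2 * coeff (u t) j) x)
            (G x - series (fun j : ℕ+ => -(j : ℝ) ^ 2 * coeff (u t) j) x)
          rw [add_sub_cancel] at h3
          linarith)
      rw [weakForm_eq (summable_sq_mul_abs_of_rpow (hu τ hτ).1 hs) (hu τ hτ).eq_series
        (isTest_cutoffPhi k (by linarith)), ← stretch, dist_zero_right, Real.norm_eq_abs]
      refine lt_of_le_of_lt ?_ hτ1
      have e : (∫ x in (0 : ℝ)..Real.pi, G x * deriv (deriv (cutoffPhi k n)) x) -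
          (m + stretch (u τ)) * (∫ x in (0 : ℝ)..Real.pi, G x * cutoffPhi k n x) + g' τ =
          ((∫ x in (0 : ℝ)..Real.pi, G x * deriv (deriv (cutoffPhi k n)) x) + k ^ 2 * coeff G k) -
          (m + stretch (u τ)) *
            ((∫ x in (0 : ℝ)..Real.pi, G x * cutoffPhi k n x) - coeff G k) := by
        rw [hGk, hg']; ring
      rw [e]
      refine (abs_sub _ _).trans ?_
      rw [abs_mul]
      nlinarith [mul_le_mul_of_nonneg_left c1 (abs_nonneg (m + stretch (u τ)))]
    have h2 := (hgc.tendsto.comp (tendsto_snd (f := (atTop : Filter ℝ)))).sub hdiff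
    rw [sub_zero] at h2
    refine h2.congr fun n => ?_
    simp
  · have hn := eventually_gt_atTop (0 : ℝ)
    filter_upwards [hn.prod_mk (hI.mem_nhds ht)] with n hn'
    exact hw _ (isTest_cutoffPhi k hn'.1) n.2 hn'.2
  · filter_upwards [hI.mem_nhds ht] with τ hτ
    have hcs := (hut τ hτ).summable_abs hs
    rw [Metric.tendsto_nhds]
    intro ε hε
    filter_upwards [hboundary _ hcs (ε / (C + 1)) (by positivity), eventually_ge_atTop (2 : ℝ)]
      with n hn1 hn2
    have h := (hC (series (coeff (ut τ))) n _ (continuous_series hcs) hn2 hn1).1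
    rw [coeff_series hcs] at h
    have e : ∫ x in (0 : ℝ)..Real.pi, ut τ x * cutoffPhi k n x =
        ∫ x in (0 : ℝ)..Real.pi, series (coeff (ut τ)) x * cutoffPhi k n x :=
      integral_congr_Ioo fun x hx => by rw [(hut τ hτ).eq_series x (Ioo_subset_Icc_self hx)]
    rw [e, Real.dist_eq]
    refine h.trans_lt ?_
    rw [mul_div_assoc', div_lt_iff₀ (by linarith)]
    nlinarith

/-- The modes of a weak solution. -/
theorem IsWeakSolution.exists_isModeSolution {u₀ v₀ : ℝ → ℝ} (hm : -1 / 2 ≤ m) (hs : 1 / 2 < s)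
    (h : IsWeakSolution m s u₀ v₀ I u) :
    ∃ a p q, IsModeSolution m I a p q ∧ (∀ j : ℕ+, p j 0 = j * coeff u₀ j) ∧
      (∀ j : ℕ+, q j 0 = j * coeff v₀ j / omega m j) ∧
      (∀ t ∈ I, MemH (s + 2) (u t)) ∧ ∀ t (j : ℕ+), p j t = j * coeff (u t) j := by
  obtain ⟨hI, -, h0, ut, hu, hc, hut, -, hd, hu0, hv0, hw⟩ := h
  refine ⟨fun t => stretch (u t), fun j t => j * coeff (u t) j,
    fun j t => j * coeff (ut t) j / omega m j, ⟨?_, ?_, ?_, ?_⟩, ?_, ?_, hu, fun _ _ => rfl⟩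
  · intro t ht j
    refine ((hasDerivAt_coeff hs hI hu hut ht (hd t ht) j).const_mul (j : ℝ)).congr_deriv ?_
    rw [mul_div_cancel₀ _ (omega_pos hm j).ne']
  · intro t ht j
    refine (((hasDerivAt_coeff_velocity hs hI hu hut ht (hc t ht) hw j).const_mul
      (j : ℝ)).div_const (omega m j)).congr_deriv ?_
    have h1 := omega_pos hm j
    have h2 := omega_sq hm j
    rw [bcoef, div_eq_iff h1.ne']
    field_simp
    rw [h2]
    ring
  · exact fun t ht => (continuousAt_stretch hs hI hu ht (hc t ht)).continuousWithinAt
  · intro t ht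
    have h1 := ((hu t ht).summable_sq hs).hasSum
    have h2 : 2 * Real.pi * stretch (u t) = ∑' j : ℕ+, (j : ℝ) ^ 2 * coeff (u t) j ^ 2 := by
      rw [stretch, ← mul_assoc, mul_one_div_cancel (by positivity), one_mul]
    rw [h2]
    exact h1.congr_fun fun j => by rw [mul_pow]
  · exact fun j => congrArg _ (coeff_congr hu0 j)
  · exact fun j => by simp only [coeff_congr hv0 j]

end Weak

end Beam

/-! ### From the mode equations to weak solutions -/

namespace Beam

theorem rpow_two_mul_add_one (j : ℕ+) (σ : ℝ) :
    (j : ℝ) ^ (2 * (σ + 1)) = (j : ℝ) ^ (2 * σ) * (j : ℝ) ^ 2 := by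
  rw [mul_add, Real.rpow_add (cast_pnat_pos j), mul_one, Real.rpow_two]

/-- Reduces convergence in a weighted norm to convergence of each coefficient and a summable bound;
it serves the continuity of `u`, that of `u_t`, and the difference quotients. -/
theorem tendsto_sqrt_tsum {ι : Type*} {l : Filter ι} {σ : ℝ} {f : ι → ℕ+ → ℝ} {b : ℕ+ → ℝ}
    (hb : Summable b) (hf : ∀ j, Tendsto (fun τ => f τ j) l (𝓝 0))
    (hfb : ∀ᶠ τ in l, ∀ j : ℕ+, (j : ℝ) ^ (2 * σ) * f τ j ^ 2 ≤ b j) :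
    Tendsto (fun τ => √(∑' j : ℕ+, (j : ℝ) ^ (2 * σ) * f τ j ^ 2)) l (𝓝 0) := by
  have h : Tendsto (fun τ => ∑' j : ℕ+, (j : ℝ) ^ (2 * σ) * f τ j ^ 2) l
      (𝓝 (∑' _ : ℕ+, (0 : ℝ))) := by
    refine tendsto_tsum_of_dominated_convergence hb (fun j => ?_) ?_
    · have := ((hf j).pow 2).const_mul ((j : ℝ) ^ (2 * σ))
      simpa using this
    · filter_upwards [hfb] with τ hτ j
      rw [Real.norm_of_nonneg (by positivity)]
      exact hτ j
  have h2 := (Real.continuous_sqrt.tendsto _).comp h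
  rw [tsum_zero, Real.sqrt_zero] at h2
  exact h2

namespace IsModeSolution

variable {m s : ℝ} {a : ℝ → ℝ} {p q : ℕ+ → ℝ → ℝ}

/-- The factor `L` does not depend on the mode, so every weighted norm of the data is propagated,
and `L` times the weighted initial energy is the majorant in all dominated convergence arguments
below. -/
theorem exists_mode_bound (hm : -1 / 2 ≤ m) (h : IsModeSolution m univ a p q) (R : ℝ) :
    ∃ A L, 0 ≤ A ∧ 0 ≤ L ∧ ∀ t ∈ Icc (-R) R, |a t| ≤ A ∧
      ∀ j, p j t ^ 2 + q j t ^ 2 ≤ L * (p j 0 ^ 2 + q j 0 ^ 2) := by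
  obtain ⟨A, hA⟩ := (isCompact_Icc (a := -R) (b := R)).exists_bound_of_continuousOn
    (h.continuousOn.mono (subset_univ _))
  refine ⟨max A 0, Real.exp (cc m * (max A 0 + 1) * R), le_max_right _ _, (Real.exp_pos _).le,
    fun t ht => ⟨(hA t ht).trans (le_max_left _ _), fun j => ?_⟩⟩
  have hR : |t| ≤ R := abs_le.2 ht
  have h1 := mode_le hm (le_max_right A 0) (h.mono (subset_univ (uIcc 0 t)))
    (fun r hr => (hA r (uIcc_subset_Icc ⟨by linarith [abs_nonneg t], (abs_nonneg t).trans hR⟩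
      ht hr)).trans (le_max_left _ _)) j
  have hc := cc_pos hm
  refine h1.trans (mul_le_mul_of_nonneg_right (Real.exp_le_exp.2 ?_)
    (add_nonneg (sq_nonneg _) (sq_nonneg _)))
  exact mul_le_mul_of_nonneg_left hR (by positivity)

theorem omega_sq_le (hm : -1 / 2 ≤ m) (hm1 : m ≤ 1) (j : ℕ+) :
    omega m j ^ 2 ≤ 2 * (j : ℝ) ^ 4 := by
  have h1 : (1 : ℝ) ≤ (j : ℝ) ^ 2 := one_le_pow₀ (one_le_cast j)
  rw [omega_sq hm]
  nlinarith

variable (p q) in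
/-- The displacement of a mode solution. -/
noncomputable def position (t : ℝ) (j : ℕ+) : ℝ := p j t / j

variable (m q) in
/-- The velocity of a mode solution. -/
noncomputable def velocity (t : ℝ) (j : ℕ+) : ℝ := omega m j * q j t / j

theorem hasDerivAt_position (h : IsModeSolution m univ a p q) (t : ℝ) (j : ℕ+) :
    HasDerivAt (fun τ => position p τ j) (velocity m q t j) t :=
  (h.hasDerivAt_p t trivial j).div_const _

theorem hasDerivAt_velocity (hm : -1 / 2 ≤ m) (h : IsModeSolution m univ a p q) (t : ℝ) (j : ℕ+) :
    HasDerivAt (fun τ => velocity m q τ j)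
      (-((j : ℝ) ^ 4 + (m + a t) * (j : ℝ) ^ 2) * position p t j) t := by
  refine (((h.hasDerivAt_q t trivial j).const_mul (omega m j)).div_const _).congr_deriv ?_
  have h1 := omega_mul_bcoef hm j
  have h2 := omega_sq hm j
  have h3 : omega m j * (omega m j + a t * bcoef m j) = (j : ℝ) ^ 4 + (m + a t) * (j : ℝ) ^ 2 := by
    linear_combination h2 + a t * h1
  rw [position, ← h3]
  ring

theorem sq_mul_position_sq (t : ℝ) (j : ℕ+) : (j : ℝ) ^ 2 * position p t j ^ 2 = p j t ^ 2 := by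
  rw [position, div_pow, mul_div_cancel₀ _ (pow_pos (cast_pnat_pos j) 2).ne']

theorem velocity_sq_le (hm : -1 / 2 ≤ m) (hm1 : m ≤ 1) (t : ℝ) (j : ℕ+) :
    velocity m q t j ^ 2 ≤ 2 * (j : ℝ) ^ 2 * q j t ^ 2 := by
  have hj := cast_pnat_pos j
  rw [velocity, div_pow, mul_pow, div_le_iff₀ (by positivity)]
  nlinarith [mul_le_mul_of_nonneg_right (omega_sq_le hm hm1 j) (sq_nonneg (q j t))]

variable (hE : Summable fun j : ℕ+ => (j : ℝ) ^ (2 * (s + 1)) * (p j 0 ^ 2 + q j 0 ^ 2))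

theorem rpow_mul_position_sq_le {L t : ℝ}
    (hL : ∀ j, p j t ^ 2 + q j t ^ 2 ≤ L * (p j 0 ^ 2 + q j 0 ^ 2)) (j : ℕ+) :
    (j : ℝ) ^ (2 * (s + 2)) * position p t j ^ 2 ≤
      L * ((j : ℝ) ^ (2 * (s + 1)) * (p j 0 ^ 2 + q j 0 ^ 2)) := by
  have e : (j : ℝ) ^ (2 * (s + 2)) * position p t j ^ 2 =
      (j : ℝ) ^ (2 * (s + 1)) * p j t ^ 2 := by
    rw [show s + 2 = s + 1 + 1 by ring, rpow_two_mul_add_one, mul_assoc, sq_mul_position_sq]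
  rw [e, mul_left_comm]
  refine mul_le_mul_of_nonneg_left ?_ (by positivity)
  linarith [hL j, sq_nonneg (q j t)]

theorem rpow_mul_velocity_sq_le (hm : -1 / 2 ≤ m) (hm1 : m ≤ 1) {L t : ℝ}
    (hL : ∀ j, p j t ^ 2 + q j t ^ 2 ≤ L * (p j 0 ^ 2 + q j 0 ^ 2)) (j : ℕ+) :
    (j : ℝ) ^ (2 * s) * velocity m q t j ^ 2 ≤
      2 * L * ((j : ℝ) ^ (2 * (s + 1)) * (p j 0 ^ 2 + q j 0 ^ 2)) := by
  have h1 := velocity_sq_le (q := q) hm hm1 t j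
  have h2 : q j t ^ 2 ≤ L * (p j 0 ^ 2 + q j 0 ^ 2) := by linarith [hL j, sq_nonneg (p j t)]
  calc (j : ℝ) ^ (2 * s) * velocity m q t j ^ 2
      ≤ (j : ℝ) ^ (2 * s) * (2 * (j : ℝ) ^ 2 * (L * (p j 0 ^ 2 + q j 0 ^ 2))) := by
        refine mul_le_mul_of_nonneg_left (h1.trans ?_) (by positivity)
        exact mul_le_mul_of_nonneg_left h2 (by positivity)
    _ = _ := by rw [rpow_two_mul_add_one]; ring

include hE in
theorem summable_position (hm : -1 / 2 ≤ m) (h : IsModeSolution m univ a p q) (t : ℝ) :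
    Summable fun j : ℕ+ => (j : ℝ) ^ (2 * (s + 2)) * position p t j ^ 2 := by
  obtain ⟨A, L, -, -, hL⟩ := h.exists_mode_bound hm |t|
  exact Summable.of_nonneg_of_le (fun j => by positivity)
    (rpow_mul_position_sq_le (hL t (abs_le.1 le_rfl)).2) (hE.mul_left L)

include hE in
theorem summable_velocity (hm : -1 / 2 ≤ m) (hm1 : m ≤ 1) (h : IsModeSolution m univ a p q)
    (t : ℝ) : Summable fun j : ℕ+ => (j : ℝ) ^ (2 * s) * velocity m q t j ^ 2 := by
  obtain ⟨A, L, -, -, hL⟩ := h.exists_mode_bound hm |t|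
  exact Summable.of_nonneg_of_le (fun j => by positivity)
    (rpow_mul_velocity_sq_le hm hm1 (hL t (abs_le.1 le_rfl)).2) (hE.mul_left (2 * L))

theorem eventually_mem_Icc (t : ℝ) : ∀ᶠ τ in 𝓝 t, τ ∈ Icc (-(|t| + 1)) (|t| + 1) := by
  filter_upwards [Ioo_mem_nhds (sub_one_lt t) (lt_add_one t)] with τ hτ
  exact ⟨by linarith [hτ.1, neg_abs_le t], by linarith [hτ.2, le_abs_self t]⟩

theorem mem_Icc_abs_add_one (t : ℝ) : t ∈ Icc (-(|t| + 1)) (|t| + 1) :=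
  (eventually_mem_Icc t).self_of_nhds

include hE in
theorem tendsto_normH_position (hm : -1 / 2 ≤ m) (hs : 1 / 2 < s)
    (h : IsModeSolution m univ a p q) (t : ℝ) :
    Tendsto (fun τ => normH (s + 2) fun x => series (position p τ) x - series (position p t) x)
      (𝓝 t) (𝓝 0) := by
  obtain ⟨A, L, -, -, hL⟩ := h.exists_mode_bound hm (|t| + 1)
  have hc := fun τ => summable_abs_of_rpow (summable_position hE hm h τ) (by linarith)
  have e : ∀ τ j, coeff (fun x => series (position p τ) x - series (position p t) x) j =
      position p τ j - position p t j := fun τ j => by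
    rw [coeff_sub (continuous_series (hc τ)).continuousOn (continuous_series (hc t)).continuousOn,
      coeff_series (hc τ), coeff_series (hc t)]
  simp_rw [normH, e]
  refine tendsto_sqrt_tsum (hE.mul_left (4 * L)) (fun j => ?_) ?_
  · have := (h.hasDerivAt_position t j).continuousAt.tendsto.sub_const (position p t j)
    rwa [sub_self] at this
  · filter_upwards [eventually_mem_Icc t] with τ hτ j
    have h1 := rpow_mul_position_sq_le (s := s) (hL τ hτ).2 j
    have h2 := rpow_mul_position_sq_le (s := s) (hL t (mem_Icc_abs_add_one t)).2 j
    have h3 : 0 ≤ (j : ℝ) ^ (2 * (s + 2)) := by positivity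
    nlinarith [mul_nonneg h3 (sq_nonneg (position p τ j + position p t j))]

include hE in
theorem tendsto_normH_velocity (hm : -1 / 2 ≤ m) (hm1 : m ≤ 1) (hs : 1 / 2 < s)
    (h : IsModeSolution m univ a p q) (t : ℝ) :
    Tendsto (fun τ => normH s fun x => series (velocity m q τ) x - series (velocity m q t) x)
      (𝓝 t) (𝓝 0) := by
  obtain ⟨A, L, -, -, hL⟩ := h.exists_mode_bound hm (|t| + 1)
  have hc := fun τ => summable_abs_of_rpow (summable_velocity hE hm hm1 h τ) hs
  have e : ∀ τ j, coeff (fun x => series (velocity m q τ) x - series (velocity m q t) x) j =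
      velocity m q τ j - velocity m q t j := fun τ j => by
    rw [coeff_sub (continuous_series (hc τ)).continuousOn (continuous_series (hc t)).continuousOn,
      coeff_series (hc τ), coeff_series (hc t)]
  simp_rw [normH, e]
  refine tendsto_sqrt_tsum (hE.mul_left (8 * L)) (fun j => ?_) ?_
  · have := (h.hasDerivAt_velocity hm t j).continuousAt.tendsto.sub_const (velocity m q t j)
    rwa [sub_self] at this
  · filter_upwards [eventually_mem_Icc t] with τ hτ j
    have h1 := rpow_mul_velocity_sq_le (s := s) hm hm1 (hL τ hτ).2 j
    have h2 := rpow_mul_velocity_sq_le (s := s) hm hm1 (hL t (mem_Icc_abs_add_one t)).2 j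
    have h3 : 0 ≤ (j : ℝ) ^ (2 * s) := by positivity
    nlinarith [mul_nonneg h3 (sq_nonneg (velocity m q τ j + velocity m q t j))]

include hE in
theorem tendsto_normH_slope (hm : -1 / 2 ≤ m) (hm1 : m ≤ 1) (hs : 1 / 2 < s)
    (h : IsModeSolution m univ a p q) (t : ℝ) :
    Tendsto (fun τ => normH s fun x => (τ - t)⁻¹ *
      (series (position p τ) x - series (position p t) x) - series (velocity m q t) x)
      (𝓝[≠] t) (𝓝 0) := by
  obtain ⟨A, L, -, hL0, hL⟩ := h.exists_mode_bound hm (|t| + 1)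
  have hc := fun τ => summable_abs_of_rpow (summable_position hE hm h τ) (by linarith)
  have hv := summable_abs_of_rpow (summable_velocity hE hm hm1 h t) hs
  have e : ∀ τ j, coeff (fun x => (τ - t)⁻¹ *
      (series (position p τ) x - series (position p t) x) - series (velocity m q t) x) j =
      slope (fun τ => position p τ j) t τ - velocity m q t j := fun τ j => by
    have c1 := (continuous_series (hc τ)).continuousOn (s := Icc 0 Real.pi)
    have c2 := (continuous_series (hc t)).continuousOn (s := Icc 0 Real.pi)
    rw [coeff_sub (u := fun x => (τ - t)⁻¹ * (series (position p τ) x - series (position p t) x))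
      (continuousOn_const.mul (c1.sub c2)) (continuous_series hv).continuousOn, coeff_const_mul,
      coeff_sub c1 c2, coeff_series (hc τ), coeff_series (hc t), coeff_series hv, slope_def_field,
      div_eq_inv_mul]
  simp_rw [normH, e]
  refine tendsto_sqrt_tsum (hE.mul_left (8 * L)) (fun j => ?_) ?_
  · have := (hasDerivAt_iff_tendsto_slope.1 (h.hasDerivAt_position t j)).sub_const
      (velocity m q t j)
    rwa [sub_self] at this
  · filter_upwards [mem_nhdsWithin_of_mem_nhds (eventually_mem_Icc t), self_mem_nhdsWithin]
      with τ hτ hne j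
    have hb := fun r hr => rpow_mul_velocity_sq_le (s := s) hm hm1 (hL r hr).2 j
    have h2 := hb t (mem_Icc_abs_add_one t)
    have h3 : 0 < (j : ℝ) ^ (2 * s) := Real.rpow_pos_of_pos (cast_pnat_pos j) _
    set D := 2 * L * ((j : ℝ) ^ (2 * (s + 1)) * (p j 0 ^ 2 + q j 0 ^ 2)) with hD
    have hD0 : 0 ≤ D := by positivity
    -- By the mean value inequality the difference quotients of a mode obey the bound already known
    -- for its velocity, so the same majorant applies.
    have hlip := Convex.norm_image_sub_le_of_norm_hasDerivWithin_le
      (f := fun τ => position p τ j) (f' := fun τ => velocity m q τ j)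
      (C := √(D / (j : ℝ) ^ (2 * s)))
      (fun r _ => (h.hasDerivAt_position r j).hasDerivWithinAt) (fun r hr => by
        rw [Real.norm_eq_abs]
        refine Real.le_sqrt_of_sq_le ?_
        rw [sq_abs, le_div_iff₀ h3, mul_comm]
        exact hb r hr) (convex_Icc _ _) (mem_Icc_abs_add_one t) hτ
    have h1 : (j : ℝ) ^ (2 * s) * slope (fun τ => position p τ j) t τ ^ 2 ≤ D := by
      have h4 : |slope (fun τ => position p τ j) t τ| ≤ √(D / (j : ℝ) ^ (2 * s)) := by
        rw [slope_def_field, abs_div]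
        exact div_le_of_le_mul₀ (abs_nonneg _) (Real.sqrt_nonneg _) hlip
      have h5 := pow_le_pow_left₀ (abs_nonneg _) h4 2
      rw [sq_abs, Real.sq_sqrt (by positivity), le_div_iff₀ h3] at h5
      linarith
    nlinarith [mul_nonneg h3.le
      (sq_nonneg (slope (fun τ => position p τ j) t τ + velocity m q t j))]

include hE in
-- Termwise differentiation of `∑ v_j η_j`. The acceleration costs `j⁴ u_j`; two powers are absorbed
-- by the boundedness of `j² η_j`, and `|j u_j|` by the mode energy.
theorem hasDerivAt_integral_velocity (hm : -1 / 2 ≤ m) (hm1 : m ≤ 1) (hs : 1 / 2 < s)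
    (h : IsModeSolution m univ a p q) {η : ℝ → ℝ} (hη : IsTest η) (t : ℝ) :
    HasDerivAt (fun τ => ∫ x in (0 : ℝ)..Real.pi, series (velocity m q τ) x * η x)
      (-weakForm m (series (position p t)) η) t := by
  obtain ⟨A, L, hA0, hL0, hL⟩ := h.exists_mode_bound hm (|t| + 1)
  obtain ⟨B, hB⟩ := (isCompact_Icc (a := 0) (b := Real.pi)).exists_bound_of_continuousOn
    hη.continuous_deriv_deriv.continuousOn
  have hB0 : 0 ≤ B := (norm_nonneg _).trans (hB 0 ⟨le_rfl, Real.pi_pos.le⟩)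
  have hcoeff : ∀ j : ℕ+, (j : ℝ) ^ 2 * |coeff η j| ≤ B * Real.pi := fun j => by
    have h1 := abs_coeff_le hB j
    have h2 : coeff (deriv (deriv η)) j = -(j : ℝ) ^ 2 * coeff η j := by
      rw [← integral_phi_mul_deriv_deriv hη]
      exact intervalIntegral.integral_congr fun x _ => mul_comm _ _
    rwa [h2, abs_mul, abs_neg, abs_pow, Nat.abs_cast] at h1
  have hcomm : ∀ j, ∫ x in (0 : ℝ)..Real.pi, phi j x * η x = coeff η j := fun j =>
    intervalIntegral.integral_congr fun x _ => mul_comm _ _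
  have hv := fun τ => summable_abs_of_rpow (summable_velocity hE hm hm1 h τ) hs
  have hsum : ∀ τ, HasSum (fun j => velocity m q τ j * coeff η j)
      (∫ x in (0 : ℝ)..Real.pi, series (velocity m q τ) x * η x) := fun τ => by
    have := hasSum_integral_series_mul (hv τ) hη.1.continuous.continuousOn
    simpa only [hcomm] using this
  have hpos := summable_sq_mul_abs_of_rpow (summable_position hE hm h t) hs
  have hposs := summable_abs_sq_mul hpos
  have hweak : HasSum (fun j : ℕ+ => -((j : ℝ) ^ 4 + (m + a t) * (j : ℝ) ^ 2) * position p t j *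
      coeff η j) (-weakForm m (series (position p t)) η) := by
    rw [weakForm_eq hpos (fun x _ => rfl) hη]
    have h1 := hasSum_integral_series_mul hposs hη.continuous_deriv_deriv.continuousOn
    have h2 := hasSum_integral_series_mul hposs hη.1.continuous.continuousOn
    have h3 : 1 / (2 * Real.pi) * ∑' j : ℕ+, (j : ℝ) ^ 2 * position p t j ^ 2 = a t := by
      simp_rw [sq_mul_position_sq]
      rw [(h.hasSum t trivial).tsum_eq, ← mul_assoc, one_div_mul_cancel (by positivity), one_mul]
    rw [h3]
    refine (h1.sub (h2.mul_left (m + a t))).neg.congr_fun fun j => ?_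
    rw [integral_phi_mul_deriv_deriv hη, hcomm]
    ring
  rw [← hweak.tsum_eq, show (fun τ => ∫ x in (0 : ℝ)..Real.pi, series (velocity m q τ) x * η x) =
    fun τ => ∑' j, velocity m q τ j * coeff η j from funext fun τ => (hsum τ).tsum_eq.symm]
  -- What remains is a multiple of `j` times the square root of the initial energy of the mode,
  -- summable because `1 < (s + 1) - 1/2`.
  have hbound : Summable fun j : ℕ+ => (1 + (|m| + A)) * (B * Real.pi) *
      (√L * ((j : ℝ) ^ (1 : ℝ) * |√(p j 0 ^ 2 + q j 0 ^ 2)|)) := by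
    refine ((summable_rpow_mul_abs (σ := s + 1) ?_ (by linarith)).mul_left _).mul_left _
    refine hE.congr fun j => ?_
    rw [Real.sq_sqrt (by positivity)]
  refine hasDerivAt_tsum_of_isPreconnected hbound isOpen_Ioo isPreconnected_Ioo
    (g := fun j τ => velocity m q τ j * coeff η j)
    (g' := fun (j : ℕ+) τ => -((j : ℝ) ^ 4 + (m + a τ) * (j : ℝ) ^ 2) * position p τ j * coeff η j)
    (t := Ioo (-(|t| + 1)) (|t| + 1)) (y₀ := t)
    (fun j τ _ => (h.hasDerivAt_velocity hm τ j).mul_const _) (fun j τ hτ => ?_)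
    ?_ (hsum t).summable ?_
  · obtain ⟨h1, h2⟩ := hL τ (Ioo_subset_Icc_self hτ)
    have hj := cast_pnat_pos j
    have hj1 := one_le_cast j
    have h3 : |position p τ j| * j ≤ √L * √(p j 0 ^ 2 + q j 0 ^ 2) := by
      rw [← Real.sqrt_mul hL0]
      refine Real.le_sqrt_of_sq_le ?_
      rw [mul_pow, sq_abs, mul_comm, sq_mul_position_sq]
      linarith [h2 j, sq_nonneg (q j τ)]
    have h4 : |(j : ℝ) ^ 2 + (m + a τ)| ≤ (1 + (|m| + A)) * (j : ℝ) ^ 2 := by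
      refine (abs_add_le _ _).trans ?_
      rw [abs_of_nonneg (by positivity : 0 ≤ (j : ℝ) ^ 2)]
      have h5 := abs_add_le m (a τ)
      have h6 : (1 : ℝ) ≤ (j : ℝ) ^ 2 := one_le_pow₀ hj1
      nlinarith [abs_nonneg m]
    have e : -((j : ℝ) ^ 4 + (m + a τ) * (j : ℝ) ^ 2) * position p τ j * coeff η j =
        -(((j : ℝ) ^ 2 + (m + a τ)) * ((j : ℝ) ^ 2 * coeff η j) * position p τ j) := by ring
    rw [e, norm_neg, norm_mul, norm_mul, norm_mul, norm_pow, Real.norm_natCast, Real.norm_eq_abs,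
      Real.norm_eq_abs, Real.norm_eq_abs, Real.rpow_one, abs_of_nonneg (Real.sqrt_nonneg _)]
    calc |(j : ℝ) ^ 2 + (m + a τ)| * ((j : ℝ) ^ 2 * |coeff η j|) * |position p τ j|
        ≤ (1 + (|m| + A)) * (j : ℝ) ^ 2 * (B * Real.pi) * |position p τ j| := by
          refine mul_le_mul_of_nonneg_right ?_ (abs_nonneg _)
          exact mul_le_mul h4 (hcoeff j) (by positivity) (by positivity)
      _ = (1 + (|m| + A)) * (B * Real.pi) * (j * (|position p τ j| * j)) := by ring
      _ ≤ (1 + (|m| + A)) * (B * Real.pi) * (j * (√L * √(p j 0 ^ 2 + q j 0 ^ 2))) := by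
          gcongr
      _ = _ := by ring
  · exact ⟨by linarith [neg_abs_le t], by linarith [le_abs_self t]⟩
  · exact ⟨by linarith [neg_abs_le t], by linarith [le_abs_self t]⟩

include hE in
theorem isWeakSolution (hm : -1 / 2 ≤ m) (hm1 : m ≤ 1) (hs : 1 / 2 < s)
    (h : IsModeSolution m univ a p q) {u₀ v₀ : ℝ → ℝ} (hu₀ : MemH (s + 2) u₀) (hv₀ : MemH s v₀)
    (hp : ∀ j : ℕ+, p j 0 = j * coeff u₀ j) (hq : ∀ j : ℕ+, q j 0 = j * coeff v₀ j / omega m j) :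
    IsWeakSolution m s u₀ v₀ univ fun t => series (position p t) := by
  refine ⟨isOpen_univ, ordConnected_univ, trivial, fun t => series (velocity m q t),
    fun t _ => memH_series (summable_position hE hm h t) (by linarith),
    fun t _ => tendsto_normH_position hE hm hs h t,
    fun t _ => memH_series (summable_velocity hE hm hm1 h t) hs,
    fun t _ => tendsto_normH_velocity hE hm hm1 hs h t,
    fun t _ => tendsto_normH_slope hE hm hm1 hs h t, fun x hx => ?_, fun x hx => ?_,
    fun η hη t _ => hasDerivAt_integral_velocity hE hm hm1 hs h hη t⟩
  · rw [hu₀.eq_series x hx]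
    refine congrFun (congrArg series (funext fun j => ?_)) x
    rw [position, hp, mul_div_cancel_left₀ _ (cast_pnat_pos j).ne']
  · rw [hv₀.eq_series x hx]
    refine congrFun (congrArg series (funext fun j => ?_)) x
    have := cast_pnat_pos j
    have := omega_pos hm j
    rw [velocity, hq]
    field_simp

end IsModeSolution

end Beam

/-! ### Norms of the data, the sup bound, and the tails -/

namespace Beam

theorem sum_inv_sq_le (F : Finset ℕ+) : ∑ j ∈ F, ((j : ℝ)⁻¹) ^ 2 ≤ Real.pi ^ 2 / 6 := by
  have h : ∑ j ∈ F, ((j : ℝ)⁻¹) ^ 2 =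
      ∑ n ∈ F.map ⟨_, PNat.coe_injective⟩, 1 / (n : ℝ) ^ 2 := by
    rw [Finset.sum_map]
    exact Finset.sum_congr rfl fun j _ => by simp
  rw [h, ← hasSum_zeta_two.tsum_eq]
  exact hasSum_zeta_two.summable.sum_le_tsum _ fun n _ => by positivity

/-- The embedding of `H¹` into the bounded functions, with its constant. -/
theorem abs_series_sq_le {c : ℕ+ → ℝ} {E : ℝ}
    (h : ∀ F : Finset ℕ+, ∑ j ∈ F, ((j : ℝ) * c j) ^ 2 ≤ E) (x : ℝ) :
    series c x ^ 2 ≤ Real.pi / 3 * E := by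
  have hE : 0 ≤ E := by simpa using h ∅
  have hpi := Real.pi_pos
  have hF : ∀ F : Finset ℕ+, ∑ j ∈ F, |c j * phi j x| ≤ √(Real.pi / 3 * E) := fun F => by
    have h1 : ∑ j ∈ F, |c j * phi j x| ≤ ∑ j ∈ F, √(2 / Real.pi) * (j : ℝ)⁻¹ * |(j : ℝ) * c j| := by
      refine Finset.sum_le_sum fun j _ => ?_
      have hj := cast_pnat_pos j
      have e : √(2 / Real.pi) * (j : ℝ)⁻¹ * |(j : ℝ) * c j| = |c j| * √(2 / Real.pi) := by
        rw [abs_mul, abs_of_pos hj]; field_simp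
      rw [e, abs_mul, phi, abs_mul, abs_of_nonneg (Real.sqrt_nonneg _)]
      exact mul_le_mul_of_nonneg_left (mul_le_of_le_one_right (Real.sqrt_nonneg _)
        (Real.abs_sin_le_one _)) (abs_nonneg _)
    refine h1.trans (Real.le_sqrt_of_sq_le ((Finset.sum_mul_sq_le_sq_mul_sq F _ _).trans ?_))
    have e : ∀ j : ℕ+, (√(2 / Real.pi) * (j : ℝ)⁻¹) ^ 2 = 2 / Real.pi * ((j : ℝ)⁻¹) ^ 2 :=
        fun j => by
      rw [mul_pow, Real.sq_sqrt (by positivity)]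
    simp_rw [e, sq_abs, ← Finset.mul_sum]
    -- The squared amplitude `2/π` times `∑ j⁻² = π²/6` gives the constant `π/3`.
    calc 2 / Real.pi * (∑ j ∈ F, ((j : ℝ)⁻¹) ^ 2) * ∑ j ∈ F, ((j : ℝ) * c j) ^ 2
        ≤ 2 / Real.pi * (Real.pi ^ 2 / 6) * E := by
          gcongr
          exacts [sum_inv_sq_le F, h F]
      _ = Real.pi / 3 * E := by field_simp; ring
  have hs : Summable fun j => |c j * phi j x| := summable_of_sum_le (fun j => abs_nonneg _) hF
  have h2 : |series c x| ≤ √(Real.pi / 3 * E) :=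
    (tsum_of_norm_bounded (f := fun j => c j * phi j x) hs.hasSum fun j => le_rfl).trans
      (hs.tsum_le_of_sum_le hF)
  have h3 := pow_le_pow_left₀ (abs_nonneg _) h2 2
  rwa [sq_abs, Real.sq_sqrt (by positivity)] at h3

variable {m s : ℝ} {u₀ v₀ : ℝ → ℝ}

theorem hasSum_normH_one (hs : 1 / 2 < s) (hu₀ : MemH (s + 2) u₀) :
    HasSum (fun j : ℕ+ => ((j : ℝ) * coeff u₀ j) ^ 2) (normH 1 u₀ ^ 2) := by
  rw [normH, Real.sq_sqrt (tsum_nonneg fun j => by positivity)]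
  have e : ∀ j : ℕ+, (j : ℝ) ^ (2 * (1 : ℝ)) * coeff u₀ j ^ 2 = ((j : ℝ) * coeff u₀ j) ^ 2 :=
    fun j => by rw [mul_one, Real.rpow_two, mul_pow]
  simp_rw [e]
  exact ((hu₀.summable_sq hs).congr fun j => (mul_pow _ _ 2).symm).hasSum

theorem mode_velocity_sq_le (hm : -1 / 2 ≤ m) (v : ℝ) (j : ℕ+) :
    ((j : ℝ) * v / omega m j) ^ 2 ≤ v ^ 2 / (1 + m) := by
  have h := omega_sq hm j
  have hp := omega_pos hm j
  have h1 : (1 : ℝ) ≤ (j : ℝ) ^ 2 := one_le_pow₀ (one_le_cast j)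
  rw [div_pow, mul_pow, div_le_div_iff₀ (by positivity) (by linarith), h]
  nlinarith [mul_nonneg (mul_nonneg (sq_nonneg (j : ℝ)) (sq_nonneg v)) (sub_nonneg.2 h1)]

theorem summable_velocity_sq (hs : 1 / 2 < s) (hv₀ : MemH s v₀) :
    Summable fun j : ℕ+ => coeff v₀ j ^ 2 := by
  have := summable_rpow_mul_sq_of_le (r := 0) hv₀.1 (by linarith)
  simpa using this

theorem hasSum_normHTilde (hm : -1 / 2 ≤ m) (hs : 1 / 2 < s) (hv₀ : MemH s v₀) :
    HasSum (fun j : ℕ+ => ((j : ℝ) * coeff v₀ j / omega m j) ^ 2) (normHTilde m v₀ ^ 2) := by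
  rw [normHTilde, Real.sq_sqrt (tsum_nonneg fun j => by positivity)]
  have e : ∀ j : ℕ+, (j : ℝ) ^ 2 / omega m j ^ 2 * coeff v₀ j ^ 2 =
    ((j : ℝ) * coeff v₀ j / omega m j) ^ 2 := fun j => by ring
  simp_rw [e]
  exact (Summable.of_nonneg_of_le (fun j => sq_nonneg _) (fun j => mode_velocity_sq_le hm _ j)
    ((summable_velocity_sq hs hv₀).div_const _)).hasSum

theorem normHTilde_sq_le (hm : -1 / 2 ≤ m) (hs : 1 / 2 < s) (hv₀ : MemH s v₀) :
    normHTilde m v₀ ^ 2 ≤ normH 0 v₀ ^ 2 / (1 + m) := by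
  have e : normH 0 v₀ ^ 2 = ∑' j : ℕ+, coeff v₀ j ^ 2 := by
    rw [normH, Real.sq_sqrt (tsum_nonneg fun j => by positivity)]
    simp
  rw [e]
  exact hasSum_le (fun j => mode_velocity_sq_le hm _ j) (hasSum_normHTilde hm hs hv₀)
    ((summable_velocity_sq hs hv₀).hasSum.div_const _)

/-- In normalized coordinates both data spaces carry the weight `j^(2(s+1))`: the position term is
`j^(2(s+2)) u_j²`, and the velocity term is `b_j² j^(2s) v_j²` with `b_j` bounded. -/
theorem summable_rpow_mul_mode_energy (hm : -1 / 2 ≤ m) (hu₀ : MemH (s + 2) u₀)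
    (hv₀ : MemH s v₀) : Summable fun j : ℕ+ => (j : ℝ) ^ (2 * (s + 1)) *
      (((j : ℝ) * coeff u₀ j) ^ 2 + ((j : ℝ) * coeff v₀ j / omega m j) ^ 2) := by
  refine Summable.of_nonneg_of_le (fun j => by positivity) (fun j => ?_)
    (hu₀.1.add (hv₀.1.mul_left (cc m ^ 2)))
  rw [mul_add]
  refine add_le_add (le_of_eq ?_) ?_
  · rw [show s + 2 = s + 1 + 1 by ring, rpow_two_mul_add_one j (s + 1), mul_pow, mul_assoc]
  · have h1 : (j : ℝ) ^ (2 * (s + 1)) * ((j : ℝ) * coeff v₀ j / omega m j) ^ 2 =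
      bcoef m j ^ 2 * ((j : ℝ) ^ (2 * s) * coeff v₀ j ^ 2) := by
      rw [rpow_two_mul_add_one, bcoef]; ring
    rw [h1]
    exact mul_le_mul_of_nonneg_right (pow_le_pow_left₀ (bcoef_pos hm j).le (bcoef_le hm j) 2)
      (by positivity)

/-- The solution of the mode equations with the given initial data, and its energy bound. -/
theorem exists_mode_solution_of_memH (hm : -1 / 2 ≤ m) (hm1 : m ≤ 1) (hm0 : m ≠ 0)
    (hs : 1 / 2 < s) (hu₀ : MemH (s + 2) u₀) (hv₀ : MemH s v₀) :
    ∃ a p q, IsModeSolution m univ a p q ∧ (∀ j : ℕ+, p j 0 = j * coeff u₀ j) ∧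
      (∀ j : ℕ+, q j 0 = j * coeff v₀ j / omega m j) ∧
      ∀ ε, 0 ≤ ε → ε ≤ eps1 m → normH 1 u₀ ^ 2 + normHTilde m v₀ ^ 2 ≤ 3 * ε ^ 2 →
        ∀ t, |t| * ε ^ 6 ≤ T1 m ε → ∀ F : Finset ℕ+, ∑ j ∈ F, p j t ^ 2 ≤ 3.5 * ε ^ 2 := by
  have hE := summable_rpow_mul_mode_energy hm hu₀ hv₀
  have hsum := (hasSum_normH_one hs hu₀).add (hasSum_normHTilde hm hs hv₀)
  obtain ⟨a, p, q, h, hp, hq, hb⟩ := exists_mode_solution hm hm1 hm0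
    (x := fun j => j * coeff u₀ j) (y := fun j => j * coeff v₀ j / omega m j) (by
      refine Summable.of_nonneg_of_le (fun j => mul_nonneg (sq_add_pos hm j).le (by positivity))
        (fun j => ?_) (hE.mul_left 2)
      rw [← mul_assoc]
      refine mul_le_mul_of_nonneg_right ?_ (by positivity)
      have h1 : (1 : ℝ) ≤ (j : ℝ) ^ 2 := one_le_pow₀ (one_le_cast j)
      have h2 : (j : ℝ) ^ (2 : ℝ) ≤ (j : ℝ) ^ (2 * (s + 1)) :=
        Real.rpow_le_rpow_of_exponent_le (one_le_cast j) (by linarith)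
      rw [Real.rpow_two] at h2
      linarith)
  refine ⟨a, p, q, h, hp, hq, fun ε hε0 hε hle t ht F => ?_⟩
  -- The long-time bound requires `ε > 0`. For `ε = 0` all data vanish and the modewise growth bound
  -- keeps every mode at zero.
  rcases hε0.eq_or_lt with rfl | hε0
  · have hzero : ∀ j, p j t ^ 2 = 0 := fun j => by
      obtain ⟨A, L, -, -, hL⟩ := h.exists_mode_bound hm |t|
      have h1 := (hL t (abs_le.1 le_rfl)).2 j
      have h2 := le_hasSum hsum j fun i _ => by positivity
      rw [hp, hq] at h1
      have h3 : ((j : ℝ) * coeff u₀ j) ^ 2 + ((j : ℝ) * coeff v₀ j / omega m j) ^ 2 = 0 :=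
        le_antisymm (by linarith) (by positivity)
      rw [h3, mul_zero] at h1
      linarith [sq_nonneg (p j t), sq_nonneg (q j t)]
    simp [hzero]
  · refine le_trans (Finset.sum_le_sum fun j _ => ?_) (hb ε hε0 hε (by rwa [hsum.tsum_eq]) t ht F)
    linarith [sq_nonneg (q j t)]

/-- A weak solution is determined by the solution of the mode equations. -/
theorem IsWeakSolution.coeff_eq {I : Set ℝ} {u : ℝ → ℝ → ℝ} {a : ℝ → ℝ} {p q : ℕ+ → ℝ → ℝ}
    (hm : -1 / 2 ≤ m) (hs : 1 / 2 < s) (hu₀ : MemH (s + 2) u₀) (hv₀ : MemH s v₀)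
    (hu : IsWeakSolution m s u₀ v₀ I u) (h : IsModeSolution m univ a p q)
    (hp : ∀ j : ℕ+, p j 0 = j * coeff u₀ j) (hq : ∀ j : ℕ+, q j 0 = j * coeff v₀ j / omega m j)
    {t : ℝ} (ht : t ∈ I) : MemH (s + 2) (u t) ∧ ∀ j : ℕ+, j * coeff (u t) j = p j t := by
  have hord := hu.2.1
  have h0 := hu.2.2.1
  obtain ⟨a', p', q', h', hp', hq', hmem, hpu⟩ := hu.exists_isModeSolution hm hs
  have hsub : uIcc 0 t ⊆ I := hord.uIcc_subset h0 ht
  have hsum := ((hasSum_normH_one hs hu₀).add (hasSum_normHTilde hm hs hv₀)).summable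
  have := (IsModeSolution.unique hm (h'.mono hsub) (h.mono (subset_univ _))
    (by simpa only [hp, hq] using hsum) (fun j => by rw [hp, hp']) (fun j => by rw [hq, hq'])).2
  exact ⟨hmem t ht, fun j => by rw [← hpu, (this j).1]⟩

/-- The constant `2.1` is admissible because `3.5 π/3 < 2.1²`. -/
theorem abs_le_of_sum_mode_sq_le {u : ℝ → ℝ} {p : ℕ+ → ℝ} {ε : ℝ} (hε : 0 ≤ ε) (hu : MemH (s + 2) u)
    (hp : ∀ j : ℕ+, j * coeff u j = p j) (h : ∀ F : Finset ℕ+, ∑ j ∈ F, p j ^ 2 ≤ 3.5 * ε ^ 2) :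
    ∀ x ∈ Icc 0 Real.pi, |u x| ≤ 2.1 * ε := by
  intro x hx
  refine abs_le_of_sq_le_sq ?_ (by positivity)
  rw [hu.eq_series x hx]
  refine (abs_series_sq_le (fun F => by simpa only [hp] using h F) x).trans ?_
  nlinarith [Real.pi_lt_d2, sq_nonneg ε]

/-- The tails of the strong norm are uniformly small on bounded time intervals. -/
theorem IsModeSolution.exists_tail_le {a : ℝ → ℝ} {p q : ℕ+ → ℝ → ℝ} (hm : -1 / 2 ≤ m)
    (h : IsModeSolution m univ a p q)
    (hE : Summable fun j : ℕ+ => (j : ℝ) ^ (2 * (s + 1)) * (p j 0 ^ 2 + q j 0 ^ 2)) (R : ℝ)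
    {δ : ℝ} (hδ : 0 < δ) : ∃ N : ℕ, 1 ≤ N ∧ ∀ t ∈ Icc (-R) R, ∀ F : Finset ℕ+,
      ∑ j ∈ F, (if (j : ℕ) ≤ N then 0 else (j : ℝ) ^ (2 * (s + 2)) * position p t j ^ 2) ≤ δ := by
  obtain ⟨A, L, -, hL0, hL⟩ := h.exists_mode_bound hm R
  set b : ℕ+ → ℝ := fun j => L * ((j : ℝ) ^ (2 * (s + 1)) * (p j 0 ^ 2 + q j 0 ^ 2)) with hb
  have hb0 : ∀ j, 0 ≤ b j := fun j => by positivity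
  have hbs : Summable b := hE.mul_left L
  have hif : ∀ (N : ℕ) (j : ℕ+), ‖if (j : ℕ) ≤ N then 0 else b j‖ ≤ b j := fun N j => by
    split_ifs
    · simpa using hb0 j
    · exact (Real.norm_of_nonneg (hb0 j)).le
  have hlim : Tendsto (fun N : ℕ => ∑' j : ℕ+, if (j : ℕ) ≤ N then 0 else b j) atTop
      (𝓝 (∑' _ : ℕ+, (0 : ℝ))) := by
    refine tendsto_tsum_of_dominated_convergence hbs (fun j => ?_)
      (Eventually.of_forall fun N j => hif N j)
    refine tendsto_const_nhds.congr' ?_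
    filter_upwards [eventually_ge_atTop (j : ℕ)] with N hN
    rw [if_pos hN]
  rw [tsum_zero] at hlim
  obtain ⟨N, hN, hN1⟩ := ((hlim.eventually_lt_const hδ).and (eventually_ge_atTop 1)).exists
  refine ⟨N, hN1, fun t ht F => ?_⟩
  refine le_trans (Finset.sum_le_sum fun j _ => ?_) (le_trans
    ((Summable.of_norm_bounded hbs (hif N)).sum_le_tsum F fun j _ => ?_) hN.le)
  · split_ifs
    · exact le_rfl
    · exact rpow_mul_position_sq_le (hL t ht).2 j
  · split_ifs
    exacts [le_rfl, hb0 j]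

/-- The low modes contribute at most `3.5 ε²` and the tail `0.5 ε²`, together `(2ε)²`. -/
theorem normHN_le_two_mul {u : ℝ → ℝ} {p : ℕ+ → ℝ → ℝ} {ε t : ℝ} {N : ℕ} (hε : 0 ≤ ε)
    (hp : ∀ j : ℕ+, j * coeff u j = p j t)
    (h : ∀ F : Finset ℕ+, ∑ j ∈ F, p j t ^ 2 ≤ 3.5 * ε ^ 2)
    (hN : ∀ F : Finset ℕ+, ∑ j ∈ F, (if (j : ℕ) ≤ N then 0 else
      (j : ℝ) ^ (2 * (s + 2)) * IsModeSolution.position p t j ^ 2) ≤ 0.5 * ε ^ 2) :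
    normHN (s + 2) N u ≤ 2 * ε := by
  refine Real.sqrt_le_iff.2 ⟨by positivity, ?_⟩
  refine tsum_le_of_sum_le' (by positivity) fun F => ?_
  have hpos : ∀ j, coeff u j = IsModeSolution.position p t j := fun j => by
    rw [IsModeSolution.position, ← hp, mul_div_cancel_left₀ _ (cast_pnat_pos j).ne']
  have : ∑ j ∈ F, (if (j : ℕ) ≤ N then (j : ℝ) ^ 2 else (j : ℝ) ^ (2 * (s + 2))) * coeff u j ^ 2 ≤
      ∑ j ∈ F, (p j t ^ 2 + if (j : ℕ) ≤ N then 0 else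
        (j : ℝ) ^ (2 * (s + 2)) * IsModeSolution.position p t j ^ 2) := by
    refine Finset.sum_le_sum fun j _ => ?_
    split_ifs
    · rw [add_zero, ← hp, mul_pow]
    · rw [hpos]
      linarith [sq_nonneg (p j t)]
  rw [Finset.sum_add_distrib] at this
  linarith [h F, hN F]

end Beam

/-- Existence of the weak solution, the sup-norm bound in terms of
`ε = max {|u₀|₁, |v₀|₀ / (1+m)}`, and the sharper form in terms of
`ε = max {|u₀|₁, |v₀|_{H̃^{-1}}}`, where `N` depends on the data only.
The condition `|t| ≤ T₁ ε^{-6}` is written `|t| ε⁶ ≤ T₁`; for `ε = 0` it holds for all `t`. -/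
theorem theorem2 (m s : ℝ) (hm : -1 / 2 ≤ m) (hm1 : m ≤ 1) (hm0 : m ≠ 0) (hs : 1 / 2 < s)
    (u₀ v₀ : ℝ → ℝ) (hu₀ : Beam.MemH (s + 2) u₀) (hv₀ : Beam.MemH s v₀) :
    (∃ u : ℝ → ℝ → ℝ, Beam.IsWeakSolution m s u₀ v₀ Set.univ u) ∧
    (∀ ε : ℝ, ε = max (Beam.normH 1 u₀) (Beam.normH 0 v₀ / (1 + m)) → ε ≤ Beam.eps1 m →
      ∀ (I : Set ℝ) (u : ℝ → ℝ → ℝ), Beam.IsWeakSolution m s u₀ v₀ I u →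
        ∀ t ∈ I, |t| * ε ^ 6 ≤ Beam.T1 m ε →
          ∀ x ∈ Set.Icc 0 Real.pi, |u t x| ≤ 2.1 * ε) ∧
    (∀ ε : ℝ, ε = max (Beam.normH 1 u₀) (Beam.normHTilde m v₀) → ε ≤ Beam.eps1 m →
      ∃ N : ℕ, 1 ≤ N ∧
        ∀ (I : Set ℝ) (u : ℝ → ℝ → ℝ), Beam.IsWeakSolution m s u₀ v₀ I u →
          ∀ t ∈ I, |t| * ε ^ 6 ≤ Beam.T1 m ε →
            Beam.MemH (s + 2) (u t) ∧
            Beam.normHN (s + 2) N (u t) ≤ 2 * ε ∧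
            ∀ x ∈ Set.Icc 0 Real.pi, |u t x| ≤ 2.1 * ε) := by
  have h1m : 0 < 1 + m := by linarith
  obtain ⟨a, p, q, h, hp, hq, hb⟩ :=
    Beam.exists_mode_solution_of_memH hm hm1 hm0 hs hu₀ hv₀
  have hE : Summable fun j : ℕ+ => (j : ℝ) ^ (2 * (s + 1)) * (p j 0 ^ 2 + q j 0 ^ 2) := by
    simp_rw [hp, hq]
    exact Beam.summable_rpow_mul_mode_energy hm hu₀ hv₀
  refine ⟨⟨_, Beam.IsModeSolution.isWeakSolution hE hm hm1 hs h hu₀ hv₀ hp hq⟩, ?_, ?_⟩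
  · intro ε hε hε1 I u hu t ht htε
    have hu1 : Beam.normH 1 u₀ ≤ ε := hε ▸ le_max_left _ _
    have hv1 : Beam.normH 0 v₀ / (1 + m) ≤ ε := hε ▸ le_max_right _ _
    have hu_nonneg : 0 ≤ Beam.normH 1 u₀ := Real.sqrt_nonneg _
    have hv_nonneg : 0 ≤ Beam.normH 0 v₀ := Real.sqrt_nonneg _
    have hε0 : 0 ≤ ε := hu_nonneg.trans hu1
    obtain ⟨hmem, hcoeff⟩ := hu.coeff_eq hm hs hu₀ hv₀ h hp hq ht
    refine Beam.abs_le_of_sum_mode_sq_le hε0 hmem hcoeff (hb ε hε0 hε1 ?_ t htε)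
    -- The velocity part of the initial energy is at most `(1 + m) ε²`, so the total is at most `(2
    -- + m) ε² ≤ 3 ε²`; this explains the constant `3` in the energy bound.
    have h1 := pow_le_pow_left₀ hu_nonneg hu1 2
    have h2 := Beam.normHTilde_sq_le hm hs hv₀
    have h3 := pow_le_pow_left₀ (div_nonneg hv_nonneg h1m.le) hv1 2
    have h4 : Beam.normH 0 v₀ ^ 2 / (1 + m) = (1 + m) * (Beam.normH 0 v₀ / (1 + m)) ^ 2 := by
      field_simp
    nlinarith [mul_le_mul_of_nonneg_left h3 h1m.le, sq_nonneg ε]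
  · intro ε hε hε1
    have hu1 : Beam.normH 1 u₀ ≤ ε := hε ▸ le_max_left _ _
    have hv1 : Beam.normHTilde m v₀ ≤ ε := hε ▸ le_max_right _ _
    have hu_nonneg : 0 ≤ Beam.normH 1 u₀ := Real.sqrt_nonneg _
    have hε0 : 0 ≤ ε := hu_nonneg.trans hu1
    have hsmall := hb ε hε0 hε1 (by
      have h1 := pow_le_pow_left₀ hu_nonneg hu1 2
      have h2 := pow_le_pow_left₀ (Real.sqrt_nonneg _) hv1 2
      simp only [Beam.normHTilde] at h2 ⊢
      nlinarith [sq_nonneg ε])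
    obtain ⟨N, hN1, hN⟩ : ∃ N : ℕ, 1 ≤ N ∧ ∀ t, |t| * ε ^ 6 ≤ Beam.T1 m ε → ∀ F : Finset ℕ+,
        ∑ j ∈ F, (if (j : ℕ) ≤ N then 0 else
          (j : ℝ) ^ (2 * (s + 2)) * Beam.IsModeSolution.position p t j ^ 2) ≤ 0.5 * ε ^ 2 := by
      -- For `ε = 0` the time interval is unbounded, but the solution is zero and any `N` will do.
      -- For `ε > 0` the interval is bounded and the tails are uniformly small on it; they belong to
      -- the one mode solution, so `N` does not depend on `I` or `u`.
      rcases hε0.eq_or_lt with h0 | h0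
      · refine ⟨1, le_rfl, fun t ht F => (Finset.sum_nonpos fun j _ => ?_).trans (by positivity)⟩
        have h1 := hsmall t ht {j}
        rw [Finset.sum_singleton, ← h0] at h1
        have h2 : p j t = 0 := by
          rw [← sq_eq_zero_iff]
          linarith [sq_nonneg (p j t)]
        simp [Beam.IsModeSolution.position, h2]
      · obtain ⟨N, hN1, hN⟩ := Beam.IsModeSolution.exists_tail_le hm h hE (Beam.T1 m ε / ε ^ 6)
          (δ := 0.5 * ε ^ 2) (by positivity)
        exact ⟨N, hN1, fun t ht => hN t (abs_le.1 (by rwa [le_div_iff₀ (by positivity)]))⟩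
    refine ⟨N, hN1, fun I u hu t ht htε => ?_⟩
    obtain ⟨hmem, hcoeff⟩ := hu.coeff_eq hm hs hu₀ hv₀ h hp hq ht
    exact ⟨hmem, Beam.normHN_le_two_mul hε0 hcoeff (hsmall t htε) (hN t htε),
      Beam.abs_le_of_sum_mode_sq_le hε0 hmem hcoeff (hsmall t htε)⟩
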